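/- **Transformation and expansion.** For $t\in\mathbb{R}$ let $\langle t\rangle=\{t\}$ if $t\notin\mathbb{Z}$ and $\langle t\rangle=1$ if $t\in\mathbb{Z}$. For $\beta>1$ let $\overline T_\beta(x)=\langle\beta x\rangle$ for $x\in[0,1]$, and $\overline d_\beta(x)=x_1x_2\cdots$ with $x_i=\lceil\beta\,\overline T_\beta^{\,i-1}(x)\rceil-1$. A set $S\subset[0,1]$ is *invariant* if $\overline T_\beta(S)=S$, and it has *frequency* $\alpha$ if $\lim_n\frac1n\sum_{k=1}^n x_k=\alpha$ for every $x\in S$, where $\overline d_\beta(x)=x_1x_2\cdots$. An *orbit closure* is the closure of $\{\overline T_\beta^n(x):n\ge0\}$ for some $x\in[0,1]$. **$\Xi$.** For $\alpha>0$ and $\beta>1$, $\Xi(\alpha,\beta)$ is the maximum of an invariant orbit closure of $\overline T_\beta$ that has frequency $\alpha$ and is contained in an interval $[t,t+\frac1\beta]\subset[0,1]$. It is *not defined* if there is no such orbit closure, and *well defined* if there is exactly one (and its maximum exists). **Words.** For $\alpha\ge0$ and $0\le\rho\le1$, the lower and upper mechanical words of slope $\alpha$ and intercept $\rho$ are $s_{\alpha,\rho}(n)=\lfloor\alpha(n+1)+\rho\rfloor-\lfloor\alpha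 n+\rho\rfloor$ and $s'_{\alpha,\rho}(n)=\lceil\alpha(n+1)+\rho\rceil-\lceil\alpha n+\rho\rceil$, $n\ge0$. Words are compared lexicographically. For an integer $a$ and $b=a+1$, a finite word $z$ is *central* over $\{a,b\}$ if, for some coprime integers $p$ and $q\ge1$ with $a<p/q<b$, the first $q$ letters of $s_{p/q,0}$ form the word $azb$. Write $|w|_b$ for the number of letters $b$ in $w$. **$\Delta$.** For $\alpha>0$, $\Delta(\alpha)$ is the number $\beta>1$ with $\overline d_\beta(1)=s'_{\alpha,0}$. **$\mathrm{Freq}$.** If $\beta>1$ is an integer, $\mathrm{Freq}(\beta)=\beta-1$. Otherwise let $b=\lfloor\beta\rfloor$ and $a=b-1$, and write $\overline d_\beta(1)=bs$. 1. $\mathrm{Freq}(\beta)=a$ if $s\le a^\omega$; $\mathrm{Freq}(\beta)=b$ if $s\ge b^\omega$; $\mathrm{Freq}(\beta)=\alpha$ if $as=s_{\alpha,0}$ or $bs=s'_{\alpha,0}$ with $\alpha\in[a,b]$. 2. In all other cases let $u$ be the longest prefix of $s$ that is central over $\{a,b\}$. * If $u=a^k$ with $k\ge1$, let $v$ be the block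 of length $k+1$ that follows $u$ in $s$. Then $\mathrm{Freq}(\beta)=a+\frac1{k+2}$ if $a^{k+1}<v<ba^k$, and $\mathrm{Freq}(\beta)=a+\frac1{k+1}$ if $v>ba^k$. * If $u=b^k$ with $k\ge1$, let $v$ be the block of length $k+1$ that follows $u$ in $s$. Then $\mathrm{Freq}(\beta)=b-\frac1{k+2}$ if $ab^k<v<b^{k+1}$, and $\mathrm{Freq}(\beta)=b-\frac1{k+1}$ if $v<ab^k$. * If $u=pabq=qbap$ with $p,q$ central over $\{a,b\}$, let $s=uxyv\cdots$ with letters $x,y$ and a word $v$ of length $|u|+2$, and put $\varphi(w)=a+\frac{|w|_b+1}{|w|+2}$. Then $\mathrm{Freq}(\beta)=\varphi(u)$ if ($xy=ab$ and $v>uab$), or $ab<xy<ba$, or ($xy=ba$ and $v<uba$); $\mathrm{Freq}(\beta)=\varphi(q)$ if ($xy=ab$ and $v<uab$), or $xy\le aa$; $\mathrm{Freq}(\beta)=\varphi(p)$ if ($xy=ba$ and $v>uba$), or $xy\ge bb$. **Theorem.** (a) Let $\beta>1$. These rules determine exactly one number $\mathrm{Freq}(\beta)$. The function $\Xi(\alpha,\beta)$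 is well defined for every $0<\alpha\le\mathrm{Freq}(\beta)$, and it is not defined for any $\alpha>\mathrm{Freq}(\beta)$. (b) Let $\alpha>0$. There is exactly one number $\Delta(\alpha)$ as above. The function $\Xi(\alpha,\beta)$ is well defined for every $\beta\ge\Delta(\alpha)$, and it is not defined for any $1<\beta<\Delta(\alpha)$. (c) Let $\beta>1$. If $\overline d_\beta(1)$ is a (lower or upper) mechanical word of slope $\alpha_0$, then $\Xi(\alpha,\beta)$ is well defined for every $0<\alpha\le\alpha_0$. -/

import Mathlib

namespace BetaOrbit

/-- `⟨t⟩`: the fractional part of `t`, except that it is `1` when `t` is an integer. -/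
noncomputable def angle (t : ℝ) : ℝ :=
  if Int.fract t = 0 then 1 else Int.fract t

/-- The transformation `x ↦ ⟨β x⟩`, considered on `[0,1]`. -/
noncomputable def Tbar (β x : ℝ) : ℝ := angle (β * x)

/-- The expansion of `x` associated with `Tbar β`; the digits are indexed from `0`. -/
noncomputable def dbar (β x : ℝ) : ℕ → ℤ := fun i => ⌈β * (Tbar β)^[i] x⌉ - 1

/-- The point `x` has frequency `α` in base `β`: the digit averages converge to `α`. -/
def HasFreq (β x α : ℝ) : Prop :=
  Filter.Tendsto (fun n : ℕ => (∑ k ∈ Finset.range n, (dbar β x k : ℝ)) / (n : ℝ))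
    Filter.atTop (nhds α)

/-- The closure of the forward orbit of `x` under `Tbar β`. -/
def orbitClosure (β x : ℝ) : Set ℝ := closure (Set.range fun n : ℕ => (Tbar β)^[n] x)

/-- `S` is an invariant orbit closure, contained in an interval `[t, t + 1/β] ⊆ [0,1]`, all of
whose points have frequency `α`. -/
def IsXiSet (α β : ℝ) (S : Set ℝ) : Prop :=
  (∃ x ∈ Set.Icc (0 : ℝ) 1, S = orbitClosure β x) ∧
  Tbar β '' S = S ∧
  (∃ t : ℝ, S ⊆ Set.Icc t (t + 1 / β) ∧ Set.Icc t (t + 1 / β) ⊆ Set.Icc 0 1) ∧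
  ∀ x ∈ S, HasFreq β x α

/-- `ξ` is a value of `Ξ` at `(α, β)`: the maximum of an orbit closure as above. -/
def IsXi (α β ξ : ℝ) : Prop := ∃ S, IsXiSet α β S ∧ IsGreatest S ξ

/-- `Ξ(α, β)` is well defined: there is exactly one orbit closure as above, and it has
a maximum, which is then the unique value of `Ξ`. -/
def XiWellDefined (α β : ℝ) : Prop := (∃! S, IsXiSet α β S) ∧ ∃! ξ, IsXi α β ξ

/-- The lower mechanical word of slope `α` and intercept `ρ`. -/
noncomputable def lowerMech (α ρ : ℝ) : ℕ → ℤ := fun n => ⌊α * (n + 1) + ρ⌋ - ⌊α * n + ρ⌋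

/-- The upper mechanical word of slope `α` and intercept `ρ`. -/
noncomputable def upperMech (α ρ : ℝ) : ℕ → ℤ := fun n => ⌈α * (n + 1) + ρ⌉ - ⌈α * n + ρ⌉

/-- `w` is a (lower or upper) mechanical word of slope `α`. -/
def IsMechanical (w : ℕ → ℤ) (α : ℝ) : Prop :=
  0 ≤ α ∧ ∃ ρ ∈ Set.Icc (0 : ℝ) 1, w = lowerMech α ρ ∨ w = upperMech α ρ

/-- `δ = Δ(α)`: `Δ(0) = 1`, and for `α > 0` it is the base `δ > 1` in which the expansion of `1` is
the upper mechanical word of slope `α` and intercept `0`. -/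
def IsDelta (α δ : ℝ) : Prop :=
  (α = 0 ∧ δ = 1) ∨ (0 < α ∧ 1 < δ ∧ dbar δ 1 = upperMech α 0)

/-- The infinite word `c s`, for a letter `c` and an infinite word `s`. -/
def cons (c : ℤ) (s : ℕ → ℤ) : ℕ → ℤ
  | 0 => c
  | n + 1 => s n

/-- The block of length `n` of the infinite word `s` that starts at position `i`. -/
def block (s : ℕ → ℤ) (i n : ℕ) : List ℤ := (List.range n).map fun j => s (i + j)

/-- `u` is a central word over `{a, a+1}`: `a u (a+1)` is a lower Christoffel word, i.e. the
period of length `q` of the lower mechanical word of slope `p/q`, with `a < p/q < a+1` in lowest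
terms. -/
def IsCentral (a : ℤ) (u : List ℤ) : Prop :=
  ∃ (p : ℤ) (q : ℕ), 0 < q ∧ IsCoprime p (q : ℤ) ∧ a * q < p ∧ p < (a + 1) * q ∧
    a :: (u ++ [a + 1]) = block (lowerMech ((p : ℝ) / (q : ℝ)) 0) 0 q

/-- `u` is the longest prefix of `s` that is a central word over `{a, a+1}`. -/
def IsLongestCentralPrefix (a : ℤ) (s : ℕ → ℤ) (u : List ℤ) : Prop :=
  (IsCentral a u ∧ block s 0 u.length = u) ∧
  ∀ w : List ℤ, IsCentral a w → block s 0 w.length = w → w.length ≤ u.length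

/-- The three special cases. Infinite words are compared lexicographically. -/
inductive MeagerFreq (a : ℤ) (s : ℕ → ℤ) : ℝ → Prop
  | low : toLex s ≤ toLex (fun _ => a) → MeagerFreq a s a
  | high : toLex (fun _ => a + 1) ≤ toLex s → MeagerFreq a s (a + 1)
  | mech (α : ℝ) : α ∈ Set.Icc (a : ℝ) (a + 1) →
      (cons a s = lowerMech α 0 ∨ cons (a + 1) s = upperMech α 0) → MeagerFreq a s α

/-- The generic cases, where `u` is the longest central prefix of `s`. Finite words of the
same length are compared lexicographically. -/
inductive GenericFreq (a : ℤ) (s : ℕ → ℤ) (u : List ℤ) : ℝ → Prop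
  | powA_low (k : ℕ) : 1 ≤ k → u = List.replicate k a →
      List.replicate (k + 1) a < block s k (k + 1) →
      block s k (k + 1) < (a + 1) :: List.replicate k a →
      GenericFreq a s u (a + 1 / (k + 2))
  | powA_high (k : ℕ) : 1 ≤ k → u = List.replicate k a →
      (a + 1) :: List.replicate k a < block s k (k + 1) →
      GenericFreq a s u (a + 1 / (k + 1))
  | powB_high (k : ℕ) : 1 ≤ k → u = List.replicate k (a + 1) →
      a :: List.replicate k (a + 1) < block s k (k + 1) →
      block s k (k + 1) < List.replicate (k + 1) (a + 1) →
      GenericFreq a s u (a + 1 - 1 / (k + 2))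
  | powB_low (k : ℕ) : 1 ≤ k → u = List.replicate k (a + 1) →
      block s k (k + 1) < a :: List.replicate k (a + 1) →
      GenericFreq a s u (a + 1 - 1 / (k + 1))
  | mixed_u (p q xy v : List ℤ) : IsCentral a p → IsCentral a q →
      u = p ++ [a, a + 1] ++ q → u = q ++ [a + 1, a] ++ p →
      xy = block s u.length 2 → v = block s (u.length + 2) (u.length + 2) →
      ((xy = [a, a + 1] ∧ u ++ [a, a + 1] < v) ∨ ([a, a + 1] < xy ∧ xy < [a + 1, a]) ∨
        (xy = [a + 1, a] ∧ v < u ++ [a + 1, a])) →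
      GenericFreq a s u (a + ((u.count (a + 1) : ℝ) + 1) / ((u.length : ℝ) + 2))
  | mixed_q (p q xy v : List ℤ) : IsCentral a p → IsCentral a q →
      u = p ++ [a, a + 1] ++ q → u = q ++ [a + 1, a] ++ p →
      xy = block s u.length 2 → v = block s (u.length + 2) (u.length + 2) →
      ((xy = [a, a + 1] ∧ v < u ++ [a, a + 1]) ∨ xy ≤ [a, a]) →
      GenericFreq a s u (a + ((q.count (a + 1) : ℝ) + 1) / ((q.length : ℝ) + 2))
  | mixed_p (p q xy v : List ℤ) : IsCentral a p → IsCentral a q →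
      u = p ++ [a, a + 1] ++ q → u = q ++ [a + 1, a] ++ p →
      xy = block s u.length 2 → v = block s (u.length + 2) (u.length + 2) →
      ((xy = [a + 1, a] ∧ u ++ [a + 1, a] < v) ∨ [a + 1, a + 1] ≤ xy) →
      GenericFreq a s u (a + ((p.count (a + 1) : ℝ) + 1) / ((p.length : ℝ) + 2))

/-- The frequency `φ` attached to the infinite word `s` and the letters `a`, `b = a + 1`. -/
def WordFreq (a : ℤ) (s : ℕ → ℤ) (φ : ℝ) : Prop :=
  MeagerFreq a s φ ∨
  ((∀ ψ, ¬ MeagerFreq a s ψ) ∧ ∃ u, IsLongestCentralPrefix a s u ∧ GenericFreq a s u φ)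

/-- `φ = Freq(β)`: for an integer `β` it is `β - 1`; otherwise the expansion of `1` is `b s` with
`b = ⌊β⌋`, and `φ` is the frequency attached to `s` and the letters `b - 1`, `b`. -/
def IsFreq (β φ : ℝ) : Prop :=
  ((∃ m : ℤ, β = m) ∧ φ = β - 1) ∨
  ((¬ ∃ m : ℤ, β = m) ∧ ∃ s : ℕ → ℤ, dbar β 1 = cons ⌊β⌋ s ∧ WordFreq (⌊β⌋ - 1) s φ)

end BetaOrbit

open BetaOrbit

/-!
An orbit closure `S` inside an interval of length `1 / β` is ordered like a set on a circle: the
lift of `Tbar β` to `S + ℤ` is monotone of degree one, so the frequency is a rotation number and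
the maximum of `S` has the upper mechanical word of slope `α` as its expansion. Conversely that word
generates such an orbit closure as soon as it is admissible in base `β`. Hence `Ξ(α, β)` is well
defined exactly when `upperMech α 0` is lexicographically at most `dbar β 1`, and both sides are
strictly increasing, in `α` and in `β` respectively.

It remains to see that `Freq(β)` is the largest `α` with `upperMech α 0 ≤ dbar β 1`. The words
starting with `b` for which this largest slope is a given rational number form an interval, bounded
by the upper and the lower mechanical word of that slope with the first letter set to `b`. Locating
`dbar β 1` among these intervals descends the Farey tree, whose nodes are the central words.
-/

namespace BetaOrbit

open Filter Topology

section Lex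

variable {A : Type*} [LinearOrder A]

lemma toLex_lt_iff {w v : ℕ → A} :
    toLex w < toLex v ↔ ∃ i, (∀ j < i, w j = v j) ∧ w i < v i := Iff.rfl

lemma eq_or_exists_first_ne (w v : ℕ → A) : w = v ∨ ∃ i, (∀ j < i, w j = v j) ∧ w i ≠ v i := by
  rcases lt_trichotomy (toLex w) (toLex v) with ⟨i, hi, hlt⟩ | h | ⟨i, hi, hlt⟩
  · exact Or.inr ⟨i, hi, hlt.ne⟩
  · exact Or.inl (toLex_inj.1 h)
  · exact Or.inr ⟨i, fun j hj => (hi j hj).symm, hlt.ne'⟩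

lemma exists_first_lt_of_le_of_lt {u v w : ℕ → A} {N : ℕ} (huv : toLex u ≤ toLex v)
    (hvw : ∀ k < N, v k = w k) (hN : v N < w N) :
    ∃ j ≤ N, (∀ k < j, u k = w k) ∧ u j < w j := by
  rcases huv.eq_or_lt with h | ⟨i, hi, hlt⟩
  · obtain rfl := toLex_inj.1 h
    exact ⟨N, le_rfl, hvw, hN⟩
  · rcases lt_trichotomy i N with hiN | rfl | hiN
    · exact ⟨i, hiN.le, fun k hk => (hi k hk).trans (hvw k (hk.trans hiN)),
        hlt.trans_eq (hvw i hiN)⟩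
    · exact ⟨i, le_rfl, fun k hk => (hi k hk).trans (hvw k hk), hlt.trans hN⟩
    · exact ⟨N, le_rfl, fun k hk => (hi k (hk.trans hiN)).trans (hvw k hk),
        (hi N hiN).trans_lt hN⟩

end Lex

/-- The sum of the first `n` letters of an infinite word. Words are compared through their partial
sums, which are simpler than the letters for mechanical words and for `Tbar`-expansions alike. -/
def psum (w : ℕ → ℤ) (n : ℕ) : ℤ := ∑ k ∈ Finset.range n, w k

/-- The infinite word obtained by deleting the first `i` letters. -/
def shift (w : ℕ → ℤ) (i : ℕ) : ℕ → ℤ := fun n => w (n + i)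

/-- The averages of the letters of `w` converge to `α`. -/
def HasMean (w : ℕ → ℤ) (α : ℝ) : Prop :=
  Tendsto (fun n : ℕ => (psum w n : ℝ) / n) atTop (𝓝 α)

section PartialSums

variable {w v : ℕ → ℤ}

lemma psum_zero (w : ℕ → ℤ) : psum w 0 = 0 := Finset.sum_range_zero _

lemma psum_succ (w : ℕ → ℤ) (n : ℕ) : psum w (n + 1) = psum w n + w n :=
  Finset.sum_range_succ _ _

lemma psum_shift (w : ℕ → ℤ) (i n : ℕ) : psum (shift w i) n = psum w (n + i) - psum w i := by
  rw [add_comm n i, psum, psum, psum, Finset.sum_range_add, add_sub_cancel_left]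
  simp only [shift, add_comm]

lemma shift_shift (w : ℕ → ℤ) (i j : ℕ) : shift (shift w i) j = shift w (j + i) := by
  funext n; simp only [shift, add_assoc]

lemma psum_cons_succ (c : ℤ) (s : ℕ → ℤ) (n : ℕ) : psum (cons c s) (n + 1) = c + psum s n := by
  rw [psum, Finset.sum_range_succ', add_comm]; rfl

lemma eq_of_psum (h : ∀ n, psum w n = psum v n) : w = v := by
  funext n
  have h1 := h (n + 1)
  rw [psum_succ, psum_succ, h n] at h1
  exact add_left_cancel h1

lemma psum_congr {n : ℕ} (h : ∀ k < n, w k = v k) : psum w n = psum v n :=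
  Finset.sum_congr rfl fun k hk => h k (Finset.mem_range.1 hk)

lemma toLex_le_of_psum_le (h : ∀ n, psum w n ≤ psum v n) : toLex w ≤ toLex v := by
  by_contra! hlt
  obtain ⟨i, hi, hlt⟩ := toLex_lt_iff.1 hlt
  have h1 := h (i + 1)
  rw [psum_succ, psum_succ, psum_congr hi] at h1
  exact absurd hlt (by linarith)

lemma toLex_lt_of_psum_le (h : ∀ n, psum w n ≤ psum v n) {m : ℕ} (hm : psum w m < psum v m) :
    toLex w < toLex v :=
  (toLex_le_of_psum_le h).lt_of_ne fun h' => hm.ne (by rw [toLex_inj.1 h'])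

lemma exists_ge_psum_le_mul {γ : ℝ}
    (h : ∀ i, ∃ j, (psum w (i + (j + 1)) : ℝ) ≤ psum w i + γ * (j + 1 : ℕ)) (m : ℕ) :
    ∃ n ≥ m, (psum w n : ℝ) ≤ γ * n := by
  induction m with
  | zero => exact ⟨0, le_rfl, by simp [psum_zero]⟩
  | succ m ih =>
    obtain ⟨n, hn, hle⟩ := ih
    obtain ⟨j, hj⟩ := h n
    exact ⟨n + (j + 1), by omega, by push_cast at hj ⊢; linarith⟩

lemma HasMean.le_of_frequently {α γ : ℝ} (hw : HasMean w α)
    (h : ∀ m, ∃ n ≥ m, (psum w n : ℝ) ≤ γ * n) : α ≤ γ := by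
  by_contra! hlt
  obtain ⟨m, hm⟩ := eventually_atTop.1 (hw.eventually_const_lt hlt)
  obtain ⟨n, hn, hle⟩ := h (m + 1)
  have hn0 : (0 : ℝ) < n := by exact_mod_cast (by omega : 0 < n)
  exact absurd hle (not_le.2 ((lt_div_iff₀ hn0).1 (hm n (by omega))))

lemma hasMean_of_abs_sub_le {α C : ℝ} (h : ∀ n : ℕ, |(psum w n : ℝ) - α * n| ≤ C) :
    HasMean w α := by
  rw [HasMean, tendsto_iff_norm_sub_tendsto_zero]
  refine squeeze_zero' (Eventually.of_forall fun _ => norm_nonneg _) ?_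
    (tendsto_const_div_atTop_nhds_zero_nat C)
  filter_upwards [eventually_gt_atTop 0] with n hn
  have hn0 : (0 : ℝ) < n := by exact_mod_cast hn
  rw [Real.norm_eq_abs, div_sub' hn0.ne', abs_div, abs_of_pos hn0, mul_comm (n : ℝ)]
  gcongr
  exact h n

end PartialSums

section Mechanical

lemma psum_lowerMech (α ρ : ℝ) (n : ℕ) : psum (lowerMech α ρ) n = ⌊α * n + ρ⌋ - ⌊ρ⌋ := by
  simpa [psum, lowerMech] using Finset.sum_range_sub (fun n : ℕ => ⌊α * n + ρ⌋) n

lemma psum_upperMech (α ρ : ℝ) (n : ℕ) : psum (upperMech α ρ) n = ⌈α * n + ρ⌉ - ⌈ρ⌉ := by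
  simpa [psum, upperMech] using Finset.sum_range_sub (fun n : ℕ => ⌈α * n + ρ⌉) n

lemma psum_lowerMech_zero (α : ℝ) (n : ℕ) : psum (lowerMech α 0) n = ⌊α * n⌋ := by
  simp [psum_lowerMech]

lemma psum_upperMech_zero (α : ℝ) (n : ℕ) : psum (upperMech α 0) n = ⌈α * n⌉ := by
  simp [psum_upperMech]

lemma psum_shift_upperMech (α : ℝ) (i n : ℕ) :
    psum (shift (upperMech α 0) i) n = ⌈α * n + α * i⌉ - ⌈α * i⌉ := by
  rw [psum_shift, psum_upperMech_zero, psum_upperMech_zero, Nat.cast_add, mul_add]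

lemma psum_shift_upperMech_le (α : ℝ) (i n : ℕ) :
    psum (shift (upperMech α 0) i) n ≤ ⌈α * n⌉ := by
  rw [psum_shift_upperMech]
  linarith [Int.ceil_add_le (α * n) (α * i)]

lemma le_psum_shift_upperMech (α : ℝ) (i n : ℕ) :
    ⌈α * n⌉ - 1 ≤ psum (shift (upperMech α 0) i) n := by
  rw [psum_shift_upperMech]
  linarith [Int.ceil_add_ceil_le (α * n) (α * i)]

lemma shift_upperMech_le (α : ℝ) (i : ℕ) :
    toLex (shift (upperMech α 0) i) ≤ toLex (upperMech α 0) :=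
  toLex_le_of_psum_le fun n => by
    rw [psum_upperMech_zero]; exact psum_shift_upperMech_le α i n

lemma upperMech_nonneg {α : ℝ} (hα : 0 ≤ α) (ρ : ℝ) (n : ℕ) : 0 ≤ upperMech α ρ n :=
  sub_nonneg.2 (Int.ceil_le_ceil (by linarith))

lemma upperMech_le (α : ℝ) (n : ℕ) : upperMech α 0 n ≤ ⌈α⌉ := by
  simpa [psum, shift] using psum_shift_upperMech_le α n 1

lemma floor_mul_lt_ceil_mul {α γ : ℝ} (h : α < γ) {n : ℕ} (hn : 0 < n) :
    ⌊α * n⌋ < ⌈γ * n⌉ := by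
  have hlt : α * n < γ * n := mul_lt_mul_of_pos_right h (by exact_mod_cast hn)
  exact_mod_cast (Int.floor_le _).trans_lt (hlt.trans_le (Int.le_ceil _))

lemma exists_floor_add_one_lt_ceil {α γ : ℝ} (h : α < γ) :
    ∃ n : ℕ, ⌊α * n⌋ + 1 < ⌈γ * n⌉ := by
  obtain ⟨n, hn⟩ := exists_nat_gt (1 / (γ - α))
  rw [div_lt_iff₀ (sub_pos.2 h)] at hn
  have h1 : ((⌊α * n⌋ + 1 : ℤ) : ℝ) < ⌈γ * n⌉ := by
    push_cast
    linarith [Int.floor_le (α * n), Int.le_ceil (γ * n)]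
  exact ⟨n, by exact_mod_cast h1⟩

lemma upperMech_strictMono : StrictMono fun α : ℝ => toLex (upperMech α 0) := by
  intro α γ h
  obtain ⟨n, hn⟩ := exists_floor_add_one_lt_ceil h
  refine toLex_lt_of_psum_le (fun n => ?_) (m := n) ?_ <;>
    rw [psum_upperMech_zero, psum_upperMech_zero]
  · exact Int.ceil_le_ceil (by gcongr)
  · exact (Int.ceil_le_floor_add_one _).trans_lt hn

lemma exists_lt_forall_ceil_sub_one_le (α : ℝ) (N : ℕ) :
    ∃ γ < α, ∀ j ≤ N, ((⌈α * (j + 1 : ℕ)⌉ - 1 : ℤ) : ℝ) ≤ γ * (j + 1 : ℕ) := by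
  have near : ∀ j : ℕ, ∀ᶠ γ in 𝓝[<] α,
      ((⌈α * (j + 1 : ℕ)⌉ - 1 : ℤ) : ℝ) ≤ γ * (j + 1 : ℕ) := fun j => by
    have hlt : ((⌈α * (j + 1 : ℕ)⌉ - 1 : ℤ) : ℝ) < α * (j + 1 : ℕ) := by
      push_cast; linarith [Int.ceil_lt_add_one (α * ((j : ℝ) + 1))]
    have hc : Tendsto (fun γ : ℝ => γ * (j + 1 : ℕ)) (𝓝[<] α) (𝓝 (α * (j + 1 : ℕ))) :=
      tendsto_nhdsWithin_of_tendsto_nhds (tendsto_id.mul_const _)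
    exact (hc.eventually_const_lt hlt).mono fun _ h => h.le
  have all : ∀ᶠ γ in 𝓝[<] α, ∀ j ∈ Set.Iic N,
      ((⌈α * (j + 1 : ℕ)⌉ - 1 : ℤ) : ℝ) ≤ γ * (j + 1 : ℕ) :=
    (eventually_all_finite (Set.finite_Iic N)).2 fun j _ => near j
  obtain ⟨γ, hγ, hlt⟩ := (all.and self_mem_nhdsWithin).exists
  exact ⟨γ, hlt, hγ⟩

theorem upperMech_le_of_hasMean {w v : ℕ → ℤ} {α : ℝ} (hw : HasMean w α)
    (hv : ∀ i, toLex (shift w i) ≤ toLex v) : toLex (upperMech α 0) ≤ toLex v := by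
  -- If `v` were smaller, then from every position of `w` some bounded block would have a sum below
  -- that of the mechanical word, which would push the mean of `w` strictly below `α`.
  by_contra! hlt
  obtain ⟨N, hN, hN'⟩ := toLex_lt_iff.1 hlt
  obtain ⟨γ, hγ, hle⟩ := exists_lt_forall_ceil_sub_one_le α N
  refine hγ.not_ge (hw.le_of_frequently (exists_ge_psum_le_mul fun i => ?_))
  obtain ⟨j, hj, heq, hlt⟩ := exists_first_lt_of_le_of_lt (hv i) hN hN'
  have hblock : psum (shift w i) (j + 1) ≤ ⌈α * (j + 1 : ℕ)⌉ - 1 := by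
    rw [← psum_upperMech_zero, psum_succ, psum_succ, psum_congr heq]
    exact Int.le_sub_one_of_lt (add_lt_add_right hlt _)
  rw [psum_shift, add_comm (j + 1)] at hblock
  have hblock' : ((psum w (i + (j + 1)) - psum w i : ℤ) : ℝ) ≤ (⌈α * (j + 1 : ℕ)⌉ - 1 : ℤ) := by
    exact_mod_cast hblock
  refine ⟨j, ?_⟩
  push_cast at hblock' hle ⊢
  linarith [hle j hj]

lemma IsMechanical.hasMean {w : ℕ → ℤ} {α : ℝ} (h : IsMechanical w α) : HasMean w α := by
  obtain ⟨_, ρ, _, rfl | rfl⟩ := h <;> refine hasMean_of_abs_sub_le (C := 1) fun n => ?_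
  · rw [psum_lowerMech, abs_le]; push_cast
    have := Int.floor_le (α * n + ρ); have := Int.lt_floor_add_one (α * n + ρ)
    have := Int.floor_le ρ; have := Int.lt_floor_add_one ρ
    constructor <;> linarith
  · rw [psum_upperMech, abs_le]; push_cast
    have := Int.le_ceil (α * n + ρ); have := Int.ceil_lt_add_one (α * n + ρ)
    have := Int.le_ceil ρ; have := Int.ceil_lt_add_one ρ
    constructor <;> linarith

end Mechanical

section Expansion

variable {β γ x y : ℝ}

lemma angle_eq (t : ℝ) : angle t = t - (⌈t⌉ - 1) := by
  rw [angle]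
  split_ifs with h
  · obtain ⟨m, rfl⟩ := Int.fract_eq_zero_iff.1 h
    rw [Int.ceil_intCast]; ring
  · rw [Int.ceil_eq_add_one_sub_fract h]; ring

lemma dbar_zero (β x : ℝ) : dbar β x 0 = ⌈β * x⌉ - 1 := rfl

lemma Tbar_eq (β x : ℝ) : Tbar β x = β * x - dbar β x 0 := by
  rw [Tbar, angle_eq, dbar_zero, Int.cast_sub, Int.cast_one]

lemma Tbar_mem_Ioc (β x : ℝ) : Tbar β x ∈ Set.Ioc (0 : ℝ) 1 := by
  rw [Tbar, angle_eq]
  constructor <;> linarith [Int.ceil_lt_add_one (β * x), Int.le_ceil (β * x)]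

lemma dbar_iterate_Tbar (β x : ℝ) (i : ℕ) : dbar β ((Tbar β)^[i] x) = shift (dbar β x) i := by
  funext n
  simp only [dbar, shift, Function.iterate_add_apply]

lemma dbar_Tbar (β x : ℝ) : dbar β (Tbar β x) = shift (dbar β x) 1 := dbar_iterate_Tbar β x 1

lemma dbar_succ (β x : ℝ) (n : ℕ) : dbar β x (n + 1) = dbar β (Tbar β x) n := by
  rw [dbar_Tbar]; rfl

lemma iterate_succ_Tbar_eq (β x : ℝ) (n : ℕ) :
    (Tbar β)^[n + 1] x = β * (Tbar β)^[n] x - dbar β x n := by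
  rw [Function.iterate_succ_apply', Tbar_eq, dbar_iterate_Tbar, shift, zero_add]

lemma iterate_Tbar_mem_Ioc (hx : x ∈ Set.Ioc (0 : ℝ) 1) (i : ℕ) :
    (Tbar β)^[i] x ∈ Set.Ioc (0 : ℝ) 1 := by
  cases i with
  | zero => exact hx
  | succ i => rw [Function.iterate_succ_apply']; exact Tbar_mem_Ioc _ _

lemma dbar_nonneg (hβ : 1 < β) (hx : x ∈ Set.Ioc (0 : ℝ) 1) (n : ℕ) : 0 ≤ dbar β x n := by
  have hpos : 0 < β * (Tbar β)^[n] x := mul_pos (by linarith) (iterate_Tbar_mem_Ioc hx n).1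
  exact Int.le_sub_one_of_lt (Int.ceil_pos.2 hpos)

lemma dbar_le (hβ : 1 < β) (hx : x ∈ Set.Ioc (0 : ℝ) 1) (n : ℕ) : (dbar β x n : ℝ) ≤ β := by
  have h1 := (iterate_Tbar_mem_Ioc (β := β) hx (n + 1)).1
  have h2 := (iterate_Tbar_mem_Ioc (β := β) hx n).2
  rw [iterate_succ_Tbar_eq] at h1
  nlinarith

lemma iterate_Tbar_sub_of_dbar_eq {n : ℕ} (h : ∀ k < n, dbar β x k = dbar β y k) :
    (Tbar β)^[n] x - (Tbar β)^[n] y = β ^ n * (x - y) := by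
  induction n with
  | zero => simp
  | succ n ih =>
    rw [iterate_succ_Tbar_eq, iterate_succ_Tbar_eq, h n n.lt_succ_self, pow_succ]
    linear_combination β * ih fun k hk => h k (hk.trans n.lt_succ_self)

lemma dbar_mono (hβ : 1 < β) : Monotone fun x => toLex (dbar β x) := by
  intro x y h
  rcases eq_or_exists_first_ne (dbar β x) (dbar β y) with h' | ⟨i, hi, hne⟩
  · exact (congrArg toLex h').le
  · have hT : (Tbar β)^[i] x ≤ (Tbar β)^[i] y := by
      have hd := iterate_Tbar_sub_of_dbar_eq hi
      have hpow : 0 < β ^ i := by positivity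
      nlinarith
    have hle : dbar β x i ≤ dbar β y i :=
      sub_le_sub_right (Int.ceil_le_ceil (mul_le_mul_of_nonneg_left hT (by linarith))) 1
    exact (toLex_lt_iff.2 ⟨i, hi, hle.lt_of_ne hne⟩).le

lemma abs_sub_le_of_dbar_eq (hβ : 1 < β) (hx : x ∈ Set.Ioc (0 : ℝ) 1)
    (hy : y ∈ Set.Ioc (0 : ℝ) 1) {n : ℕ} (h : ∀ k < n, dbar β x k = dbar β y k) :
    |x - y| ≤ (1 / β) ^ n := by
  have hpow : 0 < β ^ n := by positivity
  obtain ⟨hx0, hx1⟩ := iterate_Tbar_mem_Ioc (β := β) hx n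
  obtain ⟨hy0, hy1⟩ := iterate_Tbar_mem_Ioc (β := β) hy n
  have hle : |β ^ n * (x - y)| ≤ 1 := by
    rw [← iterate_Tbar_sub_of_dbar_eq h, abs_le]
    constructor <;> linarith
  rwa [div_pow, one_pow, le_div_iff₀' hpow, ← abs_of_pos hpow, ← abs_mul]

lemma tendsto_one_div_pow (hβ : 1 < β) : Tendsto (fun n : ℕ => (1 / β) ^ n) atTop (𝓝 0) :=
  tendsto_pow_atTop_nhds_zero_of_lt_one (by positivity) ((div_lt_one (by linarith)).2 hβ)

lemma dbar_strictMonoOn (hβ : 1 < β) :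
    StrictMonoOn (fun x => toLex (dbar β x)) (Set.Ioc (0 : ℝ) 1) := by
  refine fun x hx y hy hxy => (dbar_mono hβ hxy.le).lt_of_ne fun h => hxy.ne ?_
  have hle : |x - y| ≤ 0 := ge_of_tendsto' (tendsto_one_div_pow hβ) fun n =>
    abs_sub_le_of_dbar_eq hβ hx hy fun k _ => congrFun (toLex_inj.1 h) k
  exact sub_eq_zero.1 (abs_nonpos_iff.1 hle)

lemma dbar_injOn (hβ : 1 < β) : Set.InjOn (dbar β) (Set.Ioc (0 : ℝ) 1) :=
  (dbar_strictMonoOn hβ).injOn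

lemma shift_dbar_le (hβ : 1 < β) (i : ℕ) (h : (Tbar β)^[i] x ≤ y) :
    toLex (shift (dbar β x) i) ≤ toLex (dbar β y) := by
  rw [← dbar_iterate_Tbar]; exact dbar_mono hβ h

lemma shift_dbar_one_le (hβ : 1 < β) (i : ℕ) :
    toLex (shift (dbar β 1) i) ≤ toLex (dbar β 1) :=
  shift_dbar_le hβ i (iterate_Tbar_mem_Ioc ⟨one_pos, le_rfl⟩ i).2

lemma hasFreq_iff {α : ℝ} : HasFreq β x α ↔ HasMean (dbar β x) α := by
  simp only [HasFreq, HasMean, psum, Int.cast_sum]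

theorem upperMech_le_dbar_one_of_hasFreq {α : ℝ} (hβ : 1 < β) (hx : x ≤ 1)
    (h : HasFreq β x α) : toLex (upperMech α 0) ≤ toLex (dbar β 1) := by
  refine upperMech_le_of_hasMean (hasFreq_iff.1 h) fun i => shift_dbar_le hβ i ?_
  cases i with
  | zero => exact hx
  | succ i => rw [Function.iterate_succ_apply']; exact (Tbar_mem_Ioc _ _).2

end Expansion

/-- The letters of `w` are bounded, so that `w` has a value in every base greater than `1`. -/
def IsBoundedWord (w : ℕ → ℤ) : Prop := ∃ C : ℝ, ∀ i, |(w i : ℝ)| ≤ C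

/-- The value of an infinite word in base `β`. -/
noncomputable def val (β : ℝ) (w : ℕ → ℤ) : ℝ := ∑' i, (w i : ℝ) / β ^ (i + 1)

section Value

variable {β γ x : ℝ} {w v : ℕ → ℤ}

lemma IsBoundedWord.of_nonneg {C : ℝ} (h0 : ∀ i, 0 ≤ w i) (hC : ∀ i, (w i : ℝ) ≤ C) :
    IsBoundedWord w :=
  ⟨C, fun i => by rw [abs_of_nonneg (by exact_mod_cast h0 i)]; exact hC i⟩

lemma IsBoundedWord.shift (hw : IsBoundedWord w) (i : ℕ) : IsBoundedWord (shift w i) :=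
  hw.imp fun _ hC _ => hC _

lemma isBoundedWord_dbar (hβ : 1 < β) (hx : x ∈ Set.Ioc (0 : ℝ) 1) : IsBoundedWord (dbar β x) :=
  .of_nonneg (dbar_nonneg hβ hx) (dbar_le hβ hx)

lemma isBoundedWord_upperMech {α : ℝ} (hα : 0 ≤ α) : IsBoundedWord (upperMech α 0) :=
  .of_nonneg (upperMech_nonneg hα 0) (C := ⌈α⌉) fun i => by exact_mod_cast upperMech_le α i

lemma summable_const_div_pow (hβ : 1 < β) (C : ℝ) : Summable fun i : ℕ => C / β ^ (i + 1) := by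
  refine (((summable_geometric_of_lt_one (r := 1 / β) (by positivity)
    ((div_lt_one (by linarith)).2 hβ)).comp_injective (add_left_injective 1)).mul_left C).congr
    fun i => ?_
  simp [div_eq_mul_inv]

lemma norm_div_pow_le {C : ℝ} (hβ : 1 < β) (hC : ∀ i, |(w i : ℝ)| ≤ C) (i : ℕ) :
    ‖(w i : ℝ) / β ^ (i + 1)‖ ≤ C / β ^ (i + 1) := by
  have hpow : 0 < β ^ (i + 1) := by positivity
  rw [Real.norm_eq_abs, abs_div, abs_of_pos hpow]
  gcongr
  exact hC i

lemma IsBoundedWord.summable (hw : IsBoundedWord w) (hβ : 1 < β) :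
    Summable fun i : ℕ => (w i : ℝ) / β ^ (i + 1) := by
  obtain ⟨C, hC⟩ := hw
  exact .of_norm_bounded (summable_const_div_pow hβ C) (norm_div_pow_le hβ hC)

lemma bddAbove_range_val_shift (hβ : 1 < β) (hw : IsBoundedWord w) :
    BddAbove (Set.range fun i => val β (shift w i)) := by
  obtain ⟨C, hC⟩ := hw
  refine ⟨∑' i : ℕ, C / β ^ (i + 1), ?_⟩
  rintro _ ⟨i, rfl⟩
  exact (le_abs_self _).trans (tsum_of_norm_bounded (summable_const_div_pow hβ C).hasSum
    (norm_div_pow_le hβ fun j => hC (j + i)))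

lemma mul_val (hβ : 1 < β) (hw : IsBoundedWord w) : β * val β w = w 0 + val β (shift w 1) := by
  have hβ0 : β ≠ 0 := by positivity
  rw [val, (hw.summable hβ).tsum_eq_zero_add, mul_add, val, ← tsum_mul_left, zero_add, pow_one,
    mul_div_cancel₀ _ hβ0]
  refine congrArg _ (tsum_congr fun i => ?_)
  rw [shift, pow_succ β (i + 1)]
  field_simp

lemma pow_mul_val_sub_val (hβ : 1 < β) (hw : IsBoundedWord w) (hv : IsBoundedWord v) {n : ℕ}
    (h : ∀ k < n, w k = v k) :
    β ^ n * (val β w - val β v) = val β (shift w n) - val β (shift v n) := by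
  induction n with
  | zero => rw [pow_zero, one_mul]; rfl
  | succ n ih =>
    have hwn := mul_val hβ (hw.shift n)
    have hvn := mul_val hβ (hv.shift n)
    rw [shift_shift, add_comm 1 n, shift, zero_add] at hwn hvn
    rw [h n n.lt_succ_self] at hwn
    rw [pow_succ]
    linear_combination β * ih (fun k hk => h k (hk.trans n.lt_succ_self)) + hwn - hvn

lemma val_nonneg (hβ : 1 < β) (hw : ∀ i, 0 ≤ w i) : 0 ≤ val β w :=
  tsum_nonneg fun i => div_nonneg (by exact_mod_cast hw i) (by positivity)

lemma psum_div_pow_le_val (hβ : 1 < β) (hw : IsBoundedWord w) (h0 : ∀ i, 0 ≤ w i) (n : ℕ) :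
    psum w n / β ^ n ≤ val β w := by
  have h0' : ∀ i, (0 : ℝ) ≤ w i := fun i => by exact_mod_cast h0 i
  have hterm : ∀ i, (0 : ℝ) ≤ (w i : ℝ) / β ^ (i + 1) := fun i =>
    div_nonneg (h0' i) (by positivity)
  refine le_trans ?_ ((hw.summable hβ).sum_le_tsum (Finset.range n) fun i _ => hterm i)
  rw [psum, Int.cast_sum, Finset.sum_div]
  refine Finset.sum_le_sum fun i hi => div_le_div_of_nonneg_left (h0' i) (by positivity) ?_
  exact pow_le_pow_right₀ hβ.le (Finset.mem_range.1 hi)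

lemma val_lt_val_of_base_lt (hβ : 1 < β) (h : β < γ) (hw : IsBoundedWord w) (h0 : ∀ i, 0 ≤ w i)
    (hw0 : 0 < w 0) : val γ w < val β w := by
  have h0' : ∀ i, (0 : ℝ) ≤ w i := fun i => by exact_mod_cast h0 i
  refine Summable.tsum_lt_tsum (i := 0) (fun i => ?_) ?_ (hw.summable (hβ.trans h))
    (hw.summable hβ)
  · exact div_le_div_of_nonneg_left (h0' i) (by positivity) (by gcongr)
  · exact div_lt_div_of_pos_left (by exact_mod_cast hw0) (by positivity) (by gcongr)

lemma val_le_of_toLex_lt {M : ℝ} (hβ : 1 < β) (hw : IsBoundedWord w) (hv : IsBoundedWord v)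
    (hv0 : ∀ i, 0 ≤ v i) (hM : 1 ≤ M) (hwM : ∀ i, val β (shift w i) ≤ M)
    (h : toLex w < toLex v) : val β w ≤ val β v + (M - 1) / β := by
  obtain ⟨j, hj, hlt⟩ := toLex_lt_iff.1 h
  have hdiff := pow_mul_val_sub_val hβ hw hv hj
  have hwj := mul_val hβ (hw.shift j)
  have hvj := mul_val hβ (hv.shift j)
  rw [shift_shift, shift, zero_add] at hwj hvj
  have hletter : (w j : ℝ) + 1 ≤ v j := by exact_mod_cast hlt
  have hscaled : β ^ j * (β * (val β w - val β v)) ≤ M - 1 := by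
    have hv1 : 0 ≤ val β (shift v (1 + j)) := val_nonneg hβ fun i => hv0 _
    calc β ^ j * (β * (val β w - val β v)) = β * (β ^ j * (val β w - val β v)) := by ring
      _ = (w j - v j) + (val β (shift w (1 + j)) - val β (shift v (1 + j))) := by
        rw [hdiff, mul_sub, hwj, hvj]; ring
      _ ≤ M - 1 := by linarith [hwM (1 + j)]
  have hpow : 1 ≤ β ^ j := one_le_pow₀ hβ.le
  rw [← sub_le_iff_le_add', le_div_iff₀' (by linarith)]
  by_contra! hcon
  nlinarith

lemma val_shift_le_one (hβ : 1 < β) (hw : IsBoundedWord w) (hv : IsBoundedWord v)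
    (hv0 : ∀ i, 0 ≤ v i) (hv1 : val β v ≤ 1) (h : ∀ i, toLex (shift w i) ≤ toLex v) (i : ℕ) :
    val β (shift w i) ≤ 1 := by
  have hbdd := bddAbove_range_val_shift hβ hw
  set M := ⨆ i, val β (shift w i)
  have hleM : ∀ i, val β (shift w i) ≤ M := le_ciSup hbdd
  suffices M ≤ 1 from (hleM i).trans this
  by_contra! hM
  have hcontract : M ≤ 1 + (M - 1) / β := ciSup_le fun i => by
    rcases (h i).eq_or_lt with heq | hlt
    · have hfrac : 0 ≤ (M - 1) / β := div_nonneg (by linarith) (by linarith)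
      rw [toLex_inj.1 heq]; linarith
    · have hle := val_le_of_toLex_lt hβ (hw.shift i) hv hv0 hM.le
        (fun j => by rw [shift_shift]; exact hleM _) hlt
      linarith
  rw [← sub_le_iff_le_add', le_div_iff₀ (by linarith)] at hcontract
  nlinarith

lemma val_dbar (hβ : 1 < β) (hx : x ∈ Set.Ioc (0 : ℝ) 1) : val β (dbar β x) = x := by
  have hpartial : ∀ n, ∑ i ∈ Finset.range n, (dbar β x i : ℝ) / β ^ (i + 1) =
      x - (Tbar β)^[n] x / β ^ n := fun n => by
    induction n with
    | zero => simp
    | succ n ih =>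
      rw [Finset.sum_range_succ, ih, iterate_succ_Tbar_eq]
      field_simp
      ring
  have hremainder : Tendsto (fun n => (Tbar β)^[n] x / β ^ n) atTop (𝓝 0) := by
    refine squeeze_zero (fun n => ?_) (fun n => ?_) (tendsto_one_div_pow hβ)
    · exact div_nonneg (iterate_Tbar_mem_Ioc hx n).1.le (by positivity)
    · rw [div_pow, one_pow]
      exact div_le_div_of_nonneg_right (iterate_Tbar_mem_Ioc hx n).2 (by positivity)
  refine ((hasSum_iff_tendsto_nat_of_nonneg (fun i => ?_) x).2 ?_).tsum_eq
  · exact div_nonneg (by exact_mod_cast dbar_nonneg hβ hx i) (by positivity)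
  · simpa only [hpartial, sub_zero] using hremainder.const_sub x

lemma dbar_zero_val (hβ : 1 < β) (hw : IsBoundedWord w)
    (h : val β (shift w 1) ∈ Set.Ioc (0 : ℝ) 1) : dbar β (val β w) 0 = w 0 := by
  rw [dbar_zero, sub_eq_iff_eq_add, Int.ceil_eq_iff, mul_val hβ hw]
  push_cast
  constructor <;> linarith [h.1, h.2]

lemma dbar_val (hβ : 1 < β) (hw : IsBoundedWord w)
    (h : ∀ i, val β (shift w i) ∈ Set.Ioc (0 : ℝ) 1) : dbar β (val β w) = w := by
  have hdigit : ∀ i, dbar β (val β (shift w i)) 0 = w i := fun i => by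
    rw [dbar_zero_val hβ (hw.shift i) (by rw [shift_shift]; exact h _), shift, zero_add]
  have hiterate : ∀ i, (Tbar β)^[i] (val β w) = val β (shift w i) := fun i => by
    induction i with
    | zero => rfl
    | succ i ih =>
      rw [Function.iterate_succ_apply', ih, Tbar_eq, hdigit, mul_val hβ (hw.shift i),
        shift_shift, add_comm 1 i, shift, zero_add, add_sub_cancel_left]
  funext i
  rw [← hdigit i, ← hiterate, dbar_iterate_Tbar, shift, zero_add]

lemma dbar_one_strictMonoOn : StrictMonoOn (fun β => toLex (dbar β 1)) (Set.Ioi 1) := by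
  intro β hβ γ hγ h
  rw [Set.mem_Ioi] at hβ hγ
  have hone : (1 : ℝ) ∈ Set.Ioc (0 : ℝ) 1 := ⟨one_pos, le_rfl⟩
  by_contra! hle
  have hval : val β (dbar γ 1) ≤ 1 :=
    val_shift_le_one hβ (isBoundedWord_dbar hγ hone) (isBoundedWord_dbar hβ hone)
      (dbar_nonneg hβ hone) (val_dbar hβ hone).le (fun i => (shift_dbar_one_le hγ i).trans hle) 0
  have hdigit : 0 < dbar γ 1 0 := by
    rw [dbar_zero, mul_one, sub_pos, Int.lt_ceil]; exact_mod_cast hγ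
  have hlt := val_lt_val_of_base_lt hβ h (isBoundedWord_dbar hγ hone) (dbar_nonneg hγ hone) hdigit
  rw [val_dbar hγ hone] at hlt
  linarith

end Value

section UpperMechanicalExpansion

variable {α β : ℝ}

lemma exists_forall_le_val_shift_upperMech (hα : 0 < α) (hβ : 1 < β) :
    ∃ δ > 0, ∀ i, δ ≤ val β (shift (upperMech α 0) i) := by
  obtain ⟨N, hN⟩ := exists_nat_gt (1 / α)
  rw [div_lt_iff₀' hα] at hN
  refine ⟨1 / β ^ N, by positivity, fun i => ?_⟩
  have hsum : 1 ≤ psum (shift (upperMech α 0) i) N := by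
    have hceil : 1 < ⌈α * N⌉ := Int.lt_ceil.2 (by exact_mod_cast hN)
    linarith [le_psum_shift_upperMech α i N]
  refine le_trans ?_ (psum_div_pow_le_val hβ ((isBoundedWord_upperMech hα.le).shift i)
    (fun k => upperMech_nonneg hα.le 0 _) N)
  gcongr
  exact_mod_cast hsum

lemma dbar_val_upperMech {v : ℕ → ℤ} (hα : 0 < α) (hβ : 1 < β) (hv : IsBoundedWord v)
    (hv0 : ∀ i, 0 ≤ v i) (hv1 : val β v ≤ 1) (h : toLex (upperMech α 0) ≤ toLex v) :
    val β (upperMech α 0) ∈ Set.Ioc (0 : ℝ) 1 ∧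
      dbar β (val β (upperMech α 0)) = upperMech α 0 := by
  obtain ⟨δ, hδ, hle⟩ := exists_forall_le_val_shift_upperMech hα hβ
  have hw := isBoundedWord_upperMech hα.le
  have hmem : ∀ i, val β (shift (upperMech α 0) i) ∈ Set.Ioc (0 : ℝ) 1 := fun i =>
    ⟨hδ.trans_le (hle i),
      val_shift_le_one hβ hw hv hv0 hv1 (fun j => (shift_upperMech_le α j).trans h) i⟩
  exact ⟨hmem 0, dbar_val hβ hw hmem⟩

lemma exists_dbar_eq_upperMech (hα : 0 < α) (hβ : 1 < β)
    (h : toLex (upperMech α 0) ≤ toLex (dbar β 1)) :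
    ∃ x ∈ Set.Ioc (0 : ℝ) 1, dbar β x = upperMech α 0 :=
  have hone : (1 : ℝ) ∈ Set.Ioc (0 : ℝ) 1 := ⟨one_pos, le_rfl⟩
  ⟨_, dbar_val_upperMech hα hβ (isBoundedWord_dbar hβ hone) (dbar_nonneg hβ hone)
    (val_dbar hβ hone).le h⟩

lemma exists_val_eq_one {w : ℕ → ℤ} (hw : IsBoundedWord w) (h0 : ∀ i, 0 ≤ w i) {N : ℕ}
    (hN : 1 < psum w N) : ∃ β > 1, val β w = 1 := by
  -- Intermediate value theorem for the power series `∑ w i * t ^ (i + 1)`, where `t = 1 / β`.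
  obtain ⟨C, hC⟩ := hw
  have h0' : ∀ i, (0 : ℝ) ≤ w i := fun i => by exact_mod_cast h0 i
  have hpartial : Tendsto (fun t : ℝ => ∑ i ∈ Finset.range N, (w i : ℝ) * t ^ (i + 1)) (𝓝[<] 1)
      (𝓝 (psum w N)) := by
    have hc : Continuous fun t : ℝ => ∑ i ∈ Finset.range N, (w i : ℝ) * t ^ (i + 1) := by fun_prop
    simpa [psum] using (hc.tendsto 1).mono_left nhdsWithin_le_nhds
  obtain ⟨r, hr, hr0, hr1⟩ := ((hpartial.eventually_const_lt
    (show (1 : ℝ) < psum w N by exact_mod_cast hN)).and (Ioo_mem_nhdsLT zero_lt_one)).exists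
  have hsum : Summable fun i : ℕ => C * r ^ (i + 1) :=
    ((summable_geometric_of_lt_one hr0.le hr1).comp_injective (add_left_injective 1)).mul_left C
  have hbound : ∀ (i : ℕ), ∀ t ∈ Set.Icc 0 r, ‖(w i : ℝ) * t ^ (i + 1)‖ ≤ C * r ^ (i + 1) := by
    rintro i t ⟨ht0, htr⟩
    rw [norm_mul, Real.norm_eq_abs, Real.norm_of_nonneg (by positivity)]
    exact mul_le_mul (hC i) (by gcongr) (by positivity) ((abs_nonneg _).trans (hC i))
  have hcont : ContinuousOn (fun t : ℝ => ∑' i, (w i : ℝ) * t ^ (i + 1)) (Set.Icc 0 r) :=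
    continuousOn_tsum (fun i => by fun_prop) hsum hbound
  have hge : 1 ≤ ∑' i, (w i : ℝ) * r ^ (i + 1) :=
    hr.le.trans ((Summable.of_norm_bounded hsum fun i => hbound i r ⟨hr0.le, le_rfl⟩).sum_le_tsum _
      fun i _ => mul_nonneg (h0' i) (by positivity))
  obtain ⟨t, ⟨ht0, htr⟩, ht⟩ := intermediate_value_Icc hr0.le hcont ⟨by simp, hge⟩
  have ht_pos : 0 < t := ht0.lt_of_ne (by rintro rfl; simp at ht)
  refine ⟨t⁻¹, (one_lt_inv₀ ht_pos).2 (htr.trans_lt hr1), Eq.trans (tsum_congr fun i => ?_) ht⟩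
  rw [inv_pow, div_inv_eq_mul]

theorem exists_dbar_one_eq_upperMech (hα : 0 < α) : ∃ δ > 1, dbar δ 1 = upperMech α 0 := by
  have hw := isBoundedWord_upperMech hα.le
  have h0 := upperMech_nonneg hα.le 0
  obtain ⟨N, hN⟩ := exists_nat_gt (1 / α)
  rw [div_lt_iff₀' hα] at hN
  obtain ⟨δ, hδ, hval⟩ := exists_val_eq_one hw h0 (N := N)
    (by rw [psum_upperMech_zero]; exact Int.lt_ceil.2 (by exact_mod_cast hN))
  have hexp := (dbar_val_upperMech hα hδ hw h0 hval.le le_rfl).2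
  rw [hval] at hexp
  exact ⟨δ, hδ, hexp⟩

end UpperMechanicalExpansion

section Recurrence

lemma exists_int_sub_mul_mem_Ico (α : ℝ) {ε : ℝ} (hε : 0 < ε) :
    ∃ i : ℕ, 0 < i ∧ ∃ j : ℤ, (j : ℝ) - α * i ∈ Set.Ico 0 ε := by
  obtain ⟨n, hn⟩ := exists_nat_one_div_lt hε
  obtain ⟨k, hk, -, happrox⟩ := Real.exists_nat_abs_mul_sub_round_le α n.succ_pos
  have hle : 1 / ((n.succ : ℝ) + 1) ≤ 1 / (n + 1) := by gcongr; simp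
  have hle_one : 1 / ((n.succ : ℝ) + 1) ≤ 1 :=
    (div_le_one (by positivity)).2 (le_add_of_nonneg_left (by positivity))
  obtain ⟨hlow, hupp⟩ := abs_le.1 happrox
  rcases le_or_gt (k * α - round (k * α)) 0 with hneg | hpos
  · exact ⟨k, hk, round (k * α), by linarith, by linarith⟩
  · -- The approximation is on the wrong side of the integer: go once around the circle with it.
    set e := k * α - round (k * α) with he
    have hfloor := Nat.floor_le (one_div_pos.2 hpos).le
    have hfloor' := Nat.lt_floor_add_one (1 / e)
    have hm : 0 < ⌊1 / e⌋₊ := Nat.floor_pos.2 ((one_le_div hpos).2 (hupp.trans hle_one))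
    rw [le_div_iff₀ hpos] at hfloor
    rw [div_lt_iff₀ hpos] at hfloor'
    have hdiff : ((⌊1 / e⌋₊ * round (k * α) + 1 : ℤ) : ℝ) - α * (⌊1 / e⌋₊ * k : ℕ) =
        1 - ⌊1 / e⌋₊ * e := by
      push_cast; rw [he]; ring
    refine ⟨⌊1 / e⌋₊ * k, Nat.mul_pos hm hk, ⌊1 / e⌋₊ * round (k * α) + 1, ?_⟩
    rw [hdiff]
    constructor <;> linarith

lemma exists_mul_sub_int_mem_Ioo {α : ℝ} (hα : Irrational α) {l r : ℝ} (hlr : l < r) :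
    ∃ i : ℕ, ∃ j : ℤ, α * i - j ∈ Set.Ioo l r := by
  obtain ⟨i, hi, j, hη0, hηlt⟩ := exists_int_sub_mul_mem_Ico α (sub_pos.2 hlr)
  have hη : 0 < j - α * i :=
    hη0.lt_of_ne fun h => (hα.mul_natCast hi.ne').ne_int j (by linarith)
  have hquot : 0 ≤ (⌈r⌉ - r) / (j - α * i) := div_nonneg (by linarith [Int.le_ceil r]) hη.le
  have hfloor := Nat.floor_le hquot
  have hfloor' := Nat.lt_floor_add_one ((⌈r⌉ - r) / (j - α * i))
  set m := ⌊(⌈r⌉ - r) / (j - α * i)⌋₊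
  rw [le_div_iff₀ hη] at hfloor
  rw [div_lt_iff₀ hη] at hfloor'
  refine ⟨(m + 1) * i, (m + 1) * j - ⌈r⌉, ?_⟩
  push_cast
  constructor <;> linarith

lemma eq_of_psum_eq {w v : ℕ → ℤ} {N : ℕ} (h : ∀ n ≤ N, psum w n = psum v n) {k : ℕ}
    (hk : k < N) : w k = v k := by
  have hsucc := h (k + 1) hk
  rwa [psum_succ, psum_succ, h k hk.le, add_right_inj] at hsucc

lemma upperMech_recurrent (α : ℝ) (N : ℕ) :
    ∃ i, ∀ k < N, shift (upperMech α 0) (i + 1) k = upperMech α 0 k := by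
  have hstable : ∀ᶠ ε in 𝓝[>] (0 : ℝ), ∀ n ∈ Set.Iic N, ε < α * n - (⌈α * n⌉ - 1) :=
    (eventually_all_finite (Set.finite_Iic N)).2 fun n _ =>
      eventually_nhdsWithin_of_eventually_nhds (eventually_lt_nhds
        (by linarith [Int.ceil_lt_add_one (α * n)]))
  obtain ⟨ε, hε, hε0⟩ := (hstable.and self_mem_nhdsWithin).exists
  obtain ⟨i, hi, j, hj0, hjε⟩ := exists_int_sub_mul_mem_Ico α hε0
  have hceil : ∀ n ≤ N, ⌈α * n + α * i⌉ = ⌈α * n⌉ + j := fun n hn => by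
    have hεn := hε n hn
    rw [Int.ceil_eq_iff]; push_cast
    constructor <;> linarith [Int.le_ceil (α * n)]
  have hceil0 : ⌈α * i⌉ = j := by simpa using hceil 0 N.zero_le
  obtain ⟨i, rfl⟩ := Nat.exists_eq_succ_of_ne_zero hi.ne'
  refine ⟨i, fun k hk => eq_of_psum_eq (N := N) (fun n hn => ?_) hk⟩
  rw [psum_shift_upperMech, psum_upperMech_zero, hceil n hn, hceil0, add_sub_cancel_right]

end Recurrence

section OrbitClosure

variable {β δ x y : ℝ}

lemma isClosed_setOf_le_Tbar (β : ℝ) (hδ : δ ≤ 1) : IsClosed {z | δ ≤ Tbar β z} := by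
  have hcompl : {z | δ ≤ Tbar β z}ᶜ = ⋃ d : ℤ, {z | d < β * z ∧ β * z < d + δ} := by
    ext z
    simp only [Set.mem_compl_iff, Set.mem_ofPred_eq, not_le, Set.mem_iUnion]
    constructor
    · intro h
      have hpos := (Tbar_mem_Ioc β z).1
      rw [Tbar_eq] at h hpos
      exact ⟨dbar β z 0, by linarith, by linarith⟩
    · rintro ⟨d, hlt, hlt'⟩
      have hceil : ⌈β * z⌉ = d + 1 := by
        rw [Int.ceil_eq_iff]; push_cast; constructor <;> linarith
      rw [Tbar_eq, dbar_zero, hceil]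
      push_cast; linarith
  rw [← isOpen_compl_iff, hcompl]
  have hcont : Continuous fun z : ℝ => β * z := by fun_prop
  exact isOpen_iUnion fun d =>
    (isOpen_lt continuous_const hcont).inter (isOpen_lt hcont continuous_const)

lemma dbar_zero_eq_of_abs_sub_lt (hx : δ ≤ Tbar β x) (hy : δ ≤ Tbar β y)
    (h : |β * x - β * y| < δ) : dbar β x 0 = dbar β y 0 := by
  have hx1 := (Tbar_mem_Ioc β x).2
  have hy1 := (Tbar_mem_Ioc β y).2
  rw [Tbar_eq] at hx hy hx1 hy1
  rw [abs_lt] at h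
  have hlt : (dbar β x 0 : ℝ) < dbar β y 0 + 1 := by linarith
  have hgt : (dbar β y 0 : ℝ) < dbar β x 0 + 1 := by linarith
  exact le_antisymm (Int.lt_add_one_iff.1 (by exact_mod_cast hlt))
    (Int.lt_add_one_iff.1 (by exact_mod_cast hgt))

lemma continuousOn_Tbar (hβ : 1 < β) (hδ : 0 < δ) :
    ContinuousOn (Tbar β) {z | δ ≤ Tbar β z} := by
  rw [Metric.continuousOn_iff]
  intro y hy ε hε
  refine ⟨min δ ε / β, div_pos (lt_min hδ hε) (by linarith), fun x hx h => ?_⟩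
  have hclose : |β * x - β * y| < min δ ε := by
    rwa [← mul_sub, abs_mul, abs_of_pos (by linarith), ← lt_div_iff₀' (by linarith)]
  have hdigit := dbar_zero_eq_of_abs_sub_lt hx hy (hclose.trans_le (min_le_left _ _))
  rw [Real.dist_eq, Tbar_eq, Tbar_eq, hdigit, sub_sub_sub_cancel_right]
  exact hclose.trans_le (min_le_right _ _)

lemma dbar_eq_of_pow_mul_abs_sub_lt (hβ : 1 < β) {S : Set ℝ} (hT : Set.MapsTo (Tbar β) S S)
    (hS : ∀ z ∈ S, δ ≤ z) {n : ℕ} (hx : x ∈ S) (hy : y ∈ S) (h : β ^ n * |x - y| < δ) {k : ℕ}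
    (hk : k < n) : dbar β x k = dbar β y k := by
  induction n generalizing x y k with
  | zero => exact absurd hk k.not_lt_zero
  | succ n ih =>
    have hmul : |β * x - β * y| = β * |x - y| := by
      rw [← mul_sub, abs_mul, abs_of_pos (by linarith)]
    rw [pow_succ, mul_assoc, ← hmul] at h
    have hdigit := dbar_zero_eq_of_abs_sub_lt (hS _ (hT hx)) (hS _ (hT hy))
      ((le_mul_of_one_le_left (abs_nonneg _) (one_le_pow₀ hβ.le)).trans_lt h)
    cases k with
    | zero => exact hdigit
    | succ k =>
      rw [dbar_succ, dbar_succ]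
      refine ih (hT hx) (hT hy) ?_ (Nat.lt_of_succ_lt_succ hk)
      rwa [Tbar_eq, Tbar_eq, hdigit, sub_sub_sub_cancel_right]

lemma iterate_mem_orbitClosure (β x : ℝ) (n : ℕ) : (Tbar β)^[n] x ∈ orbitClosure β x :=
  subset_closure ⟨n, rfl⟩

lemma mem_closure_of_forall_dbar_eq (hβ : 1 < β) {S : Set ℝ} (hS : S ⊆ Set.Ioc 0 1)
    (hy : y ∈ Set.Ioc (0 : ℝ) 1) (h : ∀ n, ∃ z ∈ S, ∀ k < n, dbar β z k = dbar β y k) :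
    y ∈ closure S := by
  rw [Metric.mem_closure_iff]
  intro ε hε
  obtain ⟨n, hn⟩ := ((tendsto_one_div_pow hβ).eventually_lt_const hε).exists
  obtain ⟨z, hz, hzy⟩ := h n
  exact ⟨z, hz,
    (abs_sub_le_of_dbar_eq hβ hy (hS hz) fun k hk => (hzy k hk).symm).trans_lt hn⟩

lemma mem_orbitClosure_of_dbar (hβ : 1 < β) (hx : x ∈ Set.Ioc (0 : ℝ) 1)
    (hy : y ∈ Set.Ioc (0 : ℝ) 1) (h : ∀ n, ∃ i, ∀ k < n, shift (dbar β x) i k = dbar β y k) :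
    y ∈ orbitClosure β x := by
  refine mem_closure_of_forall_dbar_eq hβ ?_ hy fun n => ?_
  · rintro _ ⟨i, rfl⟩
    exact iterate_Tbar_mem_Ioc hx i
  · obtain ⟨i, hi⟩ := h n
    exact ⟨_, ⟨i, rfl⟩, fun k hk => (congrFun (dbar_iterate_Tbar ..) k).trans (hi k hk)⟩

end OrbitClosure

section OrbitAwayFromZero

variable {β δ x y : ℝ} (hβ : 1 < β) (hδ : 0 < δ) (hx : x ∈ Set.Ioc (0 : ℝ) 1)
  (hlow : ∀ i, δ ≤ (Tbar β)^[i] x)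

include hx hlow in
lemma orbitClosure_subset_Icc : orbitClosure β x ⊆ Set.Icc δ 1 := by
  refine closure_minimal ?_ isClosed_Icc
  rintro _ ⟨i, rfl⟩
  exact ⟨hlow i, (iterate_Tbar_mem_Ioc hx i).2⟩

include hβ hδ hx hlow

lemma continuousOn_orbitClosure : ContinuousOn (Tbar β) (orbitClosure β x) := by
  refine (continuousOn_Tbar hβ hδ).mono (closure_minimal ?_ ?_)
  · rintro _ ⟨i, rfl⟩
    exact (hlow (i + 1)).trans_eq (Function.iterate_succ_apply' _ _ _)
  · exact isClosed_setOf_le_Tbar β ((hlow 0).trans hx.2)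

lemma mapsTo_orbitClosure : Set.MapsTo (Tbar β) (orbitClosure β x) (orbitClosure β x) := by
  rw [Set.mapsTo_iff_image_subset]
  refine (continuousOn_orbitClosure hβ hδ hx hlow).image_closure.trans (closure_mono ?_)
  rintro _ ⟨_, ⟨i, rfl⟩, rfl⟩
  exact ⟨i + 1, Function.iterate_succ_apply' _ _ _⟩

lemma image_orbitClosure_of_recurrent
    (hrec : ∀ n, ∃ i, ∀ k < n, shift (dbar β x) (i + 1) k = dbar β x k) :
    Tbar β '' orbitClosure β x = orbitClosure β x := by
  refine (mapsTo_orbitClosure hβ hδ hx hlow).image_subset.antisymm ?_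
  have hclosed : IsClosed (Tbar β '' orbitClosure β x) :=
    ((isCompact_Icc.of_isClosed_subset isClosed_closure
      (orbitClosure_subset_Icc hx hlow)).image_of_continuousOn
      (continuousOn_orbitClosure hβ hδ hx hlow)).isClosed
  have hsucc : ∀ i, (Tbar β)^[i + 1] x ∈ Tbar β '' orbitClosure β x := fun i =>
    ⟨_, iterate_mem_orbitClosure β x i, (Function.iterate_succ_apply' _ _ _).symm⟩
  refine closure_minimal ?_ hclosed
  rintro _ ⟨_ | i, rfl⟩
  · rw [← hclosed.closure_eq]
    refine mem_closure_of_forall_dbar_eq hβ ?_ hx fun n => ?_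
    · rintro _ ⟨z, -, rfl⟩
      exact Tbar_mem_Ioc β z
    · obtain ⟨i, hi⟩ := hrec n
      exact ⟨_, hsucc i, fun k hk => (congrFun (dbar_iterate_Tbar ..) k).trans (hi k hk)⟩
  · exact hsucc i

lemma exists_shift_dbar_eq_of_mem_orbitClosure (hy : y ∈ orbitClosure β x) (n : ℕ) :
    ∃ i, ∀ k < n, dbar β y k = shift (dbar β x) i k := by
  have hpow : 0 < β ^ n := by positivity
  obtain ⟨_, ⟨i, rfl⟩, hi⟩ := Metric.mem_closure_iff.1 hy (δ / β ^ n) (by positivity)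
  rw [Real.dist_eq, lt_div_iff₀' hpow] at hi
  refine ⟨i, fun k hk => ?_⟩
  rw [← dbar_iterate_Tbar]
  exact dbar_eq_of_pow_mul_abs_sub_lt hβ (mapsTo_orbitClosure hβ hδ hx hlow)
    (fun z hz => (orbitClosure_subset_Icc hx hlow hz).1) hy (iterate_mem_orbitClosure β x i) hi hk

end OrbitAwayFromZero

section Existence

variable {α β x y : ℝ}

lemma Tbar_le_Tbar_of_psum_dbar_le (hβ : 1 < β)
    (h : ∀ n, psum (dbar β x) (n + 1) - dbar β x 0 ≤ psum (dbar β y) (n + 1) - dbar β y 0) :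
    Tbar β x ≤ Tbar β y := by
  refine (dbar_strictMonoOn hβ).le_iff_le (Tbar_mem_Ioc β x) (Tbar_mem_Ioc β y) |>.1 ?_
  refine toLex_le_of_psum_le fun n => ?_
  have hone : ∀ w, psum w 1 = w 0 := fun w => by rw [psum_succ, psum_zero, zero_add]
  simpa only [dbar_Tbar, psum_shift, hone] using h n

lemma sub_le_one_div_of_psum_dbar_le (hβ : 1 < β)
    (h : ∀ n, psum (dbar β x) n - 1 ≤ psum (dbar β y) n) : x - y ≤ 1 / β := by
  have hx := Tbar_eq β x
  have hy := Tbar_eq β y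
  rw [le_div_iff₀' (by linarith), mul_sub]
  rcases le_or_gt (dbar β x 0) (dbar β y 0) with hle | hlt
  · have hle' : (dbar β x 0 : ℝ) ≤ dbar β y 0 := by exact_mod_cast hle
    linarith [(Tbar_mem_Ioc β x).2, (Tbar_mem_Ioc β y).1]
  · have hdigit : dbar β x 0 = dbar β y 0 + 1 := by
      have h1 := h 1
      simp only [psum_succ, psum_zero, zero_add] at h1
      omega
    have hT : Tbar β x ≤ Tbar β y := Tbar_le_Tbar_of_psum_dbar_le hβ fun n => by
      linarith [h (n + 1)]
    rw [hdigit] at hx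
    push_cast at hx
    linarith

lemma orbitClosure_subset_Icc_of_dbar_eq_upperMech (hβ : 1 < β) (hx : x ∈ Set.Ioc (0 : ℝ) 1)
    (hdx : dbar β x = upperMech α 0) : orbitClosure β x ⊆ Set.Icc (x - 1 / β) x := by
  refine closure_minimal ?_ isClosed_Icc
  rintro _ ⟨i, rfl⟩
  have hdi : dbar β ((Tbar β)^[i] x) = shift (upperMech α 0) i := by rw [dbar_iterate_Tbar, hdx]
  constructor
  · rw [sub_le_comm]
    refine sub_le_one_div_of_psum_dbar_le hβ fun n => ?_
    rw [hdx, hdi, psum_upperMech_zero]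
    exact le_psum_shift_upperMech α i n
  · refine (dbar_strictMonoOn hβ).le_iff_le (iterate_Tbar_mem_Ioc hx i) hx |>.1 ?_
    simp only [hdi, hdx]
    exact shift_upperMech_le α i

lemma hasFreq_of_forall_exists_shift_upperMech
    (h : ∀ n, ∃ i, ∀ k < n, dbar β y k = shift (upperMech α 0) i k) : HasFreq β y α := by
  refine hasFreq_iff.2 (hasMean_of_abs_sub_le (C := 1) fun n => ?_)
  obtain ⟨i, hi⟩ := h n
  rw [psum_congr hi, abs_le]
  have hupp : (psum (shift (upperMech α 0) i) n : ℝ) ≤ ⌈α * n⌉ := by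
    exact_mod_cast psum_shift_upperMech_le α i n
  have hlow : (⌈α * n⌉ : ℝ) - 1 ≤ psum (shift (upperMech α 0) i) n := by
    exact_mod_cast le_psum_shift_upperMech α i n
  constructor <;> linarith [Int.le_ceil (α * n), Int.ceil_lt_add_one (α * n)]

theorem isXiSet_orbitClosure (hα : 0 < α) (hβ : 1 < β) (hx : x ∈ Set.Ioc (0 : ℝ) 1)
    (hdx : dbar β x = upperMech α 0) : IsXiSet α β (orbitClosure β x) := by
  obtain ⟨δ, hδ, hval⟩ := exists_forall_le_val_shift_upperMech hα hβ
  have hlow : ∀ i, δ ≤ (Tbar β)^[i] x := fun i => by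
    rw [← val_dbar hβ (iterate_Tbar_mem_Ioc hx i), dbar_iterate_Tbar, hdx]
    exact hval i
  refine ⟨⟨x, Set.Ioc_subset_Icc_self hx, rfl⟩, ?_, ⟨max 0 (x - 1 / β), fun z hz => ?_, ?_⟩,
    fun z hz => ?_⟩
  · exact image_orbitClosure_of_recurrent hβ hδ hx hlow (by rw [hdx]; exact upperMech_recurrent α)
  · obtain ⟨hz0, hz1⟩ := orbitClosure_subset_Icc_of_dbar_eq_upperMech hβ hx hdx hz
    have hz2 := (orbitClosure_subset_Icc hx hlow hz).1
    exact ⟨max_le (hδ.le.trans hz2) hz0, by linarith [le_max_right 0 (x - 1 / β)]⟩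
  · refine Set.Icc_subset_Icc (le_max_left _ _) ?_
    rw [← le_sub_iff_add_le]
    have hinv : 1 / β ≤ 1 := (div_le_one (by linarith)).2 hβ.le
    exact max_le (by linarith) (by linarith [hx.2])
  · refine hasFreq_of_forall_exists_shift_upperMech ?_
    rw [← hdx]
    exact exists_shift_dbar_eq_of_mem_orbitClosure hβ hδ hx hlow hz

end Existence

/-- The value at `x` of the `n`-th iterate of the lift of `Tbar β` to the line, that is, of the map
`x + k ↦ Tbar β x + dbar β x 0 + k` for `x ∈ (0, 1]` and `k ∈ ℤ`. -/
noncomputable def orbitLift (β x : ℝ) (n : ℕ) : ℝ := psum (dbar β x) n + (Tbar β)^[n] x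

/-- A forward invariant set of points of frequency `α` that fits in an interval of length `1 / β`:
what remains of `IsXiSet` without the generating point. -/
structure IsRotationSet (α β : ℝ) (S : Set ℝ) : Prop where
  mapsTo : Set.MapsTo (Tbar β) S S
  subset : S ⊆ Set.Ioc 0 1
  sub_le : ∀ x ∈ S, ∀ y ∈ S, x - y ≤ 1 / β
  hasFreq : ∀ x ∈ S, HasFreq β x α

section Lift

variable {β x y : ℝ}

lemma orbitLift_zero (β x : ℝ) : orbitLift β x 0 = x := by simp [orbitLift, psum_zero]

lemma orbitLift_add (β x : ℝ) (m n : ℕ) :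
    orbitLift β x (m + n) = psum (dbar β x) n + orbitLift β ((Tbar β)^[n] x) m := by
  rw [orbitLift, orbitLift, dbar_iterate_Tbar, psum_shift, Function.iterate_add_apply]
  push_cast
  ring

lemma orbitLift_succ (β x : ℝ) (n : ℕ) :
    orbitLift β x (n + 1) = dbar β x 0 + orbitLift β (Tbar β x) n := by
  rw [orbitLift_add, psum_succ, psum_zero, zero_add, Function.iterate_one]

lemma psum_lt_orbitLift (hx : x ∈ Set.Ioc (0 : ℝ) 1) (n : ℕ) :
    psum (dbar β x) n < orbitLift β x n :=
  lt_add_of_pos_right _ (iterate_Tbar_mem_Ioc hx n).1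

lemma orbitLift_le_psum_add_one (hx : x ∈ Set.Ioc (0 : ℝ) 1) (n : ℕ) :
    orbitLift β x n ≤ psum (dbar β x) n + 1 :=
  add_le_add_right (iterate_Tbar_mem_Ioc hx n).2 _

lemma mul_add_int_le_mul (hβ : 1 < β) (hx : 0 < x) (hy : y ≤ 1) (hxy : x - y ≤ 1 / β) {k : ℤ}
    (h : x + k ≤ y) : β * x + k ≤ β * y := by
  rcases lt_trichotomy k 0 with hk | rfl | hk
  · have hk' : (k : ℝ) ≤ -1 := by exact_mod_cast Int.le_sub_one_of_lt hk
    rw [le_div_iff₀ (by linarith)] at hxy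
    linarith
  · simp only [Int.cast_zero, add_zero] at h ⊢
    gcongr
  · have hk' : (1 : ℝ) ≤ k := by exact_mod_cast hk
    linarith

end Lift

section MeanComparison

variable {w : ℕ → ℤ} {α : ℝ}

lemma le_of_tendsto_div {u : ℕ → ℝ} {a b C : ℝ} (hu : Tendsto (fun j : ℕ => u j / j) atTop (𝓝 b))
    (h : ∀ j : ℕ, j * a - C ≤ u j) : a ≤ b := by
  have hlim : Tendsto (fun j : ℕ => a - C / j) atTop (𝓝 (a - 0)) :=
    (tendsto_const_div_atTop_nhds_zero_nat C).const_sub a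
  rw [sub_zero] at hlim
  refine le_of_tendsto_of_tendsto hlim hu ?_
  filter_upwards [eventually_gt_atTop 0] with j hj
  have hj' : (0 : ℝ) < j := by exact_mod_cast hj
  rw [le_div_iff₀ hj', sub_mul, div_mul_cancel₀ _ hj'.ne', mul_comm]
  exact h j

lemma HasMean.tendsto_psum_mul_div (hw : HasMean w α) (n : ℕ) :
    Tendsto (fun j : ℕ => (psum w (j * n) : ℝ) / j) atTop (𝓝 (α * n)) := by
  rcases n.eq_zero_or_pos with rfl | hn
  · simp [psum_zero]
  have hn' : (n : ℝ) ≠ 0 := by exact_mod_cast hn.ne'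
  refine ((hw.comp (tendsto_id.atTop_mul_const' hn)).mul_const (n : ℝ)).congr fun j => ?_
  simp only [Function.comp_apply, id, Nat.cast_mul]
  rw [div_mul_eq_mul_div, mul_div_mul_right _ _ hn']

lemma HasMean.le_mul {a C : ℝ} (hw : HasMean w α) (n : ℕ)
    (h : ∀ j : ℕ, j * a - C ≤ psum w (j * n)) : a ≤ α * n :=
  le_of_tendsto_div (hw.tendsto_psum_mul_div n) h

lemma HasMean.mul_le {a C : ℝ} (hw : HasMean w α) (n : ℕ)
    (h : ∀ j : ℕ, psum w (j * n) ≤ j * a + C) : α * n ≤ a := by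
  refine neg_le_neg_iff.1 (le_of_tendsto_div (C := C) (u := fun j => -psum w (j * n)) ?_ ?_)
  · simpa only [neg_div] using (hw.tendsto_psum_mul_div n).neg
  · intro j; linarith [h j]

end MeanComparison

namespace IsRotationSet

variable {α β : ℝ} {S : Set ℝ} {x y M : ℝ}

lemma iterate_mem (h : IsRotationSet α β S) (hx : x ∈ S) (n : ℕ) : (Tbar β)^[n] x ∈ S :=
  h.mapsTo.iterate n hx

theorem orbitLift_mono (h : IsRotationSet α β S) (hβ : 1 < β) (hx : x ∈ S) (hy : y ∈ S) {k : ℤ}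
    (hk : x + k ≤ y) (n : ℕ) : orbitLift β x n + k ≤ orbitLift β y n := by
  induction n generalizing x y k with
  | zero => simpa only [orbitLift_zero] using hk
  | succ n ih =>
    have hmul := mul_add_int_le_mul hβ (h.subset hx).1 (h.subset hy).2 (h.sub_le x hx y hy) hk
    have hstep := ih (h.mapsTo hx) (h.mapsTo hy) (k := k + dbar β x 0 - dbar β y 0)
      (by rw [Tbar_eq, Tbar_eq]; push_cast; linarith)
    rw [orbitLift_succ, orbitLift_succ]
    push_cast at hstep
    linarith

lemma orbitLift_add_le (h : IsRotationSet α β S) (hβ : 1 < β) (hx : x ∈ S) (hy : y ∈ S) {n : ℕ}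
    {k : ℤ} (hk : x + k ≤ orbitLift β y n) (m : ℕ) :
    orbitLift β x m + k ≤ orbitLift β y (m + n) := by
  have hmono := h.orbitLift_mono hβ hx (h.iterate_mem hy n) (k := k - psum (dbar β y) n)
    (by rw [orbitLift] at hk; push_cast; linarith) m
  rw [orbitLift_add]
  push_cast at hmono
  linarith

lemma le_orbitLift_add (h : IsRotationSet α β S) (hβ : 1 < β) (hx : x ∈ S) (hy : y ∈ S) {n : ℕ}
    {k : ℤ} (hk : orbitLift β y n ≤ x + k) (m : ℕ) :
    orbitLift β y (m + n) ≤ orbitLift β x m + k := by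
  have hmono := h.orbitLift_mono hβ (h.iterate_mem hy n) hx (k := psum (dbar β y) n - k)
    (by rw [orbitLift] at hk; push_cast; linarith) m
  rw [orbitLift_add]
  push_cast at hmono
  linarith

lemma le_mul_of_le_orbitLift (h : IsRotationSet α β S) (hβ : 1 < β) (hx : x ∈ S) {n : ℕ} {k : ℤ}
    (hk : x + k ≤ orbitLift β x n) : k ≤ α * n := by
  have hiter (j : ℕ) : x + j * k ≤ orbitLift β x (j * n) := by
    induction j with
    | zero => simp [orbitLift_zero]
    | succ j ih =>
      rw [Nat.succ_mul]
      push_cast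
      linarith [h.orbitLift_add_le hβ hx hx hk (j * n)]
  refine (hasFreq_iff.1 (h.hasFreq x hx)).le_mul (C := 1) n fun j => ?_
  linarith [hiter j, orbitLift_le_psum_add_one (β := β) (h.subset hx) (j * n), (h.subset hx).1]

lemma mul_le_of_orbitLift_le (h : IsRotationSet α β S) (hβ : 1 < β) (hx : x ∈ S) {n : ℕ} {k : ℤ}
    (hk : orbitLift β x n ≤ x + k) : α * n ≤ k := by
  have hiter (j : ℕ) : orbitLift β x (j * n) ≤ x + j * k := by
    induction j with
    | zero => simp [orbitLift_zero]
    | succ j ih =>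
      rw [Nat.succ_mul]
      push_cast
      linarith [h.le_orbitLift_add hβ hx hx hk (j * n)]
  refine (hasFreq_iff.1 (h.hasFreq x hx)).mul_le (C := 1) n fun j => ?_
  linarith [hiter j, psum_lt_orbitLift (β := β) (h.subset hx) (j * n), (h.subset hx).2]

lemma orbitLift_lt (h : IsRotationSet α β S) (hβ : 1 < β) (hx : x ∈ S) (n : ℕ) :
    orbitLift β x n < x + (⌊α * n⌋ + 1) := by
  by_contra! hle
  have hfloor := h.le_mul_of_le_orbitLift hβ hx (k := ⌊α * n⌋ + 1) (by exact_mod_cast hle)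
  exact (Int.lt_floor_add_one (α * n)).not_ge (by exact_mod_cast hfloor)

lemma lt_orbitLift (h : IsRotationSet α β S) (hβ : 1 < β) (hx : x ∈ S) (n : ℕ) :
    x + (⌈α * n⌉ - 1) < orbitLift β x n := by
  by_contra! hle
  have hceil := h.mul_le_of_orbitLift_le hβ hx (k := ⌈α * n⌉ - 1) (by exact_mod_cast hle)
  push_cast at hceil
  linarith [Int.ceil_lt_add_one (α * n)]

lemma psum_le (h : IsRotationSet α β S) (hβ : 1 < β) (hx : x ∈ S) (n : ℕ) :
    psum (dbar β x) n ≤ ⌊α * n⌋ + 1 := by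
  have hlt : (psum (dbar β x) n : ℝ) < ⌊α * n⌋ + 1 + 1 := by
    linarith [h.orbitLift_lt hβ hx n, psum_lt_orbitLift (β := β) (h.subset hx) n, (h.subset hx).2]
  exact Int.lt_add_one_iff.1 (by exact_mod_cast hlt)

lemma le_psum (h : IsRotationSet α β S) (hβ : 1 < β) (hx : x ∈ S) (n : ℕ) :
    ⌈α * n⌉ - 1 ≤ psum (dbar β x) n := by
  have hlt : (⌈α * n⌉ : ℝ) - 1 < psum (dbar β x) n + 1 := by
    linarith [h.lt_orbitLift hβ hx n, orbitLift_le_psum_add_one (β := β) (h.subset hx) n,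
      (h.subset hx).1]
  exact Int.lt_add_one_iff.1 (by exact_mod_cast hlt)

lemma abs_psum_sub_le (h : IsRotationSet α β S) (hβ : 1 < β) (hx : x ∈ S) (n : ℕ) :
    |psum (dbar β x) n - α * n| ≤ 1 := by
  have hup : (psum (dbar β x) n : ℝ) ≤ ⌊α * n⌋ + 1 := by exact_mod_cast h.psum_le hβ hx n
  have hlow : (⌈α * n⌉ : ℝ) - 1 ≤ psum (dbar β x) n := by exact_mod_cast h.le_psum hβ hx n
  rw [abs_le]
  constructor <;> linarith [Int.floor_le (α * n), Int.le_ceil (α * n)]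

lemma le_psum_max (h : IsRotationSet α β S) (hβ : 1 < β) (hM : IsGreatest S M) (n : ℕ) :
    ⌈α * n⌉ ≤ psum (dbar β M) n := by
  have hlt : (⌈α * n⌉ : ℝ) - 1 < psum (dbar β M) n := by
    have hlift := h.lt_orbitLift hβ hM.1 n
    rw [orbitLift] at hlift
    linarith [hM.2 (h.iterate_mem hM.1 n)]
  exact Int.sub_one_lt_iff.1 (by exact_mod_cast hlt)

lemma psum_max_eq (h : IsRotationSet α β S) (hβ : 1 < β) (hM : IsGreatest S M) {n : ℕ}
    (hn : ∀ k : ℤ, α * n ≠ k) : psum (dbar β M) n = ⌈α * n⌉ := by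
  refine le_antisymm ((h.psum_le hβ hM.1 n).trans ?_) (h.le_psum_max hβ hM n)
  rw [Int.add_one_le_iff, Int.lt_ceil]
  exact lt_of_le_of_ne (Int.floor_le _) (hn _).symm

end IsRotationSet

section IrrationalFrequency

namespace IsRotationSet

variable {α β : ℝ} {S : Set ℝ} {y M : ℝ}

lemma dbar_max_of_irrational (h : IsRotationSet α β S) (hβ : 1 < β) (hα : Irrational α)
    (hM : IsGreatest S M) : dbar β M = upperMech α 0 := by
  refine eq_of_psum fun n => ?_
  rw [psum_upperMech_zero]
  rcases n.eq_zero_or_pos with rfl | hn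
  · simp [psum_zero]
  · exact h.psum_max_eq hβ hM fun k => (hα.mul_natCast hn.ne').ne_int k

lemma abs_psum_sub_lt_one (h : IsRotationSet α β S) (hβ : 1 < β) (hα : Irrational α) (hy : y ∈ S)
    (n : ℕ) : |psum (dbar β y) n - α * n| < 1 := by
  rcases n.eq_zero_or_pos with rfl | hn
  · simp [psum_zero]
  refine (h.abs_psum_sub_le hβ hy n).lt_of_ne fun heq => ?_
  have hirr := hα.mul_natCast hn.ne'
  rcases eq_or_eq_neg_of_abs_eq heq with heq | heq
  · exact hirr.ne_int (psum (dbar β y) n - 1) (by push_cast; linarith)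
  · exact hirr.ne_int (psum (dbar β y) n + 1) (by push_cast; linarith)

lemma psum_sub_lt_add_one (h : IsRotationSet α β S) (hβ : 1 < β) (hα : Irrational α) (hy : y ∈ S)
    (m n : ℕ) : psum (dbar β y) m - α * m < 1 + (psum (dbar β y) n - α * n) := by
  have hdiff (i k : ℕ) : |(psum (dbar β y) (k + i) - α * (k + i : ℕ)) -
      (psum (dbar β y) i - α * i)| < 1 := by
    convert h.abs_psum_sub_lt_one hβ hα (h.iterate_mem hy i) k using 2
    rw [dbar_iterate_Tbar, psum_shift]
    push_cast
    ring
  rcases le_total m n with hle | hle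
  · obtain ⟨k, rfl⟩ := Nat.exists_eq_add_of_le' hle
    linarith [(abs_lt.1 (hdiff m k)).1]
  · obtain ⟨k, rfl⟩ := Nat.exists_eq_add_of_le' hle
    linarith [(abs_lt.1 (hdiff n k)).2]

-- The deviations of `psum (dbar β y)` from `α n` oscillate by less than `1`, so up to any given
-- time they are matched by those of some point of the rotation by `α`.
theorem mem_orbitClosure_max (h : IsRotationSet α β S) (hβ : 1 < β) (hα : Irrational α)
    (hM : IsGreatest S M) (hy : y ∈ S) : y ∈ orbitClosure β M := by
  refine mem_orbitClosure_of_dbar hβ (h.subset hM.1) (h.subset hy) fun N => ?_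
  rw [h.dbar_max_of_irrational hβ hα hM]
  set D : ℕ → ℝ := fun n => psum (dbar β y) n - α * n with hD
  have hne : (Finset.range (N + 1)).Nonempty := Finset.nonempty_range_add_one
  obtain ⟨a, -, hmax⟩ := Finset.exists_max_image _ D hne
  obtain ⟨b, -, hmin⟩ := Finset.exists_min_image _ D hne
  obtain ⟨i, j, hl, hr⟩ := exists_mul_sub_int_mem_Ioo hα (h.psum_sub_lt_add_one hβ hα hy a b)
  have hceil : ∀ n ≤ N, ⌈α * n + α * i⌉ = psum (dbar β y) n + 1 + j := by
    intro n hn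
    have ha := hmax n (Finset.mem_range_succ_iff.2 hn)
    have hb := hmin n (Finset.mem_range_succ_iff.2 hn)
    simp only [hD] at ha hb
    rw [Int.ceil_eq_iff]
    push_cast
    constructor <;> linarith
  have hceil0 : ⌈α * i⌉ = 1 + j := by simpa [psum_zero] using hceil 0 N.zero_le
  refine ⟨i, fun k hk => eq_of_psum_eq (N := N) (fun n hn => ?_) hk⟩
  rw [psum_shift_upperMech, hceil n hn, hceil0, add_assoc, add_sub_cancel_right]

end IsRotationSet

end IrrationalFrequency

section RationalFrequency

lemma exists_forall_ge_eq_of_monotone {Z : ℕ → ℤ} (hZ : Monotone Z) (hB : BddAbove (Set.range Z)) :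
    ∃ N, ∀ n ≥ N, Z n = Z N := by
  obtain ⟨B, hB⟩ := hB
  obtain ⟨_, ⟨N, rfl⟩, hN⟩ := Int.exists_greatest_of_bdd (P := (· ∈ Set.range Z))
    ⟨B, fun _ hz => hB hz⟩ ⟨_, 0, rfl⟩
  exact ⟨N, fun n hn => (hN _ ⟨n, rfl⟩).antisymm (hZ hn)⟩

-- The sums of `W` over windows of length `q`, corrected by the drift `p n`, are monotone and
-- bounded, hence eventually constant.
lemma exists_forall_ge_add_eq {W : ℕ → ℤ} {α C : ℝ} {p : ℤ} {q : ℕ} (hpq : α * q = p)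
    (hstep : ∀ n, W n + p ≤ W (n + q)) (hW : ∀ n, W n - α * n ≤ C) :
    ∃ N, ∀ n ≥ N, W (n + q) = W n + p := by
  set Z : ℕ → ℤ := fun n => ∑ i ∈ Finset.range q, W (n + i) - n * p with hZ
  have hsucc (n : ℕ) : Z (n + 1) = Z n + (W (n + q) - (W n + p)) := by
    have hshift := (Finset.sum_range_succ' (fun i => W (n + i)) q).symm.trans
      (Finset.sum_range_succ (fun i => W (n + i)) q)
    simp only [hZ, add_right_comm n 1]
    simp only [add_zero, ← add_assoc] at hshift
    push_cast
    linarith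
  have hmono : Monotone Z := monotone_nat_of_le_succ fun n => by linarith [hsucc n, hstep n]
  have hbdd (n : ℕ) : (Z n : ℝ) ≤ ∑ i ∈ Finset.range q, (α * i + C) := by
    have hterm : ∑ i ∈ Finset.range q, (W (n + i) : ℝ) ≤
        ∑ i ∈ Finset.range q, (α * n + (α * i + C)) := by
      refine Finset.sum_le_sum fun i _ => ?_
      have := hW (n + i)
      push_cast at this
      linarith
    rw [Finset.sum_add_distrib, Finset.sum_const, Finset.card_range, nsmul_eq_mul] at hterm
    simp only [hZ]
    push_cast
    rw [← hpq]
    linarith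
  obtain ⟨N, hN⟩ := exists_forall_ge_eq_of_monotone hmono
    ⟨⌊∑ i ∈ Finset.range q, (α * i + C)⌋, by rintro _ ⟨n, rfl⟩; exact Int.le_floor.2 (hbdd n)⟩
  refine ⟨N, fun n hn => ?_⟩
  linarith [hsucc n, hN n hn, hN (n + 1) (by omega)]

lemma finite_range_iterate_of_isPeriodicPt {X : Type*} {f : X → X} {x : X} {N q : ℕ} (hq : 0 < q)
    (h : Function.IsPeriodicPt f q (f^[N] x)) : (Set.range fun n => f^[n] x).Finite := by
  refine ((Set.finite_Iio (q + N)).image fun n => f^[n] x).subset ?_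
  rintro _ ⟨n, rfl⟩
  rcases lt_or_ge n N with hn | hn
  · exact ⟨n, hn.trans_le (Nat.le_add_left ..), rfl⟩
  · obtain ⟨m, rfl⟩ := Nat.exists_eq_add_of_le' hn
    refine ⟨m % q + N, Nat.add_lt_add_right (Nat.mod_lt m hq) N, ?_⟩
    simp only [Function.iterate_add_apply]
    exact h.iterate_mod_apply m

variable {α β x M : ℝ} {S : Set ℝ} {p : ℤ} {q : ℕ}

namespace IsRotationSet

lemma exists_forall_ge_psum_add_eq (h : IsRotationSet α β S) (hβ : 1 < β) (hpq : α * q = p)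
    (hx : x ∈ S) :
    ∃ N, ∀ n ≥ N, psum (dbar β x) (n + q) = psum (dbar β x) n + p := by
  have hdev (n : ℕ) := abs_le.1 (h.abs_psum_sub_le hβ hx n)
  have hlt (n : ℕ) := psum_lt_orbitLift (β := β) (h.subset hx) n
  have hle (n : ℕ) := orbitLift_le_psum_add_one (β := β) (h.subset hx) n
  rcases le_total (x + p) (orbitLift β x q) with hc | hc
  · refine exists_forall_ge_add_eq hpq (fun n => ?_) fun n => (hdev n).2
    have hstep : (psum (dbar β x) n + p : ℝ) < psum (dbar β x) (n + q) + 1 := by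
      linarith [h.orbitLift_add_le hβ hx hx hc n, hlt n, hle (n + q)]
    exact Int.lt_add_one_iff.1 (by exact_mod_cast hstep)
  · have hstep (n : ℕ) : psum (dbar β x) (n + q) ≤ psum (dbar β x) n + p := by
      have hcast : (psum (dbar β x) (n + q) : ℝ) < psum (dbar β x) n + p + 1 := by
        linarith [h.le_orbitLift_add hβ hx hx hc n, hlt (n + q), hle n]
      exact Int.lt_add_one_iff.1 (by exact_mod_cast hcast)
    obtain ⟨N, hN⟩ := exists_forall_ge_add_eq (W := fun n => -psum (dbar β x) n) (α := -α)
      (p := -p) (q := q) (C := 1) (by push_cast; linarith) (fun n => by linarith [hstep n])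
      (fun n => by push_cast; linarith [(hdev n).1])
    exact ⟨N, fun n hn => by linarith [hN n hn]⟩

theorem exists_isPeriodicPt_iterate (h : IsRotationSet α β S) (hβ : 1 < β) (hpq : α * q = p)
    (hx : x ∈ S) : ∃ N, Function.IsPeriodicPt (Tbar β) q ((Tbar β)^[N] x) := by
  obtain ⟨N, hN⟩ := h.exists_forall_ge_psum_add_eq hβ hpq hx
  have hmem := h.subset (h.iterate_mem hx N)
  refine ⟨N, dbar_injOn hβ (iterate_Tbar_mem_Ioc hmem q) hmem ?_⟩
  rw [← Function.iterate_add_apply, dbar_iterate_Tbar, dbar_iterate_Tbar]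
  refine eq_of_psum fun n => ?_
  have hshift := hN (n + N) (Nat.le_add_left ..)
  rw [psum_shift, psum_shift, add_comm q N, ← add_assoc, hshift, hN N le_rfl]
  ring

lemma psum_eq_of_isPeriodicPt (h : IsRotationSet α β S) (hβ : 1 < β) (hx : x ∈ S) {n : ℕ}
    (hper : Function.IsPeriodicPt (Tbar β) n x) : (psum (dbar β x) n : ℝ) = α * n := by
  have hlift : orbitLift β x n = x + psum (dbar β x) n := by rw [orbitLift, hper.eq, add_comm]
  exact (h.le_mul_of_le_orbitLift hβ hx hlift.ge).antisymm (h.mul_le_of_orbitLift_le hβ hx hlift.le)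

lemma dbar_max_of_isPeriodicPt (h : IsRotationSet α β S) (hβ : 1 < β)
    (hcop : IsCoprime p (q : ℤ)) (hpq : α * q = p) (hM : IsGreatest S M)
    (hper : Function.IsPeriodicPt (Tbar β) q M) : dbar β M = upperMech α 0 := by
  refine eq_of_psum fun n => ?_
  rw [psum_upperMech_zero]
  by_cases hn : ∃ k : ℤ, α * n = k
  · obtain ⟨k, hk⟩ := hn
    have hkq : p * n = k * q := by
      have hcast : (p * n : ℝ) = k * q := by rw [← hpq, ← hk]; ring
      exact_mod_cast hcast
    have hdvd : (q : ℤ) ∣ n := hcop.symm.dvd_of_dvd_mul_left ⟨k, by rw [hkq, mul_comm]⟩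
    have hpsum := h.psum_eq_of_isPeriodicPt hβ hM.1
      (hper.trans_dvd (Int.natCast_dvd_natCast.1 hdvd))
    rw [hk] at hpsum ⊢
    rw [Int.ceil_intCast]
    exact_mod_cast hpsum
  · exact h.psum_max_eq hβ hM fun k hk => hn ⟨k, hk⟩

end IsRotationSet

lemma isPeriodicPt_of_surjOn_range {X : Type*} {f : X → X} {x : X} {N q : ℕ}
    (hsurj : Set.SurjOn f (Set.range fun n => f^[n] x) (Set.range fun n => f^[n] x))
    (h : Function.IsPeriodicPt f q (f^[N] x)) (n : ℕ) : Function.IsPeriodicPt f q (f^[n] x) := by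
  obtain ⟨_, ⟨i, rfl⟩, hi⟩ := hsurj.iterate N ⟨n, rfl⟩
  simp only at hi
  rw [← hi, ← Function.iterate_add_apply, add_comm, Function.iterate_add_apply]
  exact h.apply_iterate i

lemma iterate_add_mul_pred_of_isPeriodicPt {X : Type*} {f : X → X} {x : X} (hq : 0 < q)
    (h : Function.IsPeriodicPt f q x) (k i : ℕ) : f^[k + i * (q - 1)] (f^[i] x) = f^[k] x := by
  have hexp : i * (q - 1) + i = i * q := by
    rw [← Nat.mul_succ, Nat.succ_eq_add_one, Nat.sub_add_cancel hq]
  rw [← Function.iterate_add_apply, add_assoc, hexp, Function.iterate_add_apply,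
    (h.const_mul i).eq]

end RationalFrequency

section Uniqueness

variable {α β M : ℝ} {S S' : Set ℝ}

namespace IsXiSet

lemma isRotationSet (h : IsXiSet α β S) : IsRotationSet α β S := by
  obtain ⟨_, hT, ⟨t, ht, _⟩, hf⟩ := h
  refine ⟨Set.mapsTo_iff_image_subset.2 hT.subset, ?_, fun x hx y hy => ?_, hf⟩
  · rw [← hT]
    rintro _ ⟨y, _, rfl⟩
    exact Tbar_mem_Ioc β y
  · linarith [(ht hx).2, (ht hy).1]

lemma isCompact (h : IsXiSet α β S) : IsCompact S := by
  obtain ⟨⟨x, _, rfl⟩, _, ⟨t, ht, _⟩, _⟩ := h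
  exact isCompact_Icc.of_isClosed_subset isClosed_closure ht

lemma exists_isGreatest (h : IsXiSet α β S) : ∃ M, IsGreatest S M := by
  refine h.isCompact.exists_isGreatest ?_
  obtain ⟨⟨x, _, rfl⟩, _⟩ := h
  exact ⟨_, iterate_mem_orbitClosure β x 0⟩

lemma orbitClosure_subset (h : IsXiSet α β S) (hM : M ∈ S) : orbitClosure β M ⊆ S :=
  closure_minimal (by rintro _ ⟨n, rfl⟩; exact h.isRotationSet.iterate_mem hM n)
    h.isCompact.isClosed

lemma exists_eq_range_of_not_irrational (hβ : 1 < β) (h : IsXiSet α β S) (hα : ¬ Irrational α) :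
    ∃ (p : ℤ) (q : ℕ) (x : ℝ), 0 < q ∧ IsCoprime p (q : ℤ) ∧ α * q = p ∧
      (S = Set.range fun n => (Tbar β)^[n] x) ∧ ∀ z ∈ S, Function.IsPeriodicPt (Tbar β) q z := by
  obtain ⟨r, rfl⟩ := not_not.1 hα
  have hpq : (r : ℝ) * r.den = r.num := by exact_mod_cast Rat.mul_den_eq_num r
  have hrot := h.isRotationSet
  obtain ⟨⟨x, _, rfl⟩, hT, _⟩ := h
  obtain ⟨N, hN⟩ :=
    hrot.exists_isPeriodicPt_iterate hβ hpq (iterate_mem_orbitClosure β x 0)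
  have hrange : orbitClosure β x = Set.range fun n => (Tbar β)^[n] x :=
    (finite_range_iterate_of_isPeriodicPt r.den_pos hN).isClosed.closure_eq
  refine ⟨r.num, r.den, x, r.den_pos, Rat.isCoprime_num_den r, hpq, hrange, ?_⟩
  rw [hrange] at hT ⊢
  rintro _ ⟨n, rfl⟩
  exact isPeriodicPt_of_surjOn_range hT.superset hN n

theorem exists_eq_orbitClosure (hβ : 1 < β) (h : IsXiSet α β S) :
    ∃ M ∈ S, dbar β M = upperMech α 0 ∧ S = orbitClosure β M := by
  have hrot := h.isRotationSet
  obtain ⟨M, hM⟩ := h.exists_isGreatest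
  refine ⟨M, hM.1, ?_⟩
  by_cases hα : Irrational α
  · exact ⟨hrot.dbar_max_of_irrational hβ hα hM, Set.Subset.antisymm
      (fun y hy => hrot.mem_orbitClosure_max hβ hα hM hy) (h.orbitClosure_subset hM.1)⟩
  obtain ⟨p, q, x, hq, hcop, hpq, hS, hper⟩ := h.exists_eq_range_of_not_irrational hβ hα
  refine ⟨hrot.dbar_max_of_isPeriodicPt hβ hcop hpq hM (hper M hM.1),
    Set.Subset.antisymm ?_ (h.orbitClosure_subset hM.1)⟩
  have hx : x ∈ S := hS ▸ ⟨0, rfl⟩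
  obtain ⟨i, rfl⟩ : M ∈ Set.range fun n => (Tbar β)^[n] x := hS ▸ hM.1
  rw [hS]
  rintro _ ⟨k, rfl⟩
  exact subset_closure ⟨_, iterate_add_mul_pred_of_isPeriodicPt hq (hper x hx) k i⟩

theorem unique (hβ : 1 < β) (h : IsXiSet α β S) (h' : IsXiSet α β S') : S = S' := by
  obtain ⟨M, hM, hd, rfl⟩ := h.exists_eq_orbitClosure hβ
  obtain ⟨M', hM', hd', rfl⟩ := h'.exists_eq_orbitClosure hβ
  rw [dbar_injOn hβ (h.isRotationSet.subset hM) (h'.isRotationSet.subset hM')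
    (hd.trans hd'.symm)]

end IsXiSet

theorem xiWellDefined_of_upperMech_le (hα : 0 < α) (hβ : 1 < β)
    (hle : toLex (upperMech α 0) ≤ toLex (dbar β 1)) : XiWellDefined α β := by
  obtain ⟨x, hx, hdx⟩ := exists_dbar_eq_upperMech hα hβ hle
  have hS := isXiSet_orbitClosure hα hβ hx hdx
  obtain ⟨M, hM⟩ := hS.exists_isGreatest
  refine ⟨⟨_, hS, fun S' hS' => hS'.unique hβ hS⟩, M, ⟨_, hS, hM⟩, ?_⟩
  rintro ξ ⟨S', hS', hξ⟩
  rw [hS'.unique hβ hS] at hξ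
  exact hξ.unique hM

theorem upperMech_le_of_isXiSet (hβ : 1 < β) (hS : IsXiSet α β S) :
    toLex (upperMech α 0) ≤ toLex (dbar β 1) := by
  obtain ⟨x, hx⟩ := hS.exists_isGreatest
  exact upperMech_le_dbar_one_of_hasFreq hβ (hS.isRotationSet.subset hx.1).2
    (hS.isRotationSet.hasFreq x hx.1)

end Uniqueness

section Blocks

variable {s t : ℕ → ℤ} {i j m n : ℕ}

@[simp] lemma length_block (s : ℕ → ℤ) (i n : ℕ) : (block s i n).length = n := by simp [block]

lemma block_add (s : ℕ → ℤ) (i m n : ℕ) :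
    block s i (m + n) = block s i m ++ block s (i + m) n := by
  simp [block, List.range_add, add_assoc, Function.comp_def]

lemma block_one (s : ℕ → ℤ) (i : ℕ) : block s i 1 = [s i] := by simp [block]

lemma block_two (s : ℕ → ℤ) (i : ℕ) : block s i 2 = [s i, s (i + 1)] := by
  simp [block, List.range_succ]

lemma block_succ (s : ℕ → ℤ) (i n : ℕ) : block s i (n + 1) = s i :: block s (i + 1) n := by
  rw [add_comm n 1, block_add, block_one, List.singleton_append]

lemma block_shift (s : ℕ → ℤ) (j i n : ℕ) : block (shift s j) i n = block s (j + i) n := by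
  simp [block, shift, add_comm, add_left_comm]

lemma block_neg (s : ℕ → ℤ) (i n : ℕ) : block (-s) i n = (block s i n).map Neg.neg := by
  simp [block]

lemma block_eq_block : block s i n = block t j n ↔ ∀ k < n, s (i + k) = t (j + k) := by
  simp [block]

lemma block_eq_replicate {c : ℤ} : block s i n = List.replicate n c ↔ ∀ k < n, s (i + k) = c := by
  rw [List.eq_replicate_iff]
  simp [block]

lemma block_add_eq_append {x y : List ℤ} (hx : x.length = m) :
    block s i (m + n) = x ++ y ↔ block s i m = x ∧ block s (i + m) n = y := by
  rw [block_add]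
  exact ⟨fun h => List.append_inj h (by rw [length_block, hx]), fun h => by rw [h.1, h.2]⟩

lemma sum_block (w : ℕ → ℤ) (n : ℕ) : (block w 0 n).sum = psum w n := by
  induction n with
  | zero => rfl
  | succ n ih => simp [block_add, ih, psum_succ, block_one]

lemma psum_add_of_block_eq {w v : ℕ → ℤ} (h : block w i n = block v 0 n) {k : ℕ} (hk : k ≤ n) :
    psum w (i + k) = psum w i + psum v k := by
  have hshift : psum (shift w i) k = psum v k := psum_congr fun j hj => by
    simpa [shift, add_comm] using block_eq_block.1 h j (hj.trans_le hk)
  rw [psum_shift, add_comm k i] at hshift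
  lia

lemma block_eq_of_psum_add {w v : ℕ → ℤ}
    (h : ∀ k ≤ n, psum w (i + k) = psum w i + psum v k) : block w i n = block v 0 n := by
  rw [block_eq_block]
  intro k hk
  have h_succ := h (k + 1) hk
  rw [← add_assoc, psum_succ, psum_succ, h k hk.le] at h_succ
  rw [zero_add]
  lia

lemma cons_shift (w : ℕ → ℤ) : cons (w 0) (shift w 1) = w := by
  funext n; cases n <;> rfl

end Blocks

section Lexicographic

variable {s t : ℕ → ℤ} {x y z w : List ℤ}

lemma lt_of_append_lt_append (hl : x.length = y.length) (hne : x ≠ y) (h : x ++ z < y ++ w) :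
    x < y := by
  induction x generalizing y with
  | nil => exact absurd (List.length_eq_zero_iff.1 hl.symm).symm hne
  | cons c x ih =>
    obtain ⟨d, y, rfl⟩ := List.exists_cons_of_length_eq_add_one hl.symm
    simp only [List.cons_append, List.cons_lt_cons_iff] at h ⊢
    refine h.imp_right fun ⟨hcd, h⟩ => ⟨hcd, ih (by simpa using hl) (fun hxy => ?_) h⟩
    exact hne (by rw [hcd, hxy])

lemma map_neg_lt_map_neg (hl : x.length = y.length) :
    x.map Neg.neg < y.map Neg.neg ↔ y < x := by
  induction x generalizing y with
  | nil => simp [List.length_eq_zero_iff.1 hl.symm]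
  | cons c x ih =>
    obtain ⟨d, y, rfl⟩ := List.exists_cons_of_length_eq_add_one hl.symm
    simp only [List.map_cons, List.cons_lt_cons_iff, ih (by simpa using hl), neg_lt_neg_iff,
      neg_inj, eq_comm]

lemma toLex_neg_lt_toLex_neg : toLex (-s) < toLex (-t) ↔ toLex t < toLex s := by
  simp [toLex_lt_iff, eq_comm]

lemma toLex_lt_of_block_lt {n m : ℕ} (h0 : block s 0 n = block t 0 n)
    (h : block s n m < block t n m) : toLex s < toLex t := by
  induction m generalizing n with
  | zero => simp [block] at h
  | succ m ih =>
    rw [block_succ, block_succ, List.cons_lt_cons_iff] at h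
    rcases h with h | ⟨heq, h⟩
    · exact toLex_lt_iff.2 ⟨n, fun j hj => by simpa using block_eq_block.1 h0 j hj, h⟩
    · refine ih (n := n + 1) ?_ h
      rw [block_add, block_add, h0, zero_add, block_one, block_one, heq]

lemma toLex_lt_of_head_lt (h : s 0 < t 0) : toLex s < toLex t :=
  toLex_lt_iff.2 ⟨0, fun j hj => absurd hj j.not_lt_zero, h⟩

lemma cons_le_cons {c : ℤ} (h : toLex s ≤ toLex t) : toLex (cons c s) ≤ toLex (cons c t) := by
  rcases h.lt_or_eq with h | h
  · obtain ⟨i, hi, hlt⟩ := toLex_lt_iff.1 h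
    refine le_of_lt (toLex_lt_iff.2 ⟨i + 1, fun j hj => ?_, hlt⟩)
    cases j with
    | zero => rfl
    | succ j => exact hi j (by lia)
  · rw [toLex_inj.1 h]

end Lexicographic

section Slopes

lemma lowerMech_zero_apply (α : ℝ) (n : ℕ) :
    lowerMech α 0 n = ⌊α * (n + 1 : ℕ)⌋ - ⌊α * n⌋ := by simp [lowerMech]

lemma upperMech_zero_apply (α : ℝ) (n : ℕ) :
    upperMech α 0 n = ⌈α * (n + 1 : ℕ)⌉ - ⌈α * n⌉ := by simp [upperMech]

lemma lowerMech_zero_zero (α : ℝ) : lowerMech α 0 0 = ⌊α⌋ := by simp [lowerMech]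

lemma upperMech_zero_zero (α : ℝ) : upperMech α 0 0 = ⌈α⌉ := by simp [upperMech]

lemma upperMech_neg (α : ℝ) : upperMech (-α) 0 = -lowerMech α 0 := by
  funext n
  rw [upperMech_zero_apply, Pi.neg_apply, lowerMech_zero_apply, neg_mul, neg_mul, Int.ceil_neg,
    Int.ceil_neg]
  ring

lemma lowerMech_neg (α : ℝ) : lowerMech (-α) 0 = -upperMech α 0 := by
  rw [← neg_neg (lowerMech (-α) 0), ← upperMech_neg, neg_neg]

lemma neg_intCast_div (h : ℤ) (l : ℕ) : ((-h : ℤ) : ℝ) / l = -((h : ℝ) / l) := by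
  rw [Int.cast_neg, neg_div]

variable {h h₁ h₂ k : ℤ} {l l₁ l₂ n : ℕ}

lemma floor_div_mul_eq_iff (hl : 0 < l) :
    ⌊(h : ℝ) / l * n⌋ = k ↔ k * l ≤ h * n ∧ h * n < (k + 1) * l := by
  have hl' : (0 : ℝ) < l := by exact_mod_cast hl
  rw [Int.floor_eq_iff, div_mul_eq_mul_div, le_div_iff₀ hl', div_lt_iff₀ hl']
  norm_cast

lemma floor_div_mul_self (h : ℤ) (hl : 0 < l) : ⌊(h : ℝ) / l * l⌋ = h := by
  rw [floor_div_mul_eq_iff hl]; constructor <;> nlinarith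

lemma ceil_div_mul (h : ℤ) (l n : ℕ) : ⌈(h : ℝ) / l * n⌉ = -⌊((-h : ℤ) : ℝ) / l * n⌋ := by
  rw [← Int.ceil_neg, neg_intCast_div, neg_mul, neg_neg]

lemma ceil_div_mul_eq_floor_add_one (hcop : IsCoprime h (l : ℤ)) (hn : 0 < n) (hnl : n < l) :
    ⌈(h : ℝ) / l * n⌉ = ⌊(h : ℝ) / l * n⌋ + 1 := by
  obtain ⟨k, hk⟩ : ∃ k, ⌊(h : ℝ) / l * n⌋ = k := ⟨_, rfl⟩
  have hl : 0 < l := by lia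
  obtain ⟨hle, hlt⟩ := (floor_div_mul_eq_iff hl).1 hk
  have hne : k * l ≠ h * n := fun he =>
    hnl.not_ge (Nat.le_of_dvd hn (Int.natCast_dvd_natCast.1
      (hcop.symm.dvd_of_dvd_mul_left ⟨k, by rw [← he, mul_comm]⟩)))
  rw [ceil_div_mul, neg_eq_iff_eq_neg, floor_div_mul_eq_iff hl, hk]
  have := lt_of_le_of_ne hle hne
  constructor <;> linarith

lemma lowerMech_div_add (h : ℤ) (hl : 0 < l) (n : ℕ) :
    lowerMech ((h : ℝ) / l) 0 (n + l) = lowerMech ((h : ℝ) / l) 0 n := by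
  have hfloor (m : ℕ) : ⌊(h : ℝ) / l * (m + l : ℕ)⌋ = ⌊(h : ℝ) / l * m⌋ + h := by
    rw [← Int.floor_add_intCast]
    congr 1
    push_cast
    field_simp
  rw [lowerMech_zero_apply, lowerMech_zero_apply, add_right_comm, hfloor, hfloor]
  ring

lemma floor_mediant_mul (hl₁ : 0 < l₁) (hdet : l₁ * h₂ - h₁ * l₂ = 1) (hn : n < l₁ + l₂) :
    ⌊((h₁ + h₂ : ℤ) : ℝ) / (l₁ + l₂ : ℕ) * n⌋ = ⌊(h₁ : ℝ) / l₁ * n⌋ := by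
  obtain ⟨k, hk⟩ : ∃ k, ⌊(h₁ : ℝ) / l₁ * n⌋ = k := ⟨_, rfl⟩
  obtain ⟨hz0, hz1⟩ := (floor_div_mul_eq_iff hl₁).1 hk
  rw [hk, floor_div_mul_eq_iff (by lia)]
  push_cast
  obtain ⟨y, hy⟩ : ∃ y, y = h₂ * n - k * l₂ := ⟨_, rfl⟩
  have hyn : l₁ * y = n + l₂ * (h₁ * n - k * l₁) := by rw [hy]; linear_combination n * hdet
  have hy0 : 0 ≤ y := by
    by_contra! hy0
    nlinarith [Nat.cast_nonneg (α := ℤ) n]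
  have hy1 : y ≤ l₂ := by
    by_contra! hy1
    nlinarith
  constructor <;> linarith

lemma floor_mediant_mul_add (hl₁ : 0 < l₁) (hl₂ : 0 < l₂) (hdet : l₁ * h₂ - h₁ * l₂ = 1)
    (hn : n ≤ l₂) :
    ⌊((h₁ + h₂ : ℤ) : ℝ) / (l₁ + l₂ : ℕ) * (l₁ + n : ℕ)⌋ = h₁ + ⌊(h₂ : ℝ) / l₂ * n⌋ := by
  obtain ⟨k, hk⟩ : ∃ k, ⌊(h₂ : ℝ) / l₂ * n⌋ = k := ⟨_, rfl⟩
  obtain ⟨hy0, hy1⟩ := (floor_div_mul_eq_iff hl₂).1 hk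
  rw [hk, floor_div_mul_eq_iff (by lia)]
  push_cast
  obtain ⟨z, hz⟩ : ∃ z, z = h₁ * n - k * l₁ := ⟨_, rfl⟩
  have hzn : l₂ * z = l₁ * (h₂ * n - k * l₂) - n := by rw [hz]; linear_combination -n * hdet
  have hz0 : -1 ≤ z := by
    by_contra! hz0
    nlinarith
  have hz1 : z < l₁ := by
    by_contra! hz1
    nlinarith [Nat.cast_nonneg (α := ℤ) n]
  constructor <;> linarith

end Slopes

section Farey

variable {a h h₁ h₂ : ℤ} {l l₁ l₂ : ℕ}

lemma exists_farey_parents (hcop : IsCoprime h (l : ℤ)) (hl : 1 < l) :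
    ∃ (h₁ h₂ : ℤ) (l₁ l₂ : ℕ), 0 < l₁ ∧ 0 < l₂ ∧ h = h₁ + h₂ ∧ l = l₁ + l₂ ∧
      l₁ * h₂ - h₁ * l₂ = 1 := by
  obtain ⟨x, y, hxy⟩ := hcop
  have hlz : (0 : ℤ) < l := by lia
  have hmod := Int.emod_add_mul_ediv x l
  obtain ⟨l₁, hl₁⟩ := Int.eq_ofNat_of_zero_le (Int.emod_nonneg x hlz.ne')
  have hlt := Int.emod_lt_of_pos x hlz
  rw [hl₁] at hmod hlt
  obtain ⟨h₁, hdet⟩ : ∃ h₁ : ℤ, l₁ * h - h₁ * l = 1 :=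
    ⟨-(y + x / (l : ℤ) * h), by linear_combination hxy + h * hmod⟩
  have hl₁_pos : 0 < l₁ := by
    rcases Nat.eq_zero_or_pos l₁ with rfl | hpos
    · have : (l : ℤ) = 1 := Int.eq_one_of_dvd_one hlz.le ⟨-h₁, by push_cast at hdet; linarith⟩
      lia
    · exact hpos
  obtain ⟨l₂, rfl⟩ := Nat.exists_eq_add_of_le (show l₁ ≤ l by lia)
  refine ⟨h₁, h - h₁, l₁, l₂, hl₁_pos, by lia, by ring, rfl, ?_⟩
  push_cast at hdet
  linear_combination hdet

lemma mul_lt_and_mul_lt_of_det (hl₁ : 0 < l₁) (hdet : l₁ * h₂ - h₁ * l₂ = 1)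
    (hgt : a * (l₁ + l₂) + 1 < h₁ + h₂) : a * l₁ < h₁ ∧ a * l₂ < h₂ := by
  obtain ⟨e₁, rfl⟩ : ∃ e₁, h₁ = a * l₁ + e₁ := ⟨h₁ - a * l₁, by ring⟩
  obtain ⟨e₂, rfl⟩ : ∃ e₂, h₂ = a * l₂ + e₂ := ⟨h₂ - a * l₂, by ring⟩
  have hdet' : l₁ * e₂ - e₁ * l₂ = 1 := by linear_combination hdet
  have hsum : 1 < e₁ + e₂ := by linarith
  have hl₁z : (1 : ℤ) ≤ l₁ := by exact_mod_cast hl₁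
  have hl₂z : (0 : ℤ) ≤ l₂ := by positivity
  have h₁_pos : 0 < e₁ := by
    by_contra! hle
    nlinarith [hdet', hsum, hl₁z, hl₂z]
  have h₂_pos : 0 < e₂ := by
    by_contra! hle
    nlinarith [hdet', hsum, hl₁z, hl₂z]
  constructor <;> linarith

/- Write `r = l₁ * h - h₁ * l` and let `m₁`, `m₂` be the denominators of the Farey parents of
`h / l`. The floors at `m₂` and the ceilings at `m₁` are extremal, so that `m₂ < l₂` or `m₁ < l₁`
would force `r < 1`; hence `l₁ = m₁`. -/
lemma det_eq_one_of_floor_add (hcop : IsCoprime h (l : ℤ)) (hl : l = l₁ + l₂) (hl₁ : 0 < l₁)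
    (hl₂ : 0 < l₂)
    (hfloor : ∀ n < l₂, ⌊(h : ℝ) / l * (l₁ + n : ℕ)⌋ = h₁ + ⌊(h : ℝ) / l * n⌋)
    (hceil : ∀ n < l₁, ⌈(h : ℝ) / l * (l₂ + n : ℕ)⌉ = h - h₁ + ⌈(h : ℝ) / l * n⌉) :
    l₁ * h - h₁ * l = 1 := by
  have hl_pos : 0 < l := by lia
  have hlz : (l : ℤ) = l₁ + l₂ := by exact_mod_cast hl
  obtain ⟨hr_nonneg, hr_lt⟩ := (floor_div_mul_eq_iff hl_pos).1 (hfloor 0 hl₂)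
  simp only [Nat.cast_zero, mul_zero, Int.floor_zero, add_zero] at hr_nonneg hr_lt
  have hr_ne : h₁ * l ≠ h * l₁ := fun he => by
    have := Nat.le_of_dvd hl₁ (Int.natCast_dvd_natCast.1
      (hcop.symm.dvd_of_dvd_mul_left ⟨h₁, by rw [← he, mul_comm]⟩))
    lia
  have hr_pos := lt_of_le_of_ne hr_nonneg hr_ne
  obtain ⟨k₁, k₂, m₁, m₂, -, -, hk, hm, hdet⟩ := exists_farey_parents hcop (by lia)
  have hmz : (l : ℤ) = m₁ + m₂ := by exact_mod_cast hm
  have hparent₁ : m₁ * h - k₁ * l = 1 := by rw [hk, hmz]; linear_combination hdet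
  have hparent₂ : k₂ * l - m₂ * h = 1 := by rw [hk, hmz]; linear_combination hdet
  have hm₂ : l₂ ≤ m₂ := by
    by_contra! hlt
    have hval : ⌊(h : ℝ) / l * m₂⌋ = k₂ - 1 := by
      rw [floor_div_mul_eq_iff hl_pos]; constructor <;> nlinarith
    have hbound := hfloor m₂ hlt
    rw [hval, floor_div_mul_eq_iff hl_pos] at hbound
    push_cast at hbound
    linarith
  have hm₁ : l₁ ≤ m₁ := by
    by_contra! hlt
    have hval : ⌊((-h : ℤ) : ℝ) / l * m₁⌋ = -(k₁ + 1) := by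
      rw [floor_div_mul_eq_iff hl_pos]; constructor <;> nlinarith
    have hbound := hceil m₁ hlt
    rw [ceil_div_mul, ceil_div_mul, hval, neg_eq_iff_eq_neg, floor_div_mul_eq_iff hl_pos] at hbound
    push_cast [hlz] at hbound
    rw [hlz] at hr_pos hparent₁
    linarith
  obtain rfl : m₁ = l₁ := by lia
  have hdvd : (l : ℤ) ∣ m₁ * h - h₁ * l - 1 := ⟨k₁ - h₁, by linear_combination hparent₁⟩
  have := Int.eq_zero_of_dvd_of_nonneg_of_lt (by linarith) (by linarith) hdvd
  linarith

end Farey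

section Tails

variable {h : ℤ} {l : ℕ}

/-- The lower mechanical word of slope `φ` and intercept `0` without its first letter. -/
noncomputable def lowerTail (φ : ℝ) : ℕ → ℤ := shift (lowerMech φ 0) 1

/-- The upper mechanical word of slope `φ` and intercept `0` without its first letter. -/
noncomputable def upperTail (φ : ℝ) : ℕ → ℤ := shift (upperMech φ 0) 1

lemma lowerTail_neg (φ : ℝ) : lowerTail (-φ) = -upperTail φ := by
  rw [lowerTail, lowerMech_neg]; rfl

lemma upperTail_neg (φ : ℝ) : upperTail (-φ) = -lowerTail φ := by
  rw [upperTail, upperMech_neg]; rfl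

lemma cons_ceil_upperTail (φ : ℝ) : cons ⌈φ⌉ (upperTail φ) = upperMech φ 0 := by
  rw [← upperMech_zero_zero, upperTail, cons_shift]

lemma shift_lowerTail_div (h : ℤ) (hl : 0 < l) :
    shift (lowerTail ((h : ℝ) / l)) l = lowerTail ((h : ℝ) / l) := by
  funext n
  simp only [lowerTail, shift]
  rw [add_right_comm, lowerMech_div_add h hl]

end Tails

section Central

/-- `u` is the central word over `{a, a + 1}` of slope `h / l`: this is `IsCentral a u` with the
slope made explicit. -/
structure IsCentralOf (a : ℤ) (u : List ℤ) (h : ℤ) (l : ℕ) : Prop where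
  pos : 0 < l
  coprime : IsCoprime h (l : ℤ)
  mul_lt : a * l < h
  lt_mul : h < (a + 1) * l
  block_lower : a :: (u ++ [a + 1]) = block (lowerMech ((h : ℝ) / (l : ℝ)) 0) 0 l

variable {a h : ℤ} {u : List ℤ} {l : ℕ}

lemma IsCentralOf.isCentral (H : IsCentralOf a u h l) : IsCentral a u :=
  ⟨h, l, H.pos, H.coprime, H.mul_lt, H.lt_mul, H.block_lower⟩

lemma IsCentral.exists_isCentralOf (H : IsCentral a u) : ∃ h l, IsCentralOf a u h l :=
  let ⟨h, l, hpos, hcop, hlt, hgt, hblock⟩ := H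
  ⟨h, l, hpos, hcop, hlt, hgt, hblock⟩

lemma block_add_two (w : ℕ → ℤ) (m : ℕ) :
    block w 0 (m + 2) = w 0 :: (block w 1 m ++ [w (m + 1)]) := by
  rw [block_succ, block_add, block_one, add_comm (0 + 1) m]

lemma cons_append_eq_block_iff {w : ℕ → ℤ} {c d : ℤ} {m : ℕ} (hm : m = u.length + 2) :
    c :: (u ++ [d]) = block w 0 m ↔
      w 0 = c ∧ block w 1 u.length = u ∧ w (u.length + 1) = d := by
  subst hm
  rw [block_add_two, List.cons.injEq, ← List.concat_eq_append, ← List.concat_eq_append,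
    List.concat_inj, eq_comm, @eq_comm _ u, @eq_comm _ d]

namespace IsCentralOf

lemma length_eq (H : IsCentralOf a u h l) : l = u.length + 2 := by
  simpa using (congrArg List.length H.block_lower).symm

lemma lt_slope (H : IsCentralOf a u h l) : (a : ℝ) < (h : ℝ) / l := by
  rw [lt_div_iff₀ (by exact_mod_cast H.pos)]
  exact_mod_cast H.mul_lt

lemma slope_lt (H : IsCentralOf a u h l) : (h : ℝ) / l < a + 1 := by
  rw [div_lt_iff₀ (by exact_mod_cast H.pos)]
  exact_mod_cast H.lt_mul

lemma floor_eq (H : IsCentralOf a u h l) : ⌊(h : ℝ) / l⌋ = a :=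
  Int.floor_eq_iff.2 ⟨H.lt_slope.le, H.slope_lt⟩

lemma ceil_eq (H : IsCentralOf a u h l) : ⌈(h : ℝ) / l⌉ = a + 1 := by
  rw [Int.ceil_eq_iff]
  push_cast
  exact ⟨by linarith [H.lt_slope], H.slope_lt.le⟩

lemma unique {v : List ℤ} (H : IsCentralOf a u h l) (H' : IsCentralOf a v h l) : u = v := by
  have heq := H.block_lower.trans H'.block_lower.symm
  rw [List.cons.injEq] at heq
  exact List.append_cancel_right heq.2

lemma block_upper (H : IsCentralOf a u h l) :
    (a + 1) :: (u ++ [a]) = block (upperMech ((h : ℝ) / l) 0) 0 l := by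
  have hl := H.length_eq
  obtain ⟨-, hmid, hlast⟩ := (cons_append_eq_block_iff hl).1 H.block_lower
  rw [cons_append_eq_block_iff hl, upperMech_zero_zero]
  refine ⟨H.ceil_eq, Eq.trans (block_eq_block.2 fun k hk => ?_) hmid, ?_⟩
  · rw [upperMech_zero_apply, lowerMech_zero_apply,
      ceil_div_mul_eq_floor_add_one H.coprime (by lia) (by lia),
      ceil_div_mul_eq_floor_add_one H.coprime (by lia) (by lia)]
    ring
  · have hl' : u.length + 1 + 1 = l := hl.symm
    rw [lowerMech_zero_apply, hl', floor_div_mul_self _ H.pos] at hlast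
    rw [upperMech_zero_apply, hl', ceil_div_mul, floor_div_mul_self _ H.pos,
      ceil_div_mul_eq_floor_add_one H.coprime (by lia) (by lia)]
    linarith

lemma neg (H : IsCentralOf a u h l) : IsCentralOf (-a - 1) (u.map Neg.neg) (-h) l where
  pos := H.pos
  coprime := H.coprime.neg_left
  mul_lt := by linarith [H.lt_mul]
  lt_mul := by linarith [H.mul_lt]
  block_lower := by
    rw [neg_intCast_div, lowerMech_neg, block_neg, ← H.block_upper]
    simp [sub_eq_neg_add]

lemma shift_lowerTail (H : IsCentralOf a u h l) :
    shift (lowerTail ((h : ℝ) / l)) (u.length + 2) = lowerTail ((h : ℝ) / l) := by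
  rw [← H.length_eq]
  exact shift_lowerTail_div h H.pos

lemma block_lowerTail (H : IsCentralOf a u h l) :
    block (lowerTail ((h : ℝ) / l)) 0 (u.length + 2) = u ++ [a + 1, a] := by
  have hlast : lowerMech ((h : ℝ) / l) 0 (0 + l) = a := by
    rw [lowerMech_div_add h H.pos, lowerMech_zero_zero, H.floor_eq]
  have hblock : block (lowerMech ((h : ℝ) / l) 0) 0 (l + 1) = a :: (u ++ [a + 1]) ++ [a] := by
    rw [block_add, ← H.block_lower, block_one, hlast]
  rw [block_succ, List.cons_append, List.cons.injEq] at hblock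
  rw [lowerTail, block_shift, ← H.length_eq, hblock.2]
  simp

lemma block_upperTail (H : IsCentralOf a u h l) :
    block (upperTail ((h : ℝ) / l)) 0 (u.length + 2) = u ++ [a, a + 1] := by
  have hneg := H.neg.block_lowerTail
  rw [neg_intCast_div, lowerTail_neg, block_neg, List.length_map] at hneg
  apply List.map_injective_iff.2 (neg_injective (G := ℤ))
  simpa [sub_eq_neg_add] using hneg

lemma block_lowerTail_period (H : IsCentralOf a u h l) :
    block (lowerTail ((h : ℝ) / l)) (u.length + 2) (u.length + 2) = u ++ [a + 1, a] := by
  rw [← H.block_lowerTail, ← add_zero (u.length + 2), ← block_shift, add_zero, H.shift_lowerTail]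

lemma block_upperTail_period (H : IsCentralOf a u h l) :
    block (upperTail ((h : ℝ) / l)) (u.length + 2) (u.length + 2) = u ++ [a, a + 1] := by
  have hneg := H.neg.block_lowerTail_period
  rw [neg_intCast_div, lowerTail_neg, block_neg, List.length_map] at hneg
  apply List.map_injective_iff.2 (neg_injective (G := ℤ))
  simpa [sub_eq_neg_add] using hneg

lemma lowerTail_prefix (H : IsCentralOf a u h l) :
    block (lowerTail ((h : ℝ) / l)) 0 u.length = u ∧
      block (lowerTail ((h : ℝ) / l)) u.length 2 = [a + 1, a] := by
  simpa using (block_add_eq_append rfl).1 H.block_lowerTail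

lemma upperTail_prefix (H : IsCentralOf a u h l) :
    block (upperTail ((h : ℝ) / l)) 0 u.length = u ∧
      block (upperTail ((h : ℝ) / l)) u.length 2 = [a, a + 1] := by
  simpa using (block_add_eq_append rfl).1 H.block_upperTail

lemma num_eq (H : IsCentralOf a u h l) : h = 2 * a + 1 + u.sum := by
  have hsum := congrArg List.sum H.block_lower
  rw [sum_block, psum_lowerMech_zero, floor_div_mul_self h H.pos] at hsum
  simp only [List.sum_cons, List.sum_append, List.sum_nil] at hsum
  linarith

end IsCentralOf

lemma lowerMech_eq_floor_or (φ : ℝ) (n : ℕ) :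
    lowerMech φ 0 n = ⌊φ⌋ ∨ lowerMech φ 0 n = ⌊φ⌋ + 1 := by
  rw [lowerMech_zero_apply, Nat.cast_succ, mul_add_one]
  have hle := Int.le_floor_add (φ * n) φ
  have hlt := Int.le_floor_add_floor (φ * n) φ
  lia

lemma sum_eq_mul_length_add_count {v : List ℤ} (hv : ∀ x ∈ v, x = a ∨ x = a + 1) :
    v.sum = a * v.length + v.count (a + 1) := by
  induction v with
  | nil => simp
  | cons c v ih =>
    rw [List.forall_mem_cons] at hv
    rw [List.sum_cons, List.length_cons, List.count_cons, ih hv.2]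
    rcases hv.1 with rfl | rfl <;> simp <;> ring

namespace IsCentralOf

lemma eq_or_eq_of_mem (H : IsCentralOf a u h l) {x : ℤ} (hx : x ∈ u) : x = a ∨ x = a + 1 := by
  rw [← H.lowerTail_prefix.1, block, List.mem_map] at hx
  obtain ⟨n, -, rfl⟩ := hx
  have := lowerMech_eq_floor_or ((h : ℝ) / l) (0 + n + 1)
  rwa [H.floor_eq] at this

lemma num_eq_count (H : IsCentralOf a u h l) :
    h = a * l + u.count (a + 1) + 1 := by
  rw [H.num_eq, sum_eq_mul_length_add_count fun _ => H.eq_or_eq_of_mem, H.length_eq]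
  push_cast
  ring

lemma slope_eq (H : IsCentralOf a u h l) :
    (h : ℝ) / l = a + ((u.count (a + 1) : ℝ) + 1) / ((u.length : ℝ) + 2) := by
  rw [H.num_eq_count, H.length_eq]
  push_cast
  field_simp
  ring

end IsCentralOf

lemma exists_isCentralOf (hcop : IsCoprime h (l : ℤ)) (hlt : a * l < h)
    (hgt : h < (a + 1) * l) : ∃ u, IsCentralOf a u h l := by
  have hl₂ : (1 : ℤ) < l := by linarith
  obtain ⟨m, rfl⟩ := Nat.exists_eq_add_of_le' (show 2 ≤ l by exact_mod_cast hl₂)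
  have hl : 0 < m + 2 := by lia
  refine ⟨block (lowerMech ((h : ℝ) / (m + 2 : ℕ)) 0) 1 m, hl, hcop, hlt, hgt, ?_⟩
  have hfirst : ⌊(h : ℝ) / (m + 2 : ℕ) * (1 : ℕ)⌋ = a := by
    rw [floor_div_mul_eq_iff hl]; push_cast at hlt hgt ⊢; constructor <;> linarith
  have hlast : ⌊(h : ℝ) / (m + 2 : ℕ) * (m + 1 : ℕ)⌋ = h - (a + 1) := by
    rw [floor_div_mul_eq_iff hl]; push_cast at hlt hgt ⊢; constructor <;> linarith
  rw [block_add_two, lowerMech_zero_zero, ← hfirst, lowerMech_zero_apply,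
    show m + 1 + 1 = m + 2 from rfl, floor_div_mul_self h hl, hlast]
  simp [← hfirst]

lemma isCentralOf_replicate (a : ℤ) (k : ℕ) :
    IsCentralOf a (List.replicate k a) (a * (k + 2) + 1) (k + 2) := by
  obtain ⟨u, H⟩ := exists_isCentralOf (a := a) (h := a * (k + 2) + 1) (l := k + 2)
    ⟨1, -a, by push_cast; ring⟩ (by push_cast; linarith) (by push_cast; linarith)
  have hlen : u.length = k := by have := H.length_eq; lia
  have hcount : u.count (a + 1) = 0 := by have := H.num_eq_count; push_cast at this; lia
  obtain rfl : u = List.replicate k a := List.eq_replicate_iff.2 ⟨hlen, fun x hx =>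
    (H.eq_or_eq_of_mem hx).resolve_right fun he => List.count_eq_zero.1 hcount (he ▸ hx)⟩
  exact H

lemma isCentralOf_replicate_succ (a : ℤ) (k : ℕ) :
    IsCentralOf a (List.replicate k (a + 1)) ((a + 1) * (k + 2) - 1) (k + 2) := by
  have hneg := (isCentralOf_replicate (-a - 1) k).neg
  rw [List.map_replicate] at hneg
  convert hneg using 1 <;> ring_nf

end Central

section Mediant

variable {a h h₁ h₂ : ℤ} {l l₁ l₂ : ℕ} {p q u : List ℤ}

lemma block_lowerMech_mediant (hl₁ : 0 < l₁) (hl₂ : 0 < l₂) (hdet : l₁ * h₂ - h₁ * l₂ = 1) :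
    block (lowerMech (((h₁ + h₂ : ℤ) : ℝ) / (l₁ + l₂ : ℕ)) 0) 0 (l₁ + l₂) =
      block (lowerMech ((h₁ : ℝ) / l₁) 0) 0 l₁ ++ block (lowerMech ((h₂ : ℝ) / l₂) 0) 0 l₂ := by
  rw [block_add_eq_append (length_block _ _ _), zero_add]
  refine ⟨block_eq_of_psum_add fun k hk => ?_, block_eq_of_psum_add fun k hk => ?_⟩
  · rw [zero_add, psum_zero, zero_add, psum_lowerMech_zero, psum_lowerMech_zero,
      floor_mediant_mul hl₁ hdet (by lia)]
  · rw [psum_lowerMech_zero, psum_lowerMech_zero, psum_lowerMech_zero,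
      floor_mediant_mul_add hl₁ hl₂ hdet hk, floor_mediant_mul hl₁ hdet (by lia),
      floor_div_mul_self h₁ hl₁]

lemma block_upperMech_mediant (hl₁ : 0 < l₁) (hl₂ : 0 < l₂) (hdet : l₁ * h₂ - h₁ * l₂ = 1) :
    block (upperMech (((h₁ + h₂ : ℤ) : ℝ) / (l₁ + l₂ : ℕ)) 0) 0 (l₁ + l₂) =
      block (upperMech ((h₂ : ℝ) / l₂) 0) 0 l₂ ++ block (upperMech ((h₁ : ℝ) / l₁) 0) 0 l₁ := by
  have hneg := block_lowerMech_mediant (h₁ := -h₂) (h₂ := -h₁) hl₂ hl₁ (by linarith)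
  rw [← neg_add, neg_intCast_div, neg_intCast_div, neg_intCast_div, lowerMech_neg, lowerMech_neg,
    lowerMech_neg, block_neg, block_neg, block_neg, ← List.map_append] at hneg
  rw [add_comm h₁, add_comm l₁]
  exact List.map_injective_iff.2 neg_injective hneg

namespace IsCentralOf

lemma mediant (Hq : IsCentralOf a q h₁ l₁) (Hp : IsCentralOf a p h₂ l₂)
    (hdet : l₁ * h₂ - h₁ * l₂ = 1) :
    IsCentralOf a (q ++ [a + 1, a] ++ p) (h₁ + h₂) (l₁ + l₂) where
  pos := by have := Hq.pos; lia
  coprime := ⟨-l₂, h₂, by push_cast; linarith⟩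
  mul_lt := by push_cast; linarith [Hq.mul_lt, Hp.mul_lt]
  lt_mul := by push_cast; linarith [Hq.lt_mul, Hp.lt_mul]
  block_lower := by
    rw [block_lowerMech_mediant Hq.pos Hp.pos hdet, ← Hq.block_lower, ← Hp.block_lower]
    simp

lemma append_comm_of_det (Hq : IsCentralOf a q h₁ l₁) (Hp : IsCentralOf a p h₂ l₂)
    (hdet : l₁ * h₂ - h₁ * l₂ = 1) : p ++ [a, a + 1] ++ q = q ++ [a + 1, a] ++ p := by
  have hupper := (Hq.mediant Hp hdet).block_upper
  rw [block_upperMech_mediant Hq.pos Hp.pos hdet, ← Hq.block_upper, ← Hp.block_upper] at hupper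
  have happend : (q ++ [a + 1, a] ++ p) ++ [a] = (p ++ [a, a + 1] ++ q) ++ [a] := by
    simpa using hupper
  exact (List.append_cancel_right happend).symm

lemma lowerTail_mediant_prefix (hl₁ : 0 < l₁) (H : IsCentralOf a u (h₁ + h₂) (l₁ + l₂))
    (hdet : l₁ * h₂ - h₁ * l₂ = 1) : block (lowerTail ((h₁ : ℝ) / l₁)) 0 u.length = u := by
  have hl := H.length_eq
  nth_rw 2 [← H.lowerTail_prefix.1]
  simp only [lowerTail]
  rw [block_shift, block_shift, block_eq_block]
  intro k hk
  rw [lowerMech_zero_apply, lowerMech_zero_apply, floor_mediant_mul hl₁ hdet (by lia),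
    floor_mediant_mul hl₁ hdet (by lia)]

theorem eq_replicate_or_eq_append (H : IsCentralOf a u h l) :
    (∃ k, u = List.replicate k a) ∨ (∃ k, u = List.replicate k (a + 1)) ∨
      ∃ p q, IsCentral a p ∧ IsCentral a q ∧ u = p ++ [a, a + 1] ++ q ∧
        u = q ++ [a + 1, a] ++ p := by
  have hl := H.length_eq
  by_cases hlow : h = a * l + 1
  · rw [hlow, hl] at H
    exact Or.inl ⟨u.length, H.unique (by simpa using isCentralOf_replicate a u.length)⟩
  by_cases hhigh : h = (a + 1) * l - 1
  · rw [hhigh, hl] at H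
    exact Or.inr (Or.inl ⟨_, H.unique (by simpa using isCentralOf_replicate_succ a u.length)⟩)
  obtain ⟨h₁, h₂, l₁, l₂, hl₁, hl₂, rfl, rfl, hdet⟩ := exists_farey_parents H.coprime (by lia)
  obtain ⟨hlt₁, hlt₂⟩ := mul_lt_and_mul_lt_of_det (a := a) hl₁ hdet (by
    have := H.mul_lt; push_cast at *; lia)
  obtain ⟨hgt₂, hgt₁⟩ := mul_lt_and_mul_lt_of_det (a := -(a + 1)) (h₁ := -h₂) (h₂ := -h₁)
    (l₂ := l₁) hl₂ (by linarith) (by have := H.lt_mul; push_cast at *; lia)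
  obtain ⟨q, Hq⟩ := exists_isCentralOf (a := a) (h := h₁) (l := l₁)
    ⟨-l₂, h₂, by linarith⟩ hlt₁ (by linarith)
  obtain ⟨p, Hp⟩ := exists_isCentralOf (a := a) (h := h₂) (l := l₂)
    ⟨l₁, -h₁, by linarith⟩ hlt₂ (by linarith)
  have hu := H.unique (Hq.mediant Hp hdet)
  exact Or.inr (Or.inr ⟨p, q, Hp.isCentral, Hq.isCentral,
    hu.trans (Hq.append_comm_of_det Hp hdet).symm, hu⟩)

lemma floor_mul_add (H : IsCentralOf a u h l) (Hq : IsCentralOf a q h₁ l₁)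
    (Hp : IsCentralOf a p h₂ l₂) (hu : u = p ++ [a, a + 1] ++ q)
    (hu' : u = q ++ [a + 1, a] ++ p) {n : ℕ} (hn : n < l₂) :
    ⌊(h : ℝ) / l * (l₁ + n : ℕ)⌋ = h₁ + ⌊(h : ℝ) / l * n⌋ := by
  have hl : l = l₁ + l₂ := by simp [H.length_eq, Hq.length_eq, Hp.length_eq, hu']; lia
  have hsplit : block (lowerMech ((h : ℝ) / l) 0) 0 (l₁ + l₂) =
      (a :: (q ++ [a + 1])) ++ (a :: (p ++ [a + 1])) := by
    rw [← hl, ← H.block_lower, hu']; simp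
  obtain ⟨hfirst, hsecond⟩ := (block_add_eq_append (by simp [Hq.length_eq])).1 hsplit
  have hnum : ⌊(h : ℝ) / l * l₁⌋ = h₁ := by
    rw [← psum_lowerMech_zero, ← sum_block, hfirst, Hq.num_eq]; simp; ring
  have hlen : l = (p.length + 1) + (q.length + 3) := by rw [H.length_eq, hu]; simp; lia
  have hprefix : block (lowerMech ((h : ℝ) / l) 0) 0 (p.length + 1) = a :: p := by
    have hsplit' : block (lowerMech ((h : ℝ) / l) 0) 0 ((p.length + 1) + (q.length + 3)) =
        (a :: p) ++ ([a, a + 1] ++ q ++ [a + 1]) := by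
      rw [← hlen, ← H.block_lower, hu]; simp
    exact ((block_add_eq_append (by simp)).1 hsplit').1
  have hperiod : block (lowerMech ((h : ℝ) / l) 0) l₁ (p.length + 1) =
      block (lowerMech ((h : ℝ) / l) 0) 0 (p.length + 1) := by
    rw [Hp.length_eq, show a :: (p ++ [a + 1]) = (a :: p) ++ [a + 1] from rfl, zero_add,
      show p.length + 2 = (p.length + 1) + 1 from rfl] at hsecond
    exact ((block_add_eq_append (by simp)).1 hsecond).1.trans hprefix.symm
  have hsum := psum_add_of_block_eq hperiod (k := n) (by have := Hp.length_eq; lia)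
  rwa [psum_lowerMech_zero, psum_lowerMech_zero, psum_lowerMech_zero, hnum] at hsum

theorem det_eq_one (H : IsCentralOf a u h l) (Hq : IsCentralOf a q h₁ l₁)
    (Hp : IsCentralOf a p h₂ l₂) (hu : u = p ++ [a, a + 1] ++ q)
    (hu' : u = q ++ [a + 1, a] ++ p) :
    h = h₁ + h₂ ∧ l = l₁ + l₂ ∧ l₁ * h₂ - h₁ * l₂ = 1 := by
  have hl : l = l₁ + l₂ := by simp [H.length_eq, Hq.length_eq, Hp.length_eq, hu']; lia
  have hh : h = h₁ + h₂ := by simp [H.num_eq, Hq.num_eq, Hp.num_eq, hu']; ring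
  have hdet := det_eq_one_of_floor_add H.coprime hl Hq.pos Hp.pos
    (fun n hn => H.floor_mul_add Hq Hp hu hu' hn) fun n hn => by
      have hneg := H.neg.floor_mul_add Hp.neg Hq.neg (by simp [hu', sub_eq_neg_add])
        (by simp [hu, sub_eq_neg_add]) hn
      rw [ceil_div_mul, ceil_div_mul, hneg, hh]
      ring
  refine ⟨hh, hl, ?_⟩
  rw [hh, hl] at hdet
  push_cast at hdet
  linarith

end IsCentralOf

end Mediant

section SharpSlope

variable {a : ℤ} {d d₁ d₂ s : ℕ → ℤ} {φ ψ : ℝ}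

/-- `φ` is the largest slope whose upper mechanical word is at most `d`; only positive slopes are
compared, since these are the arguments of `Ξ` and `Δ`. -/
def IsSharpSlope (d : ℕ → ℤ) (φ : ℝ) : Prop :=
  ∀ α : ℝ, 0 < α → (toLex (upperMech α 0) ≤ toLex d ↔ α ≤ φ)

lemma IsSharpSlope.unique (hφ : IsSharpSlope d φ) (hψ : IsSharpSlope d ψ) (h0φ : 0 ≤ φ)
    (h0ψ : 0 ≤ ψ) : φ = ψ := by
  rcases lt_trichotomy φ ψ with h | h | h
  · exact absurd ((hφ ψ (h0φ.trans_lt h)).1 ((hψ ψ (h0φ.trans_lt h)).2 le_rfl)) (not_le.2 h)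
  · exact h
  · exact absurd ((hψ φ (h0ψ.trans_lt h)).1 ((hφ φ (h0ψ.trans_lt h)).2 le_rfl)) (not_le.2 h)

lemma IsSharpSlope.of_le_of_le (h₁ : IsSharpSlope d₁ φ) (h₂ : IsSharpSlope d₂ φ)
    (hd₁ : toLex d₁ ≤ toLex d) (hd₂ : toLex d ≤ toLex d₂) : IsSharpSlope d φ := fun α hα =>
  ⟨fun h => (h₂ α hα).1 (h.trans hd₂), fun h => ((h₁ α hα).2 h).trans hd₁⟩

lemma isSharpSlope_upperMech (φ : ℝ) : IsSharpSlope (upperMech φ 0) φ := fun _ _ =>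
  upperMech_strictMono.le_iff_le

lemma psum_cons_lowerTail (φ : ℝ) (n : ℕ) :
    psum (cons (⌊φ⌋ + 1) (lowerTail φ)) (n + 1) = ⌊φ * (n + 1 : ℕ)⌋ + 1 := by
  rw [psum_cons_succ, lowerTail, psum_shift, psum_lowerMech_zero, psum_lowerMech_zero,
    Nat.cast_one, mul_one]
  ring

theorem isSharpSlope_cons_lowerTail (φ : ℝ) :
    IsSharpSlope (cons (⌊φ⌋ + 1) (lowerTail φ)) φ := by
  refine fun α _ => ⟨fun h => not_lt.1 fun hφα => h.not_gt ?_, fun hαφ => ?_⟩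
  · obtain ⟨n, hn⟩ := exists_floor_add_one_lt_ceil hφα
    have hn0 : n ≠ 0 := by rintro rfl; simp at hn
    obtain ⟨m, rfl⟩ := Nat.exists_eq_succ_of_ne_zero hn0
    refine toLex_lt_of_psum_le (fun k => ?_) (m := m + 1) ?_
    · cases k with
      | zero => simp only [psum_zero, le_refl]
      | succ k =>
        rw [psum_cons_lowerTail, psum_upperMech_zero]
        exact floor_mul_lt_ceil_mul hφα k.succ_pos
    · rwa [psum_cons_lowerTail, psum_upperMech_zero]
  · refine (upperMech_strictMono.monotone hαφ).trans (toLex_le_of_psum_le fun k => ?_)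
    cases k with
    | zero => simp only [psum_zero, le_refl]
    | succ k =>
      rw [psum_cons_lowerTail, psum_upperMech_zero]
      exact Int.ceil_le_floor_add_one _

theorem isSharpSlope_cons_of_mem_Icc (hfloor : ⌊φ⌋ = a) (hceil : ⌈φ⌉ = a + 1)
    (hU : toLex (upperTail φ) ≤ toLex s) (hL : toLex s ≤ toLex (lowerTail φ)) :
    IsSharpSlope (cons (a + 1) s) φ := by
  refine (isSharpSlope_upperMech φ).of_le_of_le (isSharpSlope_cons_lowerTail φ) ?_ ?_
  · rw [← cons_ceil_upperTail, hceil]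
    exact cons_le_cons hU
  · rw [hfloor]
    exact cons_le_cons hL

lemma upperMech_intCast (m : ℤ) : upperMech m 0 = fun _ => m := funext fun n => by
  have hceil (k : ℕ) : ⌈(m : ℝ) * k⌉ = m * k := by
    rw [← Int.cast_natCast, ← Int.cast_mul, Int.ceil_intCast]
  rw [upperMech_zero_apply, hceil, hceil]
  push_cast
  ring

lemma lowerMech_intCast (m : ℤ) : lowerMech m 0 = fun _ => m := by
  have hneg := upperMech_neg m
  rw [← Int.cast_neg, upperMech_intCast] at hneg
  rw [← neg_neg (lowerMech m 0), ← hneg]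
  ext n
  simp

lemma isSharpSlope_const (m : ℤ) : IsSharpSlope (fun _ => m) m :=
  upperMech_intCast m ▸ isSharpSlope_upperMech m

lemma isSharpSlope_cons_of_le_const (h : toLex s ≤ toLex fun _ => a) :
    IsSharpSlope (cons (a + 1) s) a := by
  refine (isSharpSlope_const a).of_le_of_le (isSharpSlope_cons_lowerTail a) ?_ ?_
  · exact (toLex_lt_of_head_lt (lt_add_one a)).le
  · rw [Int.floor_intCast, lowerTail, lowerMech_intCast]
    exact cons_le_cons h

lemma isSharpSlope_cons_of_const_le (h : toLex (fun _ => a + 1) ≤ toLex s) :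
    IsSharpSlope (cons (a + 1) s) (a + 1) := by
  suffices IsSharpSlope (cons (a + 1) s) (a + 1 : ℤ) by rwa [Int.cast_add, Int.cast_one] at this
  refine (isSharpSlope_const (a + 1)).of_le_of_le (isSharpSlope_cons_lowerTail _) ?_ ?_
  · rw [← cons_shift fun _ => a + 1]
    exact cons_le_cons h
  · rw [Int.floor_intCast]
    exact (toLex_lt_of_head_lt (lt_add_one (a + 1))).le

lemma isSharpSlope_cons_of_cons_eq_lowerMech (h : cons a s = lowerMech φ 0) :
    IsSharpSlope (cons (a + 1) s) φ := by
  have hfloor : a = ⌊φ⌋ := (congrFun h 0).trans (lowerMech_zero_zero φ)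
  have htail : s = lowerTail φ := funext fun n => (congrFun h (n + 1))
  rw [hfloor, htail]
  exact isSharpSlope_cons_lowerTail φ

theorem MeagerFreq.isSharpSlope (h : MeagerFreq a s φ) : IsSharpSlope (cons (a + 1) s) φ := by
  cases h with
  | low h => exact isSharpSlope_cons_of_le_const h
  | high h => exact isSharpSlope_cons_of_const_le h
  | mech _ _ h =>
    rcases h with h | h
    · exact isSharpSlope_cons_of_cons_eq_lowerMech h
    · exact h ▸ isSharpSlope_upperMech φ

lemma MeagerFreq.le (h : MeagerFreq a s φ) : (a : ℝ) ≤ φ := by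
  cases h with
  | low => exact le_rfl
  | high => exact (lt_add_one _).le
  | mech _ hα => exact hα.1

end SharpSlope

section Plateau

variable {a h h₁ h₂ : ℤ} {l l₁ l₂ k : ℕ} {p q u : List ℤ} {s : ℕ → ℤ} {φ : ℝ}

/-- `s` lies strictly between the upper and the lower tail of slope `φ`. Prefixing such a word with
the larger of the two letters of slope `φ` gives a word of sharp slope `φ`. -/
def InPlateau (s : ℕ → ℤ) (φ : ℝ) : Prop :=
  toLex (upperTail φ) < toLex s ∧ toLex s < toLex (lowerTail φ)

lemma inPlateau_neg_iff : InPlateau (-s) (-φ) ↔ InPlateau s φ := by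
  rw [InPlateau, upperTail_neg, lowerTail_neg, toLex_neg_lt_toLex_neg, toLex_neg_lt_toLex_neg,
    and_comm, InPlateau]

lemma InPlateau.of_neg (hs : InPlateau (-s) (((-h : ℤ) : ℝ) / l)) :
    InPlateau s ((h : ℝ) / l) := by
  rwa [neg_intCast_div, inPlateau_neg_iff] at hs

lemma pair_lt_pair_swap (a : ℤ) : [a, a + 1] < [a + 1, a] :=
  List.cons_lt_cons_iff.2 (Or.inl (lt_add_one a))

lemma block_eq_append_pair_append {x z : List ℤ} {c d : ℤ} :
    block s 0 (x ++ [c, d] ++ z).length = x ++ [c, d] ++ z ↔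
      block s 0 x.length = x ∧ block s x.length 2 = [c, d] ∧
        block s (x.length + 2) z.length = z := by
  rw [List.append_assoc, List.length_append, List.length_append, block_add_eq_append rfl, zero_add,
    block_add_eq_append rfl]
  rfl

namespace IsLongestCentralPrefix

lemma block_ne (hL : IsLongestCentralPrefix a s u) {w : List ℤ} (hw : IsCentral a w)
    (hlen : u.length < w.length) : block s 0 w.length ≠ w :=
  fun h => (hL.2 w hw h).not_gt hlen

lemma neg (hL : IsLongestCentralPrefix a s u) :
    IsLongestCentralPrefix (-a - 1) (-s) (u.map Neg.neg) := by
  refine ⟨⟨?_, by rw [block_neg, List.length_map, hL.1.2]⟩, fun w hw hblock => ?_⟩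
  · obtain ⟨h, l, H⟩ := hL.1.1.exists_isCentralOf
    exact H.neg.isCentral
  · obtain ⟨h, l, H⟩ := hw.exists_isCentralOf
    have hw' : IsCentral a (w.map Neg.neg) := by simpa using H.neg.isCentral
    have hle := hL.2 _ hw' (by
      rw [List.length_map, ← neg_neg s, block_neg, hblock])
    simpa using hle

lemma ne_of_replicate {c : ℤ} (hL : IsLongestCentralPrefix a s (List.replicate k c))
    (hc : IsCentral a (List.replicate (k + 1) c)) : s k ≠ c := fun h => by
  have hpre := hL.1.2
  rw [List.length_replicate] at hpre
  refine hL.block_ne hc (by simp) ?_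
  rw [List.length_replicate, block_add, hpre, zero_add, block_one, h, List.replicate_succ']

end IsLongestCentralPrefix

namespace IsCentralOf

lemma lt_lowerTail (H : IsCentralOf a u h l) (hu : block s 0 u.length = u)
    (hs : block s u.length 2 < [a + 1, a] ∨ block s u.length 2 = [a + 1, a] ∧
      block s (u.length + 2) (u.length + 2) < u ++ [a + 1, a]) :
    toLex s < toLex (lowerTail ((h : ℝ) / l)) := by
  rcases hs with hpair | ⟨hpair, hs⟩
  · exact toLex_lt_of_block_lt (hu.trans H.lowerTail_prefix.1.symm)
      (hpair.trans_eq H.lowerTail_prefix.2.symm)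
  · refine toLex_lt_of_block_lt (n := u.length + 2) (m := u.length + 2) ?_ ?_
    · rw [H.block_lowerTail, block_add, hu, zero_add, hpair]
    · rwa [H.block_lowerTail_period]

lemma upperTail_lt (H : IsCentralOf a u h l) (hu : block s 0 u.length = u)
    (hs : [a, a + 1] < block s u.length 2 ∨ block s u.length 2 = [a, a + 1] ∧
      u ++ [a, a + 1] < block s (u.length + 2) (u.length + 2)) :
    toLex (upperTail ((h : ℝ) / l)) < toLex s := by
  have hpair : [-a - 1 + 1, -a - 1] = [a, a + 1].map Neg.neg := by simp [sub_eq_neg_add]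
  have hneg := H.neg.lt_lowerTail (s := -s) (by rw [block_neg, List.length_map, hu])
  rw [hpair, List.length_map, block_neg, block_neg, ← List.map_append,
    map_neg_lt_map_neg (by simp), map_neg_lt_map_neg (by simp),
    (List.map_injective_iff.2 neg_injective).eq_iff, neg_intCast_div, lowerTail_neg,
    toLex_neg_lt_toLex_neg] at hneg
  exact hneg hs

lemma inPlateau (H : IsCentralOf a u h l) (hu : block s 0 u.length = u)
    (hs : (block s u.length 2 = [a, a + 1] ∧
        u ++ [a, a + 1] < block s (u.length + 2) (u.length + 2)) ∨
      ([a, a + 1] < block s u.length 2 ∧ block s u.length 2 < [a + 1, a]) ∨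
      (block s u.length 2 = [a + 1, a] ∧
        block s (u.length + 2) (u.length + 2) < u ++ [a + 1, a])) :
    InPlateau s ((h : ℝ) / l) := by
  rcases hs with hs | ⟨hgt, hlt⟩ | hs
  · exact ⟨H.upperTail_lt hu (Or.inr hs),
      H.lt_lowerTail hu (Or.inl (hs.1.trans_lt (pair_lt_pair_swap a)))⟩
  · exact ⟨H.upperTail_lt hu (Or.inl hgt), H.lt_lowerTail hu (Or.inl hlt)⟩
  · exact ⟨H.upperTail_lt hu (Or.inl ((pair_lt_pair_swap a).trans_eq hs.1.symm)),
      H.lt_lowerTail hu (Or.inr hs)⟩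

lemma left_mediant (H : IsCentralOf a u h l) (Hq : IsCentralOf a q h₁ l₁)
    (Hp : IsCentralOf a p h₂ l₂) (hu : u = p ++ [a, a + 1] ++ q)
    (hu' : u = q ++ [a + 1, a] ++ p) :
    IsCentralOf a (u ++ [a, a + 1] ++ q) (h₁ + h) (l₁ + l) ∧ l₁ * h - h₁ * l = 1 := by
  obtain ⟨hh, hl, hdet⟩ := H.det_eq_one Hq Hp hu hu'
  have hdet' : l₁ * h - h₁ * l = 1 := by rw [hh, hl]; push_cast; linarith
  exact ⟨Hq.append_comm_of_det H hdet' ▸ Hq.mediant H hdet', hdet'⟩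

end IsCentralOf

lemma IsLongestCentralPrefix.inPlateau_left (hL : IsLongestCentralPrefix a s u)
    (Hq : IsCentralOf a q h₁ l₁) (Hp : IsCentralOf a p h₂ l₂) (hu : u = p ++ [a, a + 1] ++ q)
    (hu' : u = q ++ [a + 1, a] ++ p)
    (hs : block s u.length 2 < [a, a + 1] ∨ block s u.length 2 = [a, a + 1] ∧
      block s (u.length + 2) (u.length + 2) < u ++ [a, a + 1]) :
    InPlateau s ((h₁ : ℝ) / l₁) := by
  obtain ⟨h, l, H⟩ := hL.1.1.exists_isCentralOf
  obtain ⟨Hm, hdet⟩ := H.left_mediant Hq Hp hu hu'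
  obtain ⟨hsq, hspair, -⟩ := block_eq_append_pair_append.1 (hu' ▸ hL.1.2)
  refine ⟨Hq.upperTail_lt hsq (Or.inl (hspair ▸ pair_lt_pair_swap a)), ?_⟩
  obtain ⟨htu, htpair, htq⟩ :=
    block_eq_append_pair_append.1 (Hm.lowerTail_mediant_prefix Hq.pos hdet)
  rcases hs with hpair | ⟨hpair, hs⟩
  · exact toLex_lt_of_block_lt (hL.1.2.trans htu.symm) (hpair.trans_eq htpair.symm)
  · refine toLex_lt_of_block_lt (n := u.length + 2) (m := q.length) ?_ ?_
    · rw [block_add, block_add, htu, hL.1.2, zero_add, hpair, htpair]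
    have hne : block s (u.length + 2) q.length ≠ q := fun hq =>
      hL.block_ne Hm.isCentral (by simp) (block_eq_append_pair_append.2 ⟨hL.1.2, hpair, hq⟩)
    have hlen : u.length + 2 = q.length + (p.length + 4) := by simp [hu']; lia
    have happend : u ++ [a, a + 1] = q ++ ([a + 1, a] ++ p ++ [a, a + 1]) := by simp [hu']
    nth_rw 2 [hlen] at hs
    rw [block_add, happend] at hs
    rw [htq]
    exact lt_of_append_lt_append (length_block _ _ _) hne hs

lemma IsLongestCentralPrefix.inPlateau_right (hL : IsLongestCentralPrefix a s u)
    (Hq : IsCentralOf a q h₁ l₁) (Hp : IsCentralOf a p h₂ l₂) (hu : u = p ++ [a, a + 1] ++ q)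
    (hu' : u = q ++ [a + 1, a] ++ p)
    (hs : [a + 1, a] < block s u.length 2 ∨ block s u.length 2 = [a + 1, a] ∧
      u ++ [a + 1, a] < block s (u.length + 2) (u.length + 2)) :
    InPlateau s ((h₂ : ℝ) / l₂) := by
  have hpair : [-a - 1, -a - 1 + 1] = [a + 1, a].map Neg.neg := by simp [sub_eq_neg_add]
  refine (hL.neg.inPlateau_left Hp.neg Hq.neg (by simp [hu', sub_eq_neg_add])
    (by simp [hu, sub_eq_neg_add]) ?_).of_neg
  rw [hpair, List.length_map, block_neg, block_neg, ← List.map_append,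
    map_neg_lt_map_neg (by simp), map_neg_lt_map_neg (by simp),
    (List.map_injective_iff.2 neg_injective).eq_iff]
  exact hs

end Plateau

section Replicate

variable {a h : ℤ} {l k : ℕ} {s : ℕ → ℤ}

lemma replicate_append_cons (c : ℤ) (k : ℕ) (z : List ℤ) :
    List.replicate k c ++ c :: z = c :: (List.replicate k c ++ z) := by
  rw [← List.cons_append, ← List.replicate_succ, List.replicate_succ', List.append_assoc]
  rfl

namespace IsCentralOf

lemma block_lowerTail_replicate (H : IsCentralOf a (List.replicate k a) h l) :
    block (lowerTail ((h : ℝ) / l)) 0 k = List.replicate k a ∧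
      block (lowerTail ((h : ℝ) / l)) k (k + 1) = (a + 1) :: List.replicate k a := by
  have hfirst := H.block_lowerTail
  have hsecond := H.block_lowerTail_period
  rw [List.length_replicate] at hfirst hsecond
  have hblock : block (lowerTail ((h : ℝ) / l)) 0 (k + ((k + 1) + 3)) =
      List.replicate k a ++ ((a + 1) :: List.replicate k a ++ [a, a + 1, a]) := by
    rw [show k + ((k + 1) + 3) = (k + 2) + (k + 2) by lia, block_add, hfirst, zero_add, hsecond]
    simp [replicate_append_cons]
  rw [block_add_eq_append (by simp), zero_add, block_add_eq_append (by simp)] at hblock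
  exact ⟨hblock.1, hblock.2.1⟩

lemma block_upperTail_replicate (H : IsCentralOf a (List.replicate k a) h l) :
    block (upperTail ((h : ℝ) / l)) 0 (k + 1) = List.replicate (k + 1) a ∧
      block (upperTail ((h : ℝ) / l)) (k + 1) (k + 2) = (a + 1) :: List.replicate (k + 1) a := by
  have hfirst := H.block_upperTail
  have hsecond := H.block_upperTail_period
  rw [List.length_replicate] at hfirst hsecond
  have hblock : block (upperTail ((h : ℝ) / l)) 0 ((k + 1) + ((k + 2) + 1)) =
      List.replicate (k + 1) a ++ ((a + 1) :: List.replicate (k + 1) a ++ [a + 1]) := by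
    rw [show (k + 1) + ((k + 2) + 1) = (k + 2) + (k + 2) by lia, block_add, hfirst, zero_add,
      hsecond]
    simp [List.replicate_succ, replicate_append_cons]
  rw [block_add_eq_append (by simp), zero_add, block_add_eq_append (by simp)] at hblock
  exact ⟨hblock.1, hblock.2.1⟩

end IsCentralOf

lemma inPlateau_replicate (hL : IsLongestCentralPrefix a s (List.replicate k a))
    (H : IsCentralOf a (List.replicate k a) h l)
    (hgt : List.replicate (k + 1) a < block s k (k + 1))
    (hlt : block s k (k + 1) < (a + 1) :: List.replicate k a) : InPlateau s ((h : ℝ) / l) := by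
  have hpre := hL.1.2
  refine ⟨H.upperTail_lt hpre (Or.inl ?_), ?_⟩
  · have hne := hL.ne_of_replicate (isCentralOf_replicate a (k + 1)).isCentral
    rw [block_succ, List.replicate_succ, List.cons_lt_cons_iff] at hgt
    rw [List.length_replicate, block_two, List.cons_lt_cons_iff]
    exact Or.inl (hgt.resolve_right fun h => hne h.1.symm)
  · rw [List.length_replicate] at hpre
    exact toLex_lt_of_block_lt (hpre.trans H.block_lowerTail_replicate.1.symm)
      (hlt.trans_eq H.block_lowerTail_replicate.2.symm)

lemma inPlateau_of_block_replicate (H : IsCentralOf a (List.replicate k a) h l)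
    (hpre : block s 0 (k + 1) = List.replicate (k + 1) a)
    (hgt : (a + 1) :: List.replicate (k + 1) a < block s (k + 1) (k + 2)) :
    InPlateau s ((h : ℝ) / l) := by
  refine ⟨toLex_lt_of_block_lt (H.block_upperTail_replicate.1.trans hpre.symm)
    (H.block_upperTail_replicate.2.trans_lt hgt), ?_⟩
  rw [block_eq_replicate] at hpre
  refine toLex_lt_of_block_lt (n := k) (m := 1) ?_ ?_
  · rw [H.block_lowerTail_replicate.1, block_eq_replicate]
    exact fun i hi => hpre i (by lia)
  · have hhead := H.block_lowerTail_replicate.2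
    rw [block_succ, List.cons.injEq] at hhead
    rw [block_one, block_one, hhead.1, List.cons_lt_cons_iff]
    have := hpre k (by lia)
    rw [zero_add] at this
    exact Or.inl (by lia)

lemma inPlateau_replicate_succ (hL : IsLongestCentralPrefix a s (List.replicate k (a + 1)))
    (H : IsCentralOf a (List.replicate k (a + 1)) h l)
    (hgt : a :: List.replicate k (a + 1) < block s k (k + 1))
    (hlt : block s k (k + 1) < List.replicate (k + 1) (a + 1)) : InPlateau s ((h : ℝ) / l) := by
  have hmap (n : ℕ) : (List.replicate n (a + 1)).map Neg.neg = List.replicate n (-a - 1) := by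
    rw [List.map_replicate, neg_add']
  refine (inPlateau_replicate (hmap k ▸ hL.neg) (hmap k ▸ H.neg) ?_ ?_).of_neg
  · rwa [← hmap, block_neg, map_neg_lt_map_neg (by simp)]
  · rwa [← hmap, sub_add_cancel, ← List.map_cons, block_neg, map_neg_lt_map_neg (by simp)]

lemma inPlateau_of_block_replicate_succ (H : IsCentralOf a (List.replicate k (a + 1)) h l)
    (hpre : block s 0 (k + 1) = List.replicate (k + 1) (a + 1))
    (hlt : block s (k + 1) (k + 2) < a :: List.replicate (k + 1) (a + 1)) :
    InPlateau s ((h : ℝ) / l) := by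
  have hmap (n : ℕ) : (List.replicate n (a + 1)).map Neg.neg = List.replicate n (-a - 1) := by
    rw [List.map_replicate, neg_add']
  refine (inPlateau_of_block_replicate (hmap k ▸ H.neg) ?_ ?_).of_neg
  · rw [← hmap, block_neg, hpre]
  · rwa [← hmap, sub_add_cancel, ← List.map_cons, block_neg, map_neg_lt_map_neg (by simp)]

end Replicate

section FreqIsSharp

variable {a : ℤ} {s : ℕ → ℤ} {u : List ℤ} {φ : ℝ}

lemma pair_lt_add_one_iff {x y c d : ℤ} : [x, y] < [c, d + 1] ↔ [x, y] ≤ [c, d] := by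
  rw [← not_lt (α := List ℤ)]
  simp only [List.cons_lt_cons_iff, List.not_lt_nil]
  lia

lemma pair_lt_iff_add_one_le {x y c d : ℤ} : [c, d] < [x, y] ↔ [c, d + 1] ≤ [x, y] := by
  rw [← not_lt (α := List ℤ)]
  simp only [List.cons_lt_cons_iff, List.not_lt_nil]
  lia

theorem GenericFreq.exists_isCentralOf_inPlateau (hL : IsLongestCentralPrefix a s u)
    (hg : GenericFreq a s u φ) :
    ∃ w h l, IsCentralOf a w h l ∧ φ = (h : ℝ) / l ∧ InPlateau s ((h : ℝ) / l) := by
  cases hg with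
  | powA_low k _ hu hgt hlt =>
    subst hu
    refine ⟨_, _, _, isCentralOf_replicate a k, ?_,
      inPlateau_replicate hL (isCentralOf_replicate a k) hgt hlt⟩
    push_cast; field_simp
  | powA_high k hk hu hgt =>
    obtain ⟨j, rfl⟩ := Nat.exists_eq_add_of_le' hk
    subst hu
    refine ⟨_, _, _, isCentralOf_replicate a j, ?_, inPlateau_of_block_replicate
      (isCentralOf_replicate a j) (by simpa using hL.1.2) hgt⟩
    push_cast; field_simp; ring
  | powB_high k _ hu hgt hlt =>
    subst hu
    refine ⟨_, _, _, isCentralOf_replicate_succ a k, ?_,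
      inPlateau_replicate_succ hL (isCentralOf_replicate_succ a k) hgt hlt⟩
    push_cast; field_simp
  | powB_low k hk hu hlt =>
    obtain ⟨j, rfl⟩ := Nat.exists_eq_add_of_le' hk
    subst hu
    refine ⟨_, _, _, isCentralOf_replicate_succ a j, ?_, inPlateau_of_block_replicate_succ
      (isCentralOf_replicate_succ a j) (by simpa using hL.1.2) hlt⟩
    push_cast; field_simp; ring
  | mixed_u p q xy v _ _ _ _ hxy hv hs =>
    obtain ⟨h, l, H⟩ := hL.1.1.exists_isCentralOf
    exact ⟨u, h, l, H, H.slope_eq.symm, H.inPlateau hL.1.2 (hxy ▸ hv ▸ hs)⟩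
  | mixed_q p q xy v hp hq hu hu' hxy hv hs =>
    obtain ⟨h₂, l₂, Hp⟩ := hp.exists_isCentralOf
    obtain ⟨h₁, l₁, Hq⟩ := hq.exists_isCentralOf
    refine ⟨q, h₁, l₁, Hq, Hq.slope_eq.symm, hL.inPlateau_left Hq Hp hu hu' ?_⟩
    rw [hxy, hv, block_two, ← pair_lt_add_one_iff] at hs
    exact block_two s u.length ▸ hs.symm
  | mixed_p p q xy v hp hq hu hu' hxy hv hs =>
    obtain ⟨h₂, l₂, Hp⟩ := hp.exists_isCentralOf
    obtain ⟨h₁, l₁, Hq⟩ := hq.exists_isCentralOf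
    refine ⟨p, h₂, l₂, Hp, Hp.slope_eq.symm, hL.inPlateau_right Hq Hp hu hu' ?_⟩
    rw [hxy, hv, block_two, ← pair_lt_iff_add_one_le] at hs
    exact block_two s u.length ▸ hs.symm

theorem GenericFreq.isSharpSlope (hL : IsLongestCentralPrefix a s u)
    (hg : GenericFreq a s u φ) : (a : ℝ) ≤ φ ∧ IsSharpSlope (cons (a + 1) s) φ := by
  obtain ⟨w, h, l, H, rfl, hgt, hlt⟩ := hg.exists_isCentralOf_inPlateau hL
  exact ⟨H.lt_slope.le, isSharpSlope_cons_of_mem_Icc H.floor_eq H.ceil_eq hgt.le hlt.le⟩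

theorem WordFreq.isSharpSlope (h : WordFreq a s φ) :
    (a : ℝ) ≤ φ ∧ IsSharpSlope (cons (a + 1) s) φ := by
  rcases h with h | ⟨-, u, hL, hg⟩
  · exact ⟨h.le, h.isSharpSlope⟩
  · exact hg.isSharpSlope hL

end FreqIsSharp

section Compactness

variable {a : ℤ} {s d : ℕ → ℤ} {c e α : ℝ}

lemma eventually_ceil_mul_eq (α : ℝ) (n : ℕ) : ∀ᶠ θ : ℝ in 𝓝[≤] α, ⌈θ * n⌉ = ⌈α * n⌉ := by
  have hlim : Tendsto (fun θ : ℝ => θ * n) (𝓝[≤] α) (𝓝 (α * n)) :=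
    (tendsto_id.mul_const _).mono_left nhdsWithin_le_nhds
  filter_upwards [self_mem_nhdsWithin, hlim.eventually_const_lt
    (show (⌈α * n⌉ : ℝ) - 1 < α * n by linarith [Int.ceil_lt_add_one (α * n)])] with θ hθ hlt
  have hle : θ * n ≤ α * n := mul_le_mul_of_nonneg_right hθ n.cast_nonneg
  exact Int.ceil_eq_iff.2 ⟨hlt, hle.trans (Int.le_ceil _)⟩

lemma eventually_ceil_mul_eq_floor_add_one (α : ℝ) {n : ℕ} (hn : 0 < n) :
    ∀ᶠ θ : ℝ in 𝓝[>] α, ⌈θ * n⌉ = ⌊α * n⌋ + 1 := by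
  have hlim : Tendsto (fun θ : ℝ => θ * n) (𝓝[>] α) (𝓝 (α * n)) :=
    (tendsto_id.mul_const _).mono_left nhdsWithin_le_nhds
  filter_upwards [self_mem_nhdsWithin,
    hlim.eventually_lt_const (Int.lt_floor_add_one (α * n))] with θ hθ hlt
  have hgt : α * n < θ * n := mul_lt_mul_of_pos_right hθ (by exact_mod_cast hn)
  rw [Int.ceil_eq_iff]
  push_cast
  exact ⟨by linarith [Int.floor_le (α * n)], hlt.le⟩

theorem exists_eq_upperMech_or_psum_eq_floor_add_one
    (h : ∀ N : ℕ, ∃ φ ∈ Set.Icc c e, ∀ n ≤ N, psum d n = ⌈φ * n⌉) :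
    ∃ α ∈ Set.Icc c e, d = upperMech α 0 ∨ ∀ n : ℕ, 0 < n → psum d n = ⌊α * n⌋ + 1 := by
  choose φ hφ hd using h
  obtain ⟨α, hα, ψ, hψ, hlim⟩ := isCompact_Icc.tendsto_subseq hφ
  have hge (n : ℕ) : ∀ᶠ k in atTop, psum d n = ⌈φ (ψ k) * n⌉ :=
    (hψ.tendsto_atTop.eventually_ge_atTop n).mono fun k hk => hd _ n hk
  refine ⟨α, hα, ?_⟩
  by_cases hle : ∃ᶠ k in atTop, φ (ψ k) ≤ α
  · refine Or.inl (eq_of_psum fun n => ?_)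
    obtain ⟨k, hk, hceil, hpsum⟩ := (hle.and_eventually ((hlim.eventually
      (eventually_nhdsWithin_iff.1 (eventually_ceil_mul_eq α n))).and (hge n))).exists
    rw [psum_upperMech_zero, hpsum]
    exact hceil hk
  · refine Or.inr fun n hn => ?_
    obtain ⟨k, hk, hceil, hpsum⟩ := ((not_frequently.1 hle).and ((hlim.eventually
      (eventually_nhdsWithin_iff.1 (eventually_ceil_mul_eq_floor_add_one α hn))).and
      (hge n))).exists
    rw [hpsum]
    exact hceil (not_le.1 hk)

lemma cons_eq_lowerMech_of_psum (h : ∀ n : ℕ, 0 < n → psum (cons (a + 1) s) n = ⌊α * n⌋ + 1) :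
    cons a s = lowerMech α 0 := eq_of_psum fun n => by
  rw [psum_lowerMech_zero]
  cases n with
  | zero => simp [psum_zero]
  | succ n =>
    have hn := h (n + 1) n.succ_pos
    rw [psum_cons_succ] at hn ⊢
    linarith

lemma IsCentralOf.psum_cons_eq_ceil {u : List ℤ} {h : ℤ} {l n : ℕ} (H : IsCentralOf a u h l)
    (hu : block s 0 u.length = u) (hn : n ≤ u.length) :
    psum (cons (a + 1) s) n = ⌈(h : ℝ) / l * n⌉ := by
  rw [← psum_upperMech_zero, ← cons_ceil_upperTail, H.ceil_eq]
  refine psum_congr fun k hk => ?_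
  cases k with
  | zero => rfl
  | succ k =>
    have := block_eq_block.1 (hu.trans H.upperTail_prefix.1.symm) k (by lia)
    rwa [zero_add] at this

theorem exists_meagerFreq_of_unbounded
    (h : ∀ N, ∃ w, IsCentral a w ∧ block s 0 w.length = w ∧ N < w.length) :
    ∃ ψ, MeagerFreq a s ψ := by
  obtain ⟨α, hα, hd⟩ := exists_eq_upperMech_or_psum_eq_floor_add_one
    (d := cons (a + 1) s) (c := a) (e := a + 1) fun N => by
      obtain ⟨w, hw, hblock, hlen⟩ := h N
      obtain ⟨h, l, H⟩ := hw.exists_isCentralOf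
      exact ⟨(h : ℝ) / l, ⟨H.lt_slope.le, H.slope_lt.le⟩,
        fun n hn => H.psum_cons_eq_ceil hblock (hn.trans hlen.le)⟩
  exact ⟨α, .mech α hα (hd.symm.imp_left cons_eq_lowerMech_of_psum)⟩

theorem exists_isLongestCentralPrefix (hm : ∀ ψ, ¬ MeagerFreq a s ψ) :
    ∃ u, IsLongestCentralPrefix a s u := by
  classical
  obtain ⟨B, hB⟩ : ∃ B, ∀ w, IsCentral a w → block s 0 w.length = w → w.length ≤ B := by
    by_contra! hunbounded
    obtain ⟨ψ, hψ⟩ := exists_meagerFreq_of_unbounded hunbounded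
    exact hm ψ hψ
  let P (n : ℕ) : Prop := ∃ w, IsCentral a w ∧ block s 0 w.length = w ∧ w.length = n
  have hempty : P 0 := ⟨[], (isCentralOf_replicate a 0).isCentral, rfl, rfl⟩
  obtain ⟨u, hu, hblock, hlen⟩ := Nat.findGreatest_spec (P := P) (Nat.zero_le B) hempty
  refine ⟨u, ⟨hu, hblock⟩, fun w hw hw' => ?_⟩
  rw [hlen]
  exact Nat.le_findGreatest (hB w hw hw') ⟨w, hw, hw', rfl⟩

end Compactness

section Existence

variable {a c : ℤ} {s : ℕ → ℤ} {u p q : List ℤ} {k : ℕ}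

lemma toLex_lt_const_of_block (hpre : block s 0 k = List.replicate k c) (h : s k < c) :
    toLex s < toLex fun _ => c := by
  rw [block_eq_replicate] at hpre
  exact toLex_lt_iff.2 ⟨k, fun j hj => by simpa using hpre j hj, h⟩

lemma const_lt_toLex_of_block (hpre : block s 0 k = List.replicate k c) (h : c < s k) :
    (toLex fun _ => c) < toLex s := by
  rw [block_eq_replicate] at hpre
  exact toLex_lt_iff.2 ⟨k, fun j hj => by simpa using (hpre j hj).symm, h⟩

lemma isCentral_replicate_append_cons (a : ℤ) (k : ℕ) :
    IsCentral a (List.replicate (k + 1) a ++ (a + 1) :: List.replicate (k + 1) a) := by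
  have H := (isCentralOf_replicate a (k + 1)).mediant (isCentralOf_replicate a k)
    (by push_cast; ring)
  simpa [List.replicate_succ] using H.isCentral

namespace IsLongestCentralPrefix

lemma ne_nil (hL : IsLongestCentralPrefix a s u) (hm : ∀ ψ, ¬ MeagerFreq a s ψ) : u ≠ [] := by
  rintro rfl
  have ha : s 0 ≠ a := hL.ne_of_replicate (k := 0) (isCentralOf_replicate a 1).isCentral
  have hb : s 0 ≠ a + 1 :=
    hL.ne_of_replicate (k := 0) (isCentralOf_replicate_succ a 1).isCentral
  rcases ha.lt_or_gt with hlt | hgt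
  · exact hm _ (.low (toLex_lt_of_head_lt hlt).le)
  · exact hm _ (.high (toLex_lt_of_head_lt (hb.lt_of_le' hgt)).le)

lemma block_ne_cons_replicate (hL : IsLongestCentralPrefix a s (List.replicate (k + 1) a)) :
    block s (k + 1) (k + 2) ≠ (a + 1) :: List.replicate (k + 1) a := fun heq => by
  have hpre := hL.1.2
  rw [List.length_replicate] at hpre
  refine hL.block_ne (isCentral_replicate_append_cons a k) (by simp) ?_
  rw [List.length_append, block_add_eq_append rfl]
  simpa using ⟨hpre, heq⟩

lemma block_ne_cons_replicate_succ
    (hL : IsLongestCentralPrefix a s (List.replicate (k + 1) (a + 1))) :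
    block s (k + 1) (k + 2) ≠ a :: List.replicate (k + 1) (a + 1) := fun heq => by
  have hmap : (List.replicate (k + 1) (a + 1)).map Neg.neg = List.replicate (k + 1) (-a - 1) := by
    rw [List.map_replicate, neg_add']
  refine (hmap ▸ hL.neg).block_ne_cons_replicate ?_
  rw [block_neg, heq, ← hmap, sub_add_cancel, List.map_cons]

lemma block_ne_append (hL : IsLongestCentralPrefix a s u) (hp : IsCentral a p) (hq : IsCentral a q)
    (hu : u = p ++ [a, a + 1] ++ q) (hu' : u = q ++ [a + 1, a] ++ p)
    (hpair : block s u.length 2 = [a, a + 1]) :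
    block s (u.length + 2) (u.length + 2) ≠ u ++ [a, a + 1] := fun heq => by
  obtain ⟨h, l, H⟩ := hL.1.1.exists_isCentralOf
  obtain ⟨h₁, l₁, Hq⟩ := hq.exists_isCentralOf
  obtain ⟨h₂, l₂, Hp⟩ := hp.exists_isCentralOf
  have Hm := (H.left_mediant Hq Hp hu hu').1
  refine hL.block_ne Hm.isCentral (by simp)
    (block_eq_append_pair_append.2 ⟨hL.1.2, hpair, ?_⟩)
  have hlen : u.length + 2 = q.length + (p.length + 4) := by simp [hu']; lia
  have happend : u ++ [a, a + 1] = q ++ ([a + 1, a] ++ p ++ [a, a + 1]) := by simp [hu']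
  nth_rw 2 [hlen] at heq
  rw [happend, block_add_eq_append rfl] at heq
  exact heq.1

lemma block_ne_append_swap (hL : IsLongestCentralPrefix a s u) (hp : IsCentral a p)
    (hq : IsCentral a q) (hu : u = p ++ [a, a + 1] ++ q) (hu' : u = q ++ [a + 1, a] ++ p)
    (hpair : block s u.length 2 = [a + 1, a]) :
    block s (u.length + 2) (u.length + 2) ≠ u ++ [a + 1, a] := fun heq => by
  obtain ⟨h₁, l₁, Hq⟩ := hq.exists_isCentralOf
  obtain ⟨h₂, l₂, Hp⟩ := hp.exists_isCentralOf
  have hmap : [-a - 1, -a - 1 + 1] = [a + 1, a].map Neg.neg := by simp [sub_eq_neg_add]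
  refine hL.neg.block_ne_append Hq.neg.isCentral Hp.neg.isCentral
    (by simp [hu', sub_eq_neg_add]) (by simp [hu, sub_eq_neg_add]) ?_ ?_
  · rw [hmap, List.length_map, block_neg, hpair]
  · rw [hmap, List.length_map, block_neg, heq, List.map_append]

lemma exists_genericFreq_replicate (hL : IsLongestCentralPrefix a s (List.replicate (k + 1) a))
    (hm : ∀ ψ, ¬ MeagerFreq a s ψ) : ∃ φ, GenericFreq a s (List.replicate (k + 1) a) φ := by
  have hpre := hL.1.2
  rw [List.length_replicate] at hpre
  have hge : a ≤ s (k + 1) := by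
    by_contra! hlt
    exact hm _ (.low (toLex_lt_const_of_block hpre hlt).le)
  have hgt : a < s (k + 1) :=
    hge.lt_of_ne' (hL.ne_of_replicate (isCentralOf_replicate a (k + 2)).isCentral)
  have hreplicate : List.replicate (k + 1 + 1) a < block s (k + 1) (k + 1 + 1) := by
    rw [block_succ, List.replicate_succ, List.cons_lt_cons_iff]
    exact Or.inl hgt
  rcases lt_trichotomy (block s (k + 1) (k + 1 + 1)) ((a + 1) :: List.replicate (k + 1) a)
    with hlow | heq | hhigh
  · exact ⟨_, .powA_low (k + 1) k.succ_pos rfl hreplicate hlow⟩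
  · exact absurd heq hL.block_ne_cons_replicate
  · exact ⟨_, .powA_high (k + 1) k.succ_pos rfl hhigh⟩

lemma exists_genericFreq_replicate_succ
    (hL : IsLongestCentralPrefix a s (List.replicate (k + 1) (a + 1)))
    (hm : ∀ ψ, ¬ MeagerFreq a s ψ) :
    ∃ φ, GenericFreq a s (List.replicate (k + 1) (a + 1)) φ := by
  have hpre := hL.1.2
  rw [List.length_replicate] at hpre
  have hle : s (k + 1) ≤ a + 1 := by
    by_contra! hgt
    exact hm _ (.high (const_lt_toLex_of_block hpre hgt).le)
  have hlt : s (k + 1) < a + 1 :=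
    hle.lt_of_ne (hL.ne_of_replicate (isCentralOf_replicate_succ a (k + 2)).isCentral)
  have hreplicate : block s (k + 1) (k + 1 + 1) < List.replicate (k + 1 + 1) (a + 1) := by
    rw [block_succ, List.replicate_succ, List.cons_lt_cons_iff]
    exact Or.inl hlt
  rcases lt_trichotomy (block s (k + 1) (k + 1 + 1)) (a :: List.replicate (k + 1) (a + 1))
    with hlow | heq | hhigh
  · exact ⟨_, .powB_low (k + 1) k.succ_pos rfl hlow⟩
  · exact absurd heq hL.block_ne_cons_replicate_succ
  · exact ⟨_, .powB_high (k + 1) k.succ_pos rfl hhigh hreplicate⟩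

lemma exists_genericFreq_append (hL : IsLongestCentralPrefix a s u) (hp : IsCentral a p)
    (hq : IsCentral a q) (hu : u = p ++ [a, a + 1] ++ q) (hu' : u = q ++ [a + 1, a] ++ p) :
    ∃ φ, GenericFreq a s u φ := by
  rcases lt_trichotomy (block s u.length 2) [a, a + 1] with hlt | heq | hgt
  · rw [block_two, pair_lt_add_one_iff, ← block_two] at hlt
    exact ⟨_, .mixed_q p q _ _ hp hq hu hu' rfl rfl (Or.inr hlt)⟩
  · rcases (hL.block_ne_append hp hq hu hu' heq).lt_or_gt with hlt | hgt
    · exact ⟨_, .mixed_q p q _ _ hp hq hu hu' rfl rfl (Or.inl ⟨heq, hlt⟩)⟩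
    · exact ⟨_, .mixed_u p q _ _ hp hq hu hu' rfl rfl (Or.inl ⟨heq, hgt⟩)⟩
  rcases lt_trichotomy (block s u.length 2) [a + 1, a] with hlt' | heq | hgt'
  · exact ⟨_, .mixed_u p q _ _ hp hq hu hu' rfl rfl (Or.inr (Or.inl ⟨hgt, hlt'⟩))⟩
  · rcases (hL.block_ne_append_swap hp hq hu hu' heq).lt_or_gt with hlt | hgt
    · exact ⟨_, .mixed_u p q _ _ hp hq hu hu' rfl rfl (Or.inr (Or.inr ⟨heq, hlt⟩))⟩
    · exact ⟨_, .mixed_p p q _ _ hp hq hu hu' rfl rfl (Or.inl ⟨heq, hgt⟩)⟩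
  · rw [block_two, pair_lt_iff_add_one_le, ← block_two] at hgt'
    exact ⟨_, .mixed_p p q _ _ hp hq hu hu' rfl rfl (Or.inr hgt')⟩

theorem exists_genericFreq (hL : IsLongestCentralPrefix a s u) (hm : ∀ ψ, ¬ MeagerFreq a s ψ) :
    ∃ φ, GenericFreq a s u φ := by
  obtain ⟨h, l, H⟩ := hL.1.1.exists_isCentralOf
  rcases H.eq_replicate_or_eq_append with ⟨_ | k, rfl⟩ | ⟨_ | k, rfl⟩ | ⟨p, q, hp, hq, hu, hu'⟩
  · exact absurd rfl (hL.ne_nil hm)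
  · exact hL.exists_genericFreq_replicate hm
  · exact absurd rfl (hL.ne_nil hm)
  · exact hL.exists_genericFreq_replicate_succ hm
  · exact hL.exists_genericFreq_append hp hq hu hu'

end IsLongestCentralPrefix

theorem exists_wordFreq (a : ℤ) (s : ℕ → ℤ) : ∃ φ, WordFreq a s φ := by
  by_cases hm : ∃ ψ, MeagerFreq a s ψ
  · exact hm.imp fun _ => Or.inl
  · rw [not_exists] at hm
    obtain ⟨u, hL⟩ := exists_isLongestCentralPrefix hm
    obtain ⟨φ, hφ⟩ := hL.exists_genericFreq hm
    exact ⟨φ, Or.inr ⟨hm, u, hL, hφ⟩⟩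

end Existence

section Freq

variable {a : ℤ} {s : ℕ → ℤ} {α β φ ψ : ℝ}

lemma WordFreq.unique (ha : 0 ≤ a) (hφ : WordFreq a s φ) (hψ : WordFreq a s ψ) : φ = ψ := by
  have ha' : (0 : ℝ) ≤ a := by exact_mod_cast ha
  exact hφ.isSharpSlope.2.unique hψ.isSharpSlope.2 (ha'.trans hφ.isSharpSlope.1)
    (ha'.trans hψ.isSharpSlope.1)

lemma dbar_one_intCast (m : ℤ) : dbar m 1 = fun _ => m - 1 := by
  have hdigit : dbar m 1 0 = m - 1 := by rw [dbar_zero, mul_one, Int.ceil_intCast]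
  have hfixed : Tbar m 1 = 1 := by
    rw [Tbar_eq, hdigit]
    push_cast
    ring
  funext n
  induction n with
  | zero => exact hdigit
  | succ n ih => rw [dbar_succ, hfixed, ih]

lemma dbar_one_eq_cons_floor (hβ : ¬ ∃ m : ℤ, β = m) :
    dbar β 1 = cons ⌊β⌋ (shift (dbar β 1) 1) := by
  have hdigit : dbar β 1 0 = ⌊β⌋ := by
    rw [dbar_zero, mul_one, sub_eq_iff_eq_add, Int.ceil_eq_floor_add_one_iff_notMem]
    exact fun ⟨m, hm⟩ => hβ ⟨m, hm.symm⟩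
  rw [← hdigit, cons_shift]

lemma isFreq_intCast_iff (m : ℤ) : IsFreq m φ ↔ φ = m - 1 := by simp [IsFreq]

lemma isFreq_iff_wordFreq (hβ : ¬ ∃ m : ℤ, β = m) :
    IsFreq β φ ↔ WordFreq (⌊β⌋ - 1) (shift (dbar β 1) 1) φ := by
  refine ⟨?_, fun h => Or.inr ⟨hβ, _, dbar_one_eq_cons_floor hβ, h⟩⟩
  rintro (⟨hint, -⟩ | ⟨-, s, hs, h⟩)
  · exact absurd hint hβ
  · rwa [hs]

theorem exists_isFreq (hβ : 1 < β) :
    ∃ φ, (∀ ψ, IsFreq β ψ ↔ ψ = φ) ∧ IsSharpSlope (dbar β 1) φ := by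
  by_cases hint : ∃ m : ℤ, β = m
  · obtain ⟨m, rfl⟩ := hint
    refine ⟨m - 1, fun ψ => isFreq_intCast_iff m, ?_⟩
    rw [dbar_one_intCast]
    simpa using isSharpSlope_const (m - 1)
  · have hfloor : 0 ≤ ⌊β⌋ - 1 := sub_nonneg.2 (Int.le_floor.2 (by exact_mod_cast hβ.le))
    obtain ⟨φ, hφ⟩ := exists_wordFreq (⌊β⌋ - 1) (shift (dbar β 1) 1)
    refine ⟨φ, fun ψ => ?_, ?_⟩
    · rw [isFreq_iff_wordFreq hint]
      exact ⟨fun hψ => hψ.unique hfloor hφ, fun h => h ▸ hφ⟩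
    · rw [dbar_one_eq_cons_floor hint, ← sub_add_cancel ⌊β⌋ 1]
      exact hφ.isSharpSlope.2

theorem exists_isDelta (hα : 0 < α) :
    ∃ δ > 1, dbar δ 1 = upperMech α 0 ∧ ∀ η, IsDelta α η ↔ η = δ := by
  obtain ⟨δ, hδ, hd⟩ := exists_dbar_one_eq_upperMech hα
  refine ⟨δ, hδ, hd, fun η => ⟨?_, fun h => h ▸ Or.inr ⟨hα, hδ, hd⟩⟩⟩
  rintro (⟨h, -⟩ | ⟨-, hη, hdη⟩)
  · exact absurd h hα.ne'
  · exact dbar_one_strictMonoOn.injOn hη hδ (congrArg toLex (hdη.trans hd.symm))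

end Freq

end BetaOrbit

theorem theorem4 :
    -- (a) for fixed base, `Freq(β)` is a well-defined number, and it is the sharp bound
    (∀ β : ℝ, 1 < β → ∃ φ : ℝ, (∀ ψ : ℝ, IsFreq β ψ ↔ ψ = φ) ∧
      (∀ α : ℝ, 0 < α → α ≤ φ → XiWellDefined α β) ∧
      (∀ α : ℝ, 0 < α → φ < α → ¬ ∃ S : Set ℝ, IsXiSet α β S)) ∧
    -- (b) for fixed frequency, `Δ(α)` is a well-defined number, and it is the sharp bound
    (∀ α : ℝ, 0 < α → ∃ δ : ℝ, (∀ η : ℝ, IsDelta α η ↔ η = δ) ∧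
      (∀ β : ℝ, δ ≤ β → XiWellDefined α β) ∧
      (∀ β : ℝ, 1 < β → β < δ → ¬ ∃ S : Set ℝ, IsXiSet α β S)) ∧
    -- (c) the case of a mechanical expansion of `1`
    (∀ β α₀ : ℝ, 1 < β → IsMechanical (dbar β 1) α₀ →
      ∀ α : ℝ, 0 < α → α ≤ α₀ → XiWellDefined α β) := by
  refine ⟨fun β hβ => ?_, fun α hα => ?_, fun β α₀ hβ hmech α hα hle => ?_⟩
  · obtain ⟨φ, hφ, hsharp⟩ := exists_isFreq hβ
    refine ⟨φ, hφ, fun α hα hle => xiWellDefined_of_upperMech_le hα hβ ((hsharp α hα).2 hle), ?_⟩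
    rintro α hα hlt ⟨S, hS⟩
    exact hlt.not_ge ((hsharp α hα).1 (upperMech_le_of_isXiSet hβ hS))
  · obtain ⟨δ, hδ, hd, hunique⟩ := exists_isDelta hα
    refine ⟨δ, hunique, fun β hle => ?_, ?_⟩
    · have hβ : 1 < β := lt_of_lt_of_le hδ hle
      have hmono : toLex (dbar δ 1) ≤ toLex (dbar β 1) :=
        dbar_one_strictMonoOn.monotoneOn hδ hβ hle
      exact xiWellDefined_of_upperMech_le hα hβ (hd ▸ hmono)
    · rintro β hβ hlt ⟨S, hS⟩
      have hdlt : toLex (dbar β 1) < toLex (dbar δ 1) := dbar_one_strictMonoOn hβ hδ hlt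
      exact hdlt.not_ge (hd ▸ upperMech_le_of_isXiSet hβ hS)
  · have hmean := upperMech_le_of_hasMean hmech.hasMean (shift_dbar_one_le hβ)
    exact xiWellDefined_of_upperMech_le hα hβ ((upperMech_strictMono.monotone hle).trans hmean)
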